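/- Let $N\ge 2$, $p\in(1,2)$, $s_1\in(0,1)$, $s_p\in\left(0,\frac{p-1}{p}\right]$ and $\gamma\in\left(0,\frac{s_pp}{p-1}\right)$. Then there exist constants $C>0$ and $\kappa>0$, depending only on $N,p,s_1,s_p,\gamma$, such that the following holds for every bounded domain $\Omega\subset\mathbb{R}^N$ and every locally bounded (i.e. $L^\infty_{\mathrm{loc}}(\Omega)$) weak solution $u$ of $$(-\Delta_1)^{s_1}u+(-\Delta_p)^{s_p}u=0\quad\text{in }\Omega .$$ We have $u\in C^{0,\gamma}_{\mathrm{loc}}(\Omega)$ (that is, after modification on a null set, $[u]_{C^{0,\gamma}(B)}:=\sup_{x\ne y\in B}\frac{|u(x)-u(y)|}{|x-y|^\gamma}<\infty$ for every ball $B\subset\subset\Omega$), and for every ball $B_R=B_R(x_0)\subset\subset\Omega$ with $R\in(0,1)$ and every $r\in(0,R)$, with $B_r=B_r(x_0)$, $$[u]_{C^{0,\gamma}(B_r)}\le\frac{C\left(\|u\|_{L^\infty(B_R)}+\mathrm{Tail}(u;x_0,R)+[u]_{W^{s_p,p}(B_R)}+1\right)}{(R-r)^{\kappa}} .$$ Here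 $$[u]_{W^{s,q}(U)}=\left(\int_U\int_U\frac{|u(x)-u(y)|^q}{|x-y|^{N+sq}}\,dx\,dy\right)^{1/q},\qquad \mathrm{Tail}(u;x_0,R)=\left(R^{s_pp}\int_{\mathbb{R}^N\setminus B_R(x_0)}\frac{|u(x)|^{p-1}}{|x-x_0|^{N+s_pp}}\,dx\right)^{\frac1{p-1}},$$ $W^{s,q}(U)$ is the set of $u\in L^q(U)$ with $[u]_{W^{s,q}(U)}<\infty$, and $W^{s,q}_{\mathrm{loc}}(\Omega)$ is the set of $u$ lying in $W^{s,q}(V)$ for every open $V\subset\subset\Omega$. A weak solution is a function $u\in W^{s_1,1}_{\mathrm{loc}}(\Omega)\cap W^{s_p,p}_{\mathrm{loc}}(\Omega)\cap L^p_{\mathrm{loc}}(\mathbb{R}^N)$ with $\int_{\mathbb{R}^N}\frac{|u(x)|^{p-1}}{(1+|x|)^{N+s_pp}}\,dx<\infty$ for which there is $Z\in L^\infty(\mathbb{R}^N\times\mathbb{R}^N)$ such that, for almost every $(x,y)$, $Z(x,y)=\frac{u(x)-u(y)}{|u(x)-u(y)|}$ if $u(x)\ne u(y)$ and $Z(x,y)\in[-1,1]$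 if $u(x)=u(y)$, and such that $$0=\int_{\mathbb{R}^N}\int_{\mathbb{R}^N}Z(x,y)\frac{\varphi(x)-\varphi(y)}{|x-y|^{N+s_1}}\,dx\,dy+\int_{\mathbb{R}^N}\int_{\mathbb{R}^N}\frac{|u(x)-u(y)|^{p-2}(u(x)-u(y))(\varphi(x)-\varphi(y))}{|x-y|^{N+s_pp}}\,dx\,dy$$ for every $\varphi\in W^{s_1,1}(\mathbb{R}^N)\cap W^{s_p,p}(\mathbb{R}^N)$ that vanishes a.e. outside a compact subset of $\Omega$. -/

import Mathlib

open MeasureTheory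
open scoped ENNReal

namespace FracOneP

/-- Euclidean space `ℝ^N` with its Euclidean norm. -/
abbrev Sp (N : ℕ) : Type := EuclideanSpace ℝ (Fin N)

/-- `V ⊂⊂ Ω`: the closure of `V` is a compact subset of `Ω`. -/
def CompactlyInside {N : ℕ} (V Ω : Set (Sp N)) : Prop :=
  IsCompact (closure V) ∧ closure V ⊆ Ω

/-- `L^q_loc(Ω)`, for `q ∈ [1, ∞]`. -/
def MemLpLoc {N : ℕ} (u : Sp N → ℝ) (q : ℝ≥0∞) (Ω : Set (Sp N)) : Prop :=
  ∀ V : Set (Sp N), IsOpen V → CompactlyInside V Ω → MemLp u q (volume.restrict V)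

/-- The Gagliardo seminorm
`[u]_{W^{s,q}(U)} = (∫_U ∫_U |u(x) - u(y)|^q / |x - y|^{N + s q} dx dy)^{1/q} ∈ [0, ∞]`. -/
noncomputable def gagliardo {N : ℕ} (u : Sp N → ℝ) (s q : ℝ) (U : Set (Sp N)) : ℝ≥0∞ :=
  (∫⁻ x in U, ∫⁻ y in U,
    ENNReal.ofReal (|u x - u y| ^ q / ‖x - y‖ ^ ((N : ℝ) + s * q))) ^ (1 / q)

/-- The fractional Sobolev space `W^{s,q}(U)`. -/
def MemW {N : ℕ} (u : Sp N → ℝ) (s q : ℝ) (U : Set (Sp N)) : Prop :=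
  MemLp u (ENNReal.ofReal q) (volume.restrict U) ∧ gagliardo u s q U < ⊤

/-- The local fractional Sobolev space `W^{s,q}_loc(Ω)`. -/
def MemWLoc {N : ℕ} (u : Sp N → ℝ) (s q : ℝ) (Ω : Set (Sp N)) : Prop :=
  ∀ V : Set (Sp N), IsOpen V → CompactlyInside V Ω → MemW u s q V

/-- Test functions: elements of `W^{s,q}(ℝ^N)` that vanish almost everywhere outside some compact
subset of `Ω`. -/
def MemWZero {N : ℕ} (φ : Sp N → ℝ) (s q : ℝ) (Ω : Set (Sp N)) : Prop :=
  MemW φ s q Set.univ ∧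
    ∃ K : Set (Sp N), IsCompact K ∧ K ⊆ Ω ∧ ∀ᵐ x, x ∉ K → φ x = 0

/-- The tail space `L^{p-1}_{s p}(ℝ^N)`: functions `u ∈ L^p_loc(ℝ^N)` with
`∫ |u|^{p-1} / (1 + |x|)^{N + s p} dx < ∞`. -/
def MemTailSpace {N : ℕ} (u : Sp N → ℝ) (s p : ℝ) : Prop :=
  MemLpLoc u (ENNReal.ofReal p) Set.univ ∧
    ∫⁻ x, ENNReal.ofReal (|u x| ^ (p - 1) / (1 + ‖x‖) ^ ((N : ℝ) + s * p)) < ⊤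

/-- `Tail(u; x₀, R) = (R^{s p} ∫_{ℝ^N \ B_R(x₀)} |u|^{p-1} / |x - x₀|^{N + s p} dx)^{1/(p-1)}`. -/
noncomputable def tail {N : ℕ} (u : Sp N → ℝ) (s p : ℝ) (x₀ : Sp N) (R : ℝ) : ℝ≥0∞ :=
  (ENNReal.ofReal (R ^ (s * p)) *
    ∫⁻ x in (Metric.ball x₀ R)ᶜ,
      ENNReal.ofReal (|u x| ^ (p - 1) / ‖x - x₀‖ ^ ((N : ℝ) + s * p))) ^ (1 / (p - 1))

/-- The set-valued sign: `sgn(a) = {a / |a|}` for `a ≠ 0` and `sgn(0) = [-1, 1]`. -/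
def sgnSet (a : ℝ) : Set ℝ :=
  {t | (a = 0 → t ∈ Set.Icc (-1 : ℝ) 1) ∧ (a ≠ 0 → t = a / |a|)}

/-- Weak solutions of `(-Δ₁)^{s₁} u + (-Δ_p)^{s_p} u = 0` in `Ω`. For `u` in the stated class and
`φ` with compact support in `Ω` both integrands below are absolutely integrable on `ℝ^N × ℝ^N`. -/
structure IsWeakSolution {N : ℕ} (Ω : Set (Sp N)) (p s₁ sₚ : ℝ) (u : Sp N → ℝ) : Prop where
  memW_one : MemWLoc u s₁ 1 Ω
  memW_p : MemWLoc u sₚ p Ω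
  memTail : MemTailSpace u sₚ p
  weak : ∃ Z : Sp N × Sp N → ℝ, MemLp Z ⊤ volume ∧
    (∀ᵐ z : Sp N × Sp N, Z z ∈ sgnSet (u z.1 - u z.2)) ∧
    ∀ φ : Sp N → ℝ, MemWZero φ s₁ 1 Ω → MemWZero φ sₚ p Ω →
      0 = (∫ z : Sp N × Sp N, Z z * (φ z.1 - φ z.2) / ‖z.1 - z.2‖ ^ ((N : ℝ) + s₁)) +
        ∫ z : Sp N × Sp N,
          |u z.1 - u z.2| ^ (p - 2) * (u z.1 - u z.2) * (φ z.1 - φ z.2) /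
            ‖z.1 - z.2‖ ^ ((N : ℝ) + sₚ * p)

/-- The Hölder seminorm `sup_{x ≠ y ∈ B} |v(x) - v(y)| / |x - y|^γ ∈ [0, ∞]`. -/
noncomputable def holderSeminorm {N : ℕ} (v : Sp N → ℝ) (γ : ℝ) (B : Set (Sp N)) : ℝ≥0∞ :=
  ⨆ (x ∈ B) (y ∈ B) (_ : x ≠ y), ENNReal.ofReal (|v x - v y| / ‖x - y‖ ^ γ)

/-- `C^{0,γ}_loc(Ω)`: the `γ`-Hölder seminorm is finite on every ball `B_R(x₀) ⊂⊂ Ω` (this entails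
continuity and boundedness on the ball, as `γ > 0`). -/
def MemHolderLoc {N : ℕ} (v : Sp N → ℝ) (γ : ℝ) (Ω : Set (Sp N)) : Prop :=
  ∀ (x₀ : Sp N) (R : ℝ), 0 < R → CompactlyInside (Metric.ball x₀ R) Ω →
    holderSeminorm v γ (Metric.ball x₀ R) < ⊤

/-- `𝒯 = ‖u‖_{L^∞(B_R(x₀))} + Tail(u; x₀, R)`. -/
noncomputable def supPlusTail {N : ℕ} (u : Sp N → ℝ) (s p : ℝ) (x₀ : Sp N) (R : ℝ) : ℝ≥0∞ :=
  eLpNorm u ⊤ (volume.restrict (Metric.ball x₀ R)) + tail u s p x₀ R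

end FracOneP

/-! Consider first a solution in the unit ball with |u| ≤ 1, bounded tail and a coefficient lam ∈
[0, 1] on the 1-part. Subtracting the equation from its translate by h gives an equation for w = u(·
+ h) - u whose kernel has the sign of w(x) - w(y), because both t ↦ |t|^{p-2} t and the multivalued
sign are monotone. Test it with a cutoff times the excess v = (w - M)_+. Up to the terms where the
cutoff varies, the 1-part has the good sign and can be dropped. The remaining errors are v times a
kernel of finite mass, since s₁ < 1 and sₚ p ≤ p - 1 < 1 make min(1, |z|) |z|^{-N-s} integrable for
s = s₁ and s = sₚ p.

Coercivity comes from a Hölder bound of exponent γ already known, with constant H. Increments of u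
over distances below ρ are at most H ρ^γ, and since p < 2 the slope of t ↦ |t|^{p-2} t there is at
least (p-1)(H ρ^γ)^{p-2}. If |h| is much smaller than ρ, the mean of w over B_ρ(x) is small: the
integrals of u over B_ρ(x+h) and B_ρ(x) differ only on two thin shells. So the integral of (M - w)_+
over B_ρ(x) is at least M |B_ρ| / 2, and pairing points with w > M against points with w < M yields
(`caccioppoli`) c ρ^{-σ} M ∫_{B_r} v ≤ C ∫_{B_{r+4ε}} v, with σ = sₚ p + (2-p) γ. For M = |h|^{γ'},
the mean condition permits ρ ~ |h|^θ with θ = (1-γ')/(1-γ), so each use gains |h|^δ with δ = σ θ -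
γ'. If δ > 0, finitely many uses on growing balls give ∫ v ≤ C |h|^{nδ} with nδ > N + 1
(`excess_decay`). Then averages of u at scale D differ by O(D^{γ'}) (`average_sub_average_le`), and
a dyadic argument turns this into a Hölder bound of exponent γ' (`UnitHolder.improve`). At γ' = γ
the condition δ > 0 reads γ (p-1) < sₚ p, so steps of a fixed size lead from exponent 0 to any
exponent below sₚ p / (p-1) (`unitHolder_of_lt`).

A general solution is rescaled from a ball of radius d to the unit ball and divided by T
d^{-(N+2)/(p-1)}, where T dominates its size (`IsWeakSolution.normalize`,
`exists_holder_half_ball`). This forces both lam ≤ 1 and the tail bound, at the price of a power of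
d. Pointwise statements hold for the representative given by limits of ball averages. -/

namespace FracOneP

open Metric Set Filter Topology

/-! ### The monotone function `t ↦ |t|^{p-2} t` and the set-valued sign -/

/-- The odd power `|t|^{p-2} t`. -/
noncomputable def signedPow (p t : ℝ) : ℝ := |t| ^ (p - 2) * t

theorem signedPow_neg (p t : ℝ) : signedPow p (-t) = -signedPow p t := by
  simp [signedPow]

theorem signedPow_of_nonneg {p t : ℝ} (hp : 1 < p) (ht : 0 ≤ t) : signedPow p t = t ^ (p - 1) := by
  unfold signedPow
  rcases ht.eq_or_lt with rfl | h
  · rw [Real.zero_rpow (by linarith)]; simp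
  · rw [abs_of_pos h, show p - 1 = (p - 2) + 1 by ring, Real.rpow_add_one h.ne']

theorem abs_signedPow {p : ℝ} (hp : 1 < p) (t : ℝ) : |signedPow p t| = |t| ^ (p - 1) := by
  rw [← signedPow_of_nonneg hp (abs_nonneg t)]
  simp only [signedPow, abs_mul, abs_abs]
  rw [abs_of_nonneg (Real.rpow_nonneg (abs_nonneg t) _)]

/-- Bernoulli's inequality for the concave power p - 1 ∈ (0, 1), applied to s / t, gives the slope
(p-1) t^{p-2}; since p - 2 < 0 this is at least (p-1) m^{p-2}. -/
theorem rpow_sub_rpow_ge {p m s t : ℝ} (hp : 1 < p) (hp2 : p < 2) (hs : 0 ≤ s) (hst : s ≤ t)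
    (htm : t ≤ m) : (p - 1) * m ^ (p - 2) * (t - s) ≤ t ^ (p - 1) - s ^ (p - 1) := by
  rcases (hs.trans hst).eq_or_lt with rfl | ht
  · have : s = 0 := le_antisymm hst hs
    simp [this]
  have h1 : (s / t) ^ (p - 1) ≤ 1 + (p - 1) * (s / t - 1) := by
    have := rpow_one_add_le_one_add_mul_self (s := s / t - 1) (p := p - 1)
      (by have := div_nonneg hs ht.le; linarith) (by linarith) (by linarith)
    simpa using this
  rw [Real.div_rpow hs ht.le, div_le_iff₀ (Real.rpow_pos_of_pos ht _)] at h1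
  have h2 : t ^ (p - 1) = t ^ (p - 2) * t := by
    rw [show p - 1 = (p - 2) + 1 by ring, Real.rpow_add_one ht.ne']
  have h3 : m ^ (p - 2) ≤ t ^ (p - 2) := Real.rpow_le_rpow_of_nonpos ht htm (by linarith)
  have h4 : (1 + (p - 1) * (s / t - 1)) * t ^ (p - 1)
      = t ^ (p - 1) - (p - 1) * t ^ (p - 2) * (t - s) := by
    rw [h2]; field_simp; ring
  have h5 : (p - 1) * m ^ (p - 2) * (t - s) ≤ (p - 1) * t ^ (p - 2) * (t - s) := by
    have := mul_le_mul_of_nonneg_left h3 (by linarith : 0 ≤ p - 1)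
    exact mul_le_mul_of_nonneg_right this (by linarith)
  linarith

/-- The only source of coercivity: on bounded increments the singular nonlinearity has slope bounded
below. Oddness reduces to arguments of one sign, and opposite signs are split at 0. -/
theorem signedPow_sub_ge {p m a b : ℝ} (hp : 1 < p) (hp2 : p < 2) (ha : |a| ≤ m) (hb : |b| ≤ m)
    (hab : b ≤ a) : (p - 1) * m ^ (p - 2) * (a - b) ≤ signedPow p a - signedPow p b := by
  have key : ∀ {s t : ℝ}, 0 ≤ s → s ≤ t → t ≤ m →
      (p - 1) * m ^ (p - 2) * (t - s) ≤ signedPow p t - signedPow p s := by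
    intro s t hs hst htm
    rw [signedPow_of_nonneg hp hs, signedPow_of_nonneg hp (hs.trans hst)]
    exact rpow_sub_rpow_ge hp hp2 hs hst htm
  have h0 : signedPow p 0 = 0 := by simp [signedPow]
  rcases le_total 0 b with hb0 | hb0
  · exact key hb0 hab ((le_abs_self a).trans ha)
  · have hb' : signedPow p b = -signedPow p (-b) := by rw [signedPow_neg, neg_neg]
    rcases le_total 0 a with ha0 | ha0
    · have h1 := key le_rfl ha0 ((le_abs_self a).trans ha)
      have h2 := key le_rfl (neg_nonneg.2 hb0) ((neg_le_abs b).trans hb)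
      rw [h0] at h1 h2
      rw [hb']
      linarith
    · have h1 := key (neg_nonneg.2 ha0) (neg_le_neg hab) ((neg_le_abs b).trans hb)
      rw [signedPow_neg, signedPow_neg] at h1
      linarith

theorem signedPow_mono {p a b : ℝ} (hp : 1 < p) (hp2 : p < 2) (hab : b ≤ a) :
    signedPow p b ≤ signedPow p a := by
  have h := signedPow_sub_ge hp hp2 (le_max_left |a| |b|) (le_max_right |a| |b|) hab
  have : 0 ≤ (p - 1) * (max |a| |b|) ^ (p - 2) * (a - b) :=
    mul_nonneg (mul_nonneg (by linarith) (Real.rpow_nonneg (by positivity) _)) (by linarith)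
  linarith

theorem abs_sub_rpow_le {q a b : ℝ} (hq : 0 ≤ q) (hq1 : q ≤ 1) :
    |a - b| ^ q ≤ |a| ^ q + |b| ^ q :=
  (Real.rpow_le_rpow (abs_nonneg _) (abs_sub a b) hq).trans
    (Real.rpow_add_le_add_rpow (abs_nonneg _) (abs_nonneg _) hq hq1)

theorem abs_le_one_of_mem_sgnSet {a t : ℝ} (h : t ∈ sgnSet a) : |t| ≤ 1 := by
  by_cases ha : a = 0
  · exact abs_le.2 (h.1 ha)
  · rw [h.2 ha, abs_div, abs_abs, div_self (abs_ne_zero.2 ha)]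

/-- Monotonicity of the sign graph, whichever values are selected at 0. Together with |Z| ≤ 1, it is
what the estimates use about the 1-part. -/
theorem sgnSet_mono {a b s t : ℝ} (hs : s ∈ sgnSet a) (ht : t ∈ sgnSet b) (hab : b < a) :
    t ≤ s := by
  rcases lt_trichotomy a 0 with ha | ha | ha
  · have hb : b < 0 := hab.trans ha
    rw [hs.2 ha.ne, ht.2 hb.ne, abs_of_neg ha, abs_of_neg hb, div_neg, div_neg, div_self ha.ne,
      div_self hb.ne]
  · rw [ht.2 (by linarith : b < 0).ne, abs_of_neg (by linarith : b < 0), div_neg,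
      div_self (by linarith : b < 0).ne]
    exact (hs.1 ha).1
  · rw [hs.2 ha.ne', abs_of_pos ha, div_self ha.ne']
    exact (abs_le.1 (abs_le_one_of_mem_sgnSet ht)).2

/-! ### The truncated kernel `min(1, |z|) |z|^{-N-s}` -/

/-- The kernel `min(1, |z|) / |z|^{N+s}`, integrable for `0 < s < 1`. -/
noncomputable def truncKernel {N : ℕ} (s : ℝ) (z : Sp N) : ℝ := min 1 ‖z‖ / ‖z‖ ^ ((N : ℝ) + s)

theorem truncKernel_nonneg {N : ℕ} (s : ℝ) (z : Sp N) : 0 ≤ truncKernel s z := by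
  unfold truncKernel; positivity

theorem truncKernel_neg {N : ℕ} (s : ℝ) (z : Sp N) : truncKernel s (-z) = truncKernel s z := by
  simp [truncKernel]

theorem truncKernel_sub_comm {N : ℕ} (s : ℝ) (x y : Sp N) :
    truncKernel s (x - y) = truncKernel s (y - x) := by
  rw [← truncKernel_neg, neg_sub]

@[fun_prop]
theorem measurable_truncKernel {N : ℕ} (s : ℝ) : Measurable (truncKernel s : Sp N → ℝ) := by
  unfold truncKernel; fun_prop

/-- In polar coordinates the density is r^{-s} on (0, 1] and r^{-1-s} beyond, integrable precisely
because 0 < s < 1. -/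
theorem integrable_truncKernel {N : ℕ} (hN : 1 ≤ N) {s : ℝ} (hs : 0 < s) (hs1 : s < 1) :
    Integrable (truncKernel s : Sp N → ℝ) := by
  have : Nonempty (Fin N) := ⟨⟨0, hN⟩⟩
  have : Nontrivial (Sp N) := inferInstance
  have h := integrable_fun_norm_addHaar (volume : Measure (Sp N))
    (f := fun r : ℝ => min 1 r / r ^ ((N : ℝ) + s))
  refine h.2 ?_
  rw [finrank_euclideanSpace, Fintype.card_fin]
  have hsplit : Ioi (0 : ℝ) = Ioc 0 1 ∪ Ioi 1 := (Ioc_union_Ioi_eq_Ioi zero_le_one).symm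
  have hcast : ∀ r : ℝ, 0 < r → r ^ (N - 1) = r ^ ((N : ℝ) - 1) := by
    intro r _
    rw [← Real.rpow_natCast, Nat.cast_sub hN, Nat.cast_one]
  rw [hsplit]
  refine IntegrableOn.union ?_ ?_
  · have : IntegrableOn (fun r : ℝ => r ^ (-s)) (Ioc 0 1) :=
      (intervalIntegrable_iff_integrableOn_Ioc_of_le zero_le_one).1
        (intervalIntegral.intervalIntegrable_rpow' (by linarith))
    refine this.congr_fun (fun r hr => ?_) measurableSet_Ioc
    have hr0 : 0 < r := hr.1
    simp only [smul_eq_mul, min_eq_right hr.2]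
    rw [hcast r hr0]
    rw [show -s = ((N : ℝ) - 1) + 1 - ((N : ℝ) + s) by ring, Real.rpow_sub hr0,
      Real.rpow_add_one hr0.ne']
    ring
  · have : IntegrableOn (fun r : ℝ => r ^ (-1 - s)) (Ioi 1) :=
      integrableOn_Ioi_rpow_of_lt (by linarith) zero_lt_one
    refine this.congr_fun (fun r hr => ?_) measurableSet_Ioi
    have hr0 : 0 < r := zero_lt_one.trans hr
    simp only [smul_eq_mul, min_eq_left (le_of_lt (mem_Ioi.1 hr))]
    rw [hcast r hr0]
    rw [show -1 - s = ((N : ℝ) - 1) - ((N : ℝ) + s) by ring, Real.rpow_sub hr0]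
    ring

/-- The total mass of the truncated kernel. -/
noncomputable def kernelMass (N : ℕ) (s : ℝ) : ℝ≥0∞ :=
  ∫⁻ z : Sp N, ENNReal.ofReal (truncKernel s z)

theorem kernelMass_lt_top {N : ℕ} (hN : 1 ≤ N) {s : ℝ} (hs : 0 < s) (hs1 : s < 1) :
    kernelMass N s < ⊤ := by
  have h := (integrable_truncKernel hN hs hs1).hasFiniteIntegral
  rwa [hasFiniteIntegral_iff_ofReal (ae_of_all _ (truncKernel_nonneg s))] at h

theorem lintegral_truncKernel_sub {N : ℕ} (s : ℝ) (x : Sp N) :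
    ∫⁻ y : Sp N, ENNReal.ofReal (truncKernel s (x - y)) = kernelMass N s := by
  rw [kernelMass]
  exact lintegral_sub_left_eq_self (fun z : Sp N => ENNReal.ofReal (truncKernel s z)) x

/-- Away from the diagonal the kernel `|z|^{-N-s}` is controlled by the truncated one. -/
theorem inv_rpow_le_truncKernel {N : ℕ} {s ε : ℝ} {z : Sp N} (hε : 0 < ε) (hε1 : ε ≤ 1)
    (hz : ε ≤ ‖z‖) : 1 / ‖z‖ ^ ((N : ℝ) + s) ≤ ε⁻¹ * truncKernel s z := by
  unfold truncKernel
  have h1 : ε ≤ min 1 ‖z‖ := le_min hε1 hz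
  have h2 : 0 < ‖z‖ ^ ((N : ℝ) + s) := Real.rpow_pos_of_pos (hε.trans_le hz) _
  rw [← mul_div_assoc]
  refine div_le_div_of_nonneg_right ?_ h2.le
  rw [inv_mul_eq_div, le_div_iff₀ hε]
  linarith

/-! ### Energies on products and admissible test functions -/

variable {N : ℕ}

/-- The `q`-th power of the Gagliardo seminorm, as an integral over the product space. -/
noncomputable def energy (u : Sp N → ℝ) (s q : ℝ) (U : Set (Sp N)) : ℝ≥0∞ :=
  ∫⁻ z in U ×ˢ U, ENNReal.ofReal (|u z.1 - u z.2| ^ q / ‖z.1 - z.2‖ ^ ((N : ℝ) + s * q))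

theorem aemeasurable_sub_prod {u : Sp N → ℝ} {μ : Measure (Sp N)} [SFinite μ]
    (hu : AEStronglyMeasurable u μ) :
    AEMeasurable (fun z : Sp N × Sp N => u z.1 - u z.2) (μ.prod μ) :=
  (hu.comp_fst.sub hu.comp_snd).aemeasurable

theorem energy_eq_iterated {u : Sp N → ℝ} {s q : ℝ} {U : Set (Sp N)}
    (hu : AEStronglyMeasurable u (volume.restrict U)) :
    energy u s q U = ∫⁻ x in U, ∫⁻ y in U,
      ENNReal.ofReal (|u x - u y| ^ q / ‖x - y‖ ^ ((N : ℝ) + s * q)) := by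
  rw [energy, Measure.volume_eq_prod, ← Measure.prod_restrict, lintegral_prod]
  have h := aemeasurable_sub_prod hu
  have h1 : AEMeasurable (fun z : Sp N × Sp N => |u z.1 - u z.2| ^ q)
      ((volume.restrict U).prod (volume.restrict U)) :=
    (continuous_abs.measurable.comp_aemeasurable h).pow_const q
  exact (h1.div (by fun_prop)).ennreal_ofReal

theorem gagliardo_lt_top_iff {u : Sp N → ℝ} {s q : ℝ} (hq : 0 < q) {U : Set (Sp N)}
    (hu : AEStronglyMeasurable u (volume.restrict U)) :
    gagliardo u s q U < ⊤ ↔ energy u s q U < ⊤ := by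
  rw [energy_eq_iterated hu, gagliardo, ENNReal.rpow_lt_top_iff_of_pos (by positivity)]

/-- A symmetric weighted integral bound on the product space. -/
theorem lintegral_symm_weight_le {g : Sp N → ℝ≥0∞} {Q : Sp N → Sp N → ℝ≥0∞} {c : ℝ≥0∞}
    (hg : AEMeasurable g) (hg' : ∀ x, g x ≠ ⊤) (hQ : AEMeasurable (fun z : Sp N × Sp N => Q z.1 z.2))
    (hc : ∀ x, ∫⁻ y, Q x y ≤ c) :
    ∫⁻ z : Sp N × Sp N, (g z.1 * Q z.1 z.2 + g z.2 * Q z.2 z.1) ≤ 2 * c * ∫⁻ x, g x := by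
  have hm : AEMeasurable (fun z : Sp N × Sp N => g z.1 * Q z.1 z.2)
      ((volume : Measure (Sp N)).prod volume) :=
    (hg.comp_quasiMeasurePreserving Measure.quasiMeasurePreserving_fst).mul hQ
  have h1 : ∫⁻ z : Sp N × Sp N, g z.1 * Q z.1 z.2 ≤ c * ∫⁻ x, g x := by
    rw [Measure.volume_eq_prod, lintegral_prod _ hm]
    have h2 : ∀ x, ∫⁻ y, g x * Q x y ≤ c * g x := by
      intro x
      rw [lintegral_const_mul' _ _ (hg' x), mul_comm]
      gcongr
      exact hc x
    calc _ ≤ ∫⁻ x, c * g x := lintegral_mono h2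
      _ = _ := lintegral_const_mul'' _ hg
  have hswap : ∫⁻ z : Sp N × Sp N, g z.2 * Q z.2 z.1 = ∫⁻ z : Sp N × Sp N, g z.1 * Q z.1 z.2 := by
    rw [Measure.volume_eq_prod]
    exact lintegral_prod_swap (μ := (volume : Measure (Sp N))) (ν := volume)
      (fun z : Sp N × Sp N => g z.1 * Q z.1 z.2)
  rw [Measure.volume_eq_prod] at hswap h1 ⊢
  rw [lintegral_add_left' hm, hswap, two_mul, add_mul]
  exact add_le_add h1 h1

/-- The shape of the majorants below: a near-diagonal part G, and a weight g times a kernel of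
finite mass in its second variable, in both orders. No measurability of G is required, because the
second summand is measurable. -/
theorem lintegral_add_symm_weight_le {G : Sp N × Sp N → ℝ≥0∞} {g : Sp N → ℝ≥0∞}
    {Q : Sp N → Sp N → ℝ≥0∞} {c : ℝ≥0∞}
    (hg : AEMeasurable g) (hg' : ∀ x, g x ≠ ⊤)
    (hQ : AEMeasurable (fun z : Sp N × Sp N => Q z.1 z.2))
    (hc : ∀ x, ∫⁻ y, Q x y ≤ c) :
    ∫⁻ z : Sp N × Sp N, (G z + (g z.1 * Q z.1 z.2 + g z.2 * Q z.2 z.1)) ≤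
      (∫⁻ z, G z) + 2 * c * ∫⁻ x, g x := by
  have hm : AEMeasurable (fun z : Sp N × Sp N => g z.1 * Q z.1 z.2)
      ((volume : Measure (Sp N)).prod volume) :=
    (hg.comp_quasiMeasurePreserving Measure.quasiMeasurePreserving_fst).mul hQ
  have hm2 : AEMeasurable (fun z : Sp N × Sp N => g z.2 * Q z.2 z.1)
      ((volume : Measure (Sp N)).prod volume) :=
    hm.comp_quasiMeasurePreserving (Measure.measurePreserving_swap.quasiMeasurePreserving)
  have hm3 : AEMeasurable (fun z : Sp N × Sp N => g z.1 * Q z.1 z.2 + g z.2 * Q z.2 z.1) :=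
    hm.add hm2
  rw [lintegral_add_right' _ hm3]
  exact add_le_add le_rfl (lintegral_symm_weight_le hg hg' hQ hc)

/-! ### Tails, normalised solutions and far-field bounds -/

/-- The density of the nonlocal tail outside the unit ball. -/
noncomputable def tailDensity (p sₚ : ℝ) (u : Sp N → ℝ) (y : Sp N) : ℝ :=
  if ‖y‖ < 1 then 0 else |u y| ^ (p - 1) / ‖y‖ ^ ((N : ℝ) + sₚ * p)

theorem tailDensity_nonneg (p sₚ : ℝ) (u : Sp N → ℝ) (y : Sp N) : 0 ≤ tailDensity p sₚ u y := by
  unfold tailDensity; split_ifs <;> positivity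

theorem aemeasurable_tailDensity {p sₚ : ℝ} {u : Sp N → ℝ} (hu : AEStronglyMeasurable u volume) :
    AEMeasurable (tailDensity p sₚ u) := by
  have h1 : AEMeasurable (fun y : Sp N => |u y| ^ (p - 1)) :=
    (continuous_abs.measurable.comp_aemeasurable hu.aemeasurable).pow_const _
  have h2 : AEMeasurable (fun y : Sp N => |u y| ^ (p - 1) / ‖y‖ ^ ((N : ℝ) + sₚ * p)) :=
    h1.div (by fun_prop)
  have h3 : tailDensity p sₚ u = {y : Sp N | ¬ ‖y‖ < 1}.indicator
      (fun y : Sp N => |u y| ^ (p - 1) / ‖y‖ ^ ((N : ℝ) + sₚ * p)) := by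
    ext y
    by_cases hy : ‖y‖ < 1 <;> simp only [tailDensity, hy, if_true, if_false, indicator,
      mem_ofPred_eq, not_true_eq_false, not_false_eq_true]
  rw [h3]
  exact h2.indicator (measurableSet_lt measurable_norm measurable_const).compl

/-- Bounded test functions of finite energy, supported in a ball about the origin. -/
structure IsTest (p s₁ sₚ r : ℝ) (φ : Sp N → ℝ) : Prop where
  aesm : AEStronglyMeasurable φ volume
  zero : ∀ x, r ≤ ‖x‖ → φ x = 0
  bdd : ∃ C, ∀ x, |φ x| ≤ C
  energy_one : energy φ s₁ 1 univ < ⊤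
  energy_p : energy φ sₚ p univ < ⊤

/-- Integrand of the `1`-part of the equation. -/
noncomputable def onePart (s₁ : ℝ) (Z : Sp N × Sp N → ℝ) (φ : Sp N → ℝ) (z : Sp N × Sp N) : ℝ :=
  Z z * (φ z.1 - φ z.2) / ‖z.1 - z.2‖ ^ ((N : ℝ) + s₁)

/-- Integrand of the `p`-part of the equation. -/
noncomputable def pPart (p sₚ : ℝ) (u φ : Sp N → ℝ) (z : Sp N × Sp N) : ℝ :=
  |u z.1 - u z.2| ^ (p - 2) * (u z.1 - u z.2) * (φ z.1 - φ z.2) /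
    ‖z.1 - z.2‖ ^ ((N : ℝ) + sₚ * p)

/-- Solutions in the unit ball, normalised by `|u| ≤ 1` and a bound on the tail, with a coefficient
`lam ∈ [0, 1]` in front of the `1`-part, and equal to the limit of their averages wherever it
exists. -/
structure NormalizedSolution (p s₁ sₚ Λ lam : ℝ) (u : Sp N → ℝ) : Prop where
  aesm : AEStronglyMeasurable u volume
  bdd : ∀ x, ‖x‖ < 1 → |u x| ≤ 1
  tail_le : ∫⁻ y, ENNReal.ofReal (tailDensity p sₚ u y) ≤ ENNReal.ofReal Λ
  lam_nonneg : 0 ≤ lam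
  lam_le : lam ≤ 1
  energy_one : ∀ r < 1, energy u s₁ 1 (ball 0 r) < ⊤
  energy_p : ∀ r < 1, energy u sₚ p (ball 0 r) < ⊤
  eqn : ∃ Z : Sp N × Sp N → ℝ, AEStronglyMeasurable Z volume ∧
    (∀ᵐ z : Sp N × Sp N, Z z ∈ sgnSet (u z.1 - u z.2)) ∧
    ∀ r < 1, ∀ φ : Sp N → ℝ, IsTest p s₁ sₚ r φ →
      lam * (∫ z, onePart s₁ Z φ z) + ∫ z, pPart p sₚ u φ z = 0
  rep : ∀ x l, ‖x‖ < 1 →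
    Tendsto (fun r => ⨍ y in closedBall x r, u y) (𝓝[>] 0) (𝓝 l) → u x = l

/-- The far-field kernel `k(x - y) + tail density`. -/
theorem far_bound {p sₚ ε : ℝ} {u : Sp N → ℝ} (hp : 1 < p) (hs : 0 ≤ sₚ * p)
    (hu : ∀ x, ‖x‖ < 1 → |u x| ≤ 1) (hε : 0 < ε) (hε1 : ε ≤ 1) {x y : Sp N}
    (hx : ‖x‖ ≤ 1 - ε) (hxy : ε ≤ ‖x - y‖) :
    (1 + |u y| ^ (p - 1)) / ‖x - y‖ ^ ((N : ℝ) + sₚ * p) ≤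
      (2 * ε⁻¹ + (ε ^ ((N : ℝ) + sₚ * p))⁻¹) *
        (truncKernel (sₚ * p) (x - y) + tailDensity p sₚ u y) := by
  have hk := inv_rpow_le_truncKernel (s := sₚ * p) hε hε1 hxy
  have hk0 := truncKernel_nonneg (sₚ * p) (x - y)
  have hT := tailDensity_nonneg p sₚ u y
  have hpow : 0 < ε ^ ((N : ℝ) + sₚ * p) := Real.rpow_pos_of_pos hε _
  have hxy0 : 0 < ‖x - y‖ ^ ((N : ℝ) + sₚ * p) := Real.rpow_pos_of_pos (hε.trans_le hxy) _
  by_cases hy : ‖y‖ < 1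
  · have h1 : |u y| ^ (p - 1) ≤ 1 := Real.rpow_le_one (abs_nonneg _) (hu y hy) (by linarith)
    calc (1 + |u y| ^ (p - 1)) / ‖x - y‖ ^ ((N : ℝ) + sₚ * p)
        ≤ 2 / ‖x - y‖ ^ ((N : ℝ) + sₚ * p) := by gcongr; linarith
      _ = 2 * (1 / ‖x - y‖ ^ ((N : ℝ) + sₚ * p)) := by ring
      _ ≤ 2 * (ε⁻¹ * truncKernel (sₚ * p) (x - y)) := by gcongr
      _ ≤ _ := by
        have h3 : 0 ≤ (2 * ε⁻¹ + (ε ^ ((N : ℝ) + sₚ * p))⁻¹) * tailDensity p sₚ u y := by positivity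
        have h4 : 0 ≤ (ε ^ ((N : ℝ) + sₚ * p))⁻¹ * truncKernel (sₚ * p) (x - y) := by positivity
        linarith
  · have hy1 : 1 ≤ ‖y‖ := not_lt.1 hy
    -- ‖x - y‖ ≥ ‖y‖ - 1 + ε, which exceeds ε‖y‖ by at least (1 - ε)(‖y‖ - 1) ≥ 0.
    have hd : ε * ‖y‖ ≤ ‖x - y‖ := by
      have := norm_sub_norm_le y x
      rw [norm_sub_rev] at this
      nlinarith
    have hpow2 : ε ^ ((N : ℝ) + sₚ * p) * ‖y‖ ^ ((N : ℝ) + sₚ * p)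
        ≤ ‖x - y‖ ^ ((N : ℝ) + sₚ * p) := by
      rw [← Real.mul_rpow hε.le (norm_nonneg _)]
      exact Real.rpow_le_rpow (by positivity) hd (by positivity)
    have hy0 : 0 < ‖y‖ ^ ((N : ℝ) + sₚ * p) := Real.rpow_pos_of_pos (by linarith) _
    have h5 : |u y| ^ (p - 1) / ‖x - y‖ ^ ((N : ℝ) + sₚ * p)
        ≤ (ε ^ ((N : ℝ) + sₚ * p))⁻¹ * tailDensity p sₚ u y := by
      rw [tailDensity, if_neg hy, inv_mul_eq_div, div_div]
      rw [mul_comm (‖y‖ ^ _)]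
      gcongr
    have h6 : 0 ≤ 2 * ε⁻¹ * tailDensity p sₚ u y := by positivity
    have h7 : 0 ≤ (ε⁻¹ + (ε ^ ((N : ℝ) + sₚ * p))⁻¹) * truncKernel (sₚ * p) (x - y) := by positivity
    rw [add_div]
    linarith

/-- Multiplying by a Lipschitz cutoff preserves finiteness of the energy. -/
theorem energy_cutoff_lt_top (hN : 1 ≤ N) {s q r r' C L : ℝ} {g η : Sp N → ℝ} (hq : 1 ≤ q)
    (hsq : 0 < s * q) (hsq1 : s * q < 1) (hg : ∀ x ∈ ball (0 : Sp N) r', |g x| ≤ C)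
    (hge : energy g s q (ball 0 r') < ⊤)
    (hL : 1 ≤ L) (hη : ∀ x, |η x| ≤ 1) (hηL : ∀ x y, |η x - η y| ≤ L * ‖x - y‖)
    (hη0 : ∀ x, r ≤ ‖x‖ → η x = 0) (hrr' : r < r') (hr' : 0 < r') :
    energy (fun x => η x * g x) s q univ < ⊤ := by
  have hC : 0 ≤ C := (abs_nonneg _).trans (hg 0 (by simpa using hr'))
  set V := ball (0 : Sp N) r' with hV
  set ε := min 1 (r' - r) with hεdef
  have hε : 0 < ε := lt_min one_pos (by linarith)
  have hε1 : ε ≤ 1 := min_le_left _ _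
  -- The first summand pays for the oscillation of the cutoff inside V × V, the second for pairs
  -- with exactly one point in V.
  set D := 2 ^ q * (2 * L * C) ^ q + C ^ q * ε⁻¹ with hD
  have hD0 : 0 ≤ D := by positivity
  set G : Sp N × Sp N → ℝ≥0∞ := fun z => (V ×ˢ V).indicator (fun z => ENNReal.ofReal (2 ^ q) *
    ENNReal.ofReal (|g z.1 - g z.2| ^ q / ‖z.1 - z.2‖ ^ ((N : ℝ) + s * q))) z with hG
  set w : Sp N → ℝ≥0∞ := V.indicator 1 with hw
  set Q : Sp N → Sp N → ℝ≥0∞ := fun x y => ENNReal.ofReal (D * truncKernel (s * q) (x - y)) with hQ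
  have hfar : ∀ x y, x ∈ V → y ∉ V → |η x * g x| ^ q / ‖x - y‖ ^ ((N : ℝ) + s * q)
      ≤ D * truncKernel (s * q) (x - y) := by
    intro x y hx hy
    have hk0 := truncKernel_nonneg (s * q) (x - y)
    by_cases hxr : r ≤ ‖x‖
    · rw [hη0 x hxr, zero_mul, abs_zero, Real.zero_rpow (by linarith), zero_div]
      positivity
    · have hxy : ε ≤ ‖x - y‖ := by
        have h1 : r' ≤ ‖y‖ := by simpa [hV] using hy
        have h2 := norm_sub_norm_le y x
        rw [norm_sub_rev] at h2
        exact (min_le_right _ _).trans (by linarith [not_le.1 hxr])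
      have hk := inv_rpow_le_truncKernel (s := s * q) hε hε1 hxy
      have h3 : |η x * g x| ^ q ≤ C ^ q := by
        apply Real.rpow_le_rpow (abs_nonneg _) _ (by linarith)
        rw [abs_mul]
        calc |η x| * |g x| ≤ 1 * C := by gcongr; exacts [hη x, hg x hx]
          _ = C := one_mul C
      calc |η x * g x| ^ q / ‖x - y‖ ^ ((N : ℝ) + s * q)
          ≤ C ^ q / ‖x - y‖ ^ ((N : ℝ) + s * q) := by gcongr
        _ = C ^ q * (1 / ‖x - y‖ ^ ((N : ℝ) + s * q)) := by ring
        _ ≤ C ^ q * (ε⁻¹ * truncKernel (s * q) (x - y)) := by gcongr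
        _ ≤ _ := by
          have : 0 ≤ 2 ^ q * (2 * L * C) ^ q * truncKernel (s * q) (x - y) := by positivity
          rw [hD]; linarith
  have hpt : ∀ z : Sp N × Sp N, ENNReal.ofReal
      (|η z.1 * g z.1 - η z.2 * g z.2| ^ q / ‖z.1 - z.2‖ ^ ((N : ℝ) + s * q)) ≤
      G z + (w z.1 * Q z.1 z.2 + w z.2 * Q z.2 z.1) := by
    rintro ⟨x, y⟩
    simp only
    by_cases hx : x ∈ V <;> by_cases hy : y ∈ V
    · have hGz : G (x, y) = ENNReal.ofReal (2 ^ q) *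
          ENNReal.ofReal (|g x - g y| ^ q / ‖x - y‖ ^ ((N : ℝ) + s * q)) := by
        simp [hG, hx, hy]
      have hwx : w x = 1 := by simp [hw, hx]
      rw [hGz, hwx, one_mul, ← add_assoc]
      refine le_trans ?_ (le_add_right le_rfl)
      rw [← ENNReal.ofReal_mul (by positivity), hQ, ← ENNReal.ofReal_add (by positivity)
        (mul_nonneg hD0 (truncKernel_nonneg _ _))]
      apply ENNReal.ofReal_le_ofReal
      set m := min 1 ‖x - y‖ with hm
      have hm0 : 0 ≤ m := le_min zero_le_one (norm_nonneg _)
      have hm1 : m ≤ 1 := min_le_left _ _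
      have hηd : |η x - η y| ≤ 2 * L * m := by
        rcases le_total 1 ‖x - y‖ with h | h
        · rw [hm, min_eq_left h]
          have := abs_sub (η x) (η y)
          linarith [hη x, hη y]
        · rw [hm, min_eq_right h]
          have := hηL x y
          nlinarith [norm_nonneg (x - y)]
      have h1 : |η x * g x - η y * g y| ≤ |g x - g y| + 2 * L * C * m := by
        have : η x * g x - η y * g y = η x * (g x - g y) + (η x - η y) * g y := by ring
        rw [this]
        refine (abs_add_le _ _).trans ?_
        rw [abs_mul, abs_mul]
        have e1 : |η x| * |g x - g y| ≤ 1 * |g x - g y| := by gcongr; exact hη x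
        have e2 : |η x - η y| * |g y| ≤ (2 * L * m) * C := by gcongr; exact hg y hy
        linarith
      have h2 : |η x * g x - η y * g y| ^ q ≤
          2 ^ q * |g x - g y| ^ q + 2 ^ q * (2 * L * C) ^ q * m := by
        have h3 : (|g x - g y| + 2 * L * C * m) ≤ 2 * max |g x - g y| (2 * L * C * m) := by
          linarith [le_max_left |g x - g y| (2 * L * C * m),
            le_max_right |g x - g y| (2 * L * C * m)]
        have h4 : |η x * g x - η y * g y| ^ q ≤
            2 ^ q * (max |g x - g y| (2 * L * C * m)) ^ q := by
          rw [← Real.mul_rpow (by norm_num) (by positivity)]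
          exact Real.rpow_le_rpow (abs_nonneg _) (h1.trans h3) (by linarith)
        have h5 : (max |g x - g y| (2 * L * C * m)) ^ q ≤
            |g x - g y| ^ q + (2 * L * C) ^ q * m := by
          rcases max_cases |g x - g y| (2 * L * C * m) with h | h
          · rw [h.1]
            have : 0 ≤ (2 * L * C) ^ q * m := by positivity
            linarith
          · rw [h.1, Real.mul_rpow (by positivity) hm0]
            -- As q ≥ 1 and m ≤ 1, a full power of the truncated distance suffices; the cutoff
            -- therefore costs only the truncated kernel of order s q < 1.
            have h6 : m ^ q ≤ m := by
              simpa using Real.rpow_le_rpow_of_exponent_ge' hm0 hm1 zero_le_one hq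
            have : 0 ≤ |g x - g y| ^ q := by positivity
            have : (2 * L * C) ^ q * m ^ q ≤ (2 * L * C) ^ q * m := by gcongr
            linarith
        calc _ ≤ _ := h4
          _ ≤ 2 ^ q * (|g x - g y| ^ q + (2 * L * C) ^ q * m) := by gcongr
          _ = _ := by ring
      calc |η x * g x - η y * g y| ^ q / ‖x - y‖ ^ ((N : ℝ) + s * q)
          ≤ (2 ^ q * |g x - g y| ^ q + 2 ^ q * (2 * L * C) ^ q * m) /
            ‖x - y‖ ^ ((N : ℝ) + s * q) := by gcongr
        _ = 2 ^ q * (|g x - g y| ^ q / ‖x - y‖ ^ ((N : ℝ) + s * q)) +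
            2 ^ q * (2 * L * C) ^ q * truncKernel (s * q) (x - y) := by
          rw [truncKernel, ← hm]; ring
        _ ≤ _ := by
          have : 0 ≤ C ^ q * ε⁻¹ * truncKernel (s * q) (x - y) :=
            mul_nonneg (by positivity) (truncKernel_nonneg _ _)
          rw [hD]; linarith
    · have hy0 : η y = 0 := hη0 y (by
        have : r' ≤ ‖y‖ := by simpa [hV] using hy
        linarith)
      have hwx : w x = 1 := by simp [hw, hx]
      rw [hwx, one_mul, hy0, zero_mul, sub_zero]
      refine le_trans ?_ (le_add_left (le_add_right le_rfl))
      exact ENNReal.ofReal_le_ofReal (hfar x y hx hy)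
    · have hx0 : η x = 0 := hη0 x (by
        have : r' ≤ ‖x‖ := by simpa [hV] using hx
        linarith)
      have hwy : w y = 1 := by simp [hw, hy]
      rw [hwy, one_mul, hx0, zero_mul, zero_sub, abs_neg, norm_sub_rev]
      refine le_trans ?_ (le_add_left (le_add_left le_rfl))
      exact ENNReal.ofReal_le_ofReal (hfar y x hy hx)
    · have hx0 : η x = 0 := hη0 x (by
        have : r' ≤ ‖x‖ := by simpa [hV] using hx
        linarith)
      have hy0 : η y = 0 := hη0 y (by
        have : r' ≤ ‖y‖ := by simpa [hV] using hy
        linarith)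
      rw [hx0, hy0, zero_mul, zero_mul, sub_zero, abs_zero, Real.zero_rpow (by linarith), zero_div]
      simp
  have hQm : Measurable (fun z : Sp N × Sp N => Q z.1 z.2) := by
    simp only [hQ]; fun_prop
  have hwm : AEMeasurable w := (measurable_one.indicator measurableSet_ball).aemeasurable
  have hQint : ∀ x, ∫⁻ y, Q x y ≤ ENNReal.ofReal D * kernelMass N (s * q) := by
    intro x
    simp only [hQ, ENNReal.ofReal_mul hD0]
    rw [lintegral_const_mul' _ _ ENNReal.ofReal_ne_top, lintegral_truncKernel_sub]
  have hw1 : ∫⁻ x, w x = volume V := lintegral_indicator_one measurableSet_ball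
  have hGint : ∫⁻ z, G z < ⊤ := by
    simp only [hG]
    rw [lintegral_indicator (measurableSet_ball.prod measurableSet_ball),
      lintegral_const_mul' _ _ ENNReal.ofReal_ne_top]
    exact ENNReal.mul_lt_top ENNReal.ofReal_lt_top hge
  rw [energy, univ_prod_univ, setLIntegral_univ]
  refine (lintegral_mono hpt).trans_lt ((lintegral_add_symm_weight_le hwm
    (fun x => by by_cases hx : x ∈ V <;> simp [hw, hx]) hQm.aemeasurable hQint).trans_lt ?_)
  refine ENNReal.add_lt_top.2 ⟨hGint, ?_⟩
  rw [hw1]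
  exact ENNReal.mul_lt_top (ENNReal.mul_lt_top (by simp)
    (ENNReal.mul_lt_top ENNReal.ofReal_lt_top (kernelMass_lt_top hN hsq hsq1))) measure_ball_lt_top

/-! ### Integrability of the equation and the equation for differences -/

theorem measurePreserving_shift (h : Sp N) :
    MeasurePreserving (fun z : Sp N × Sp N => (z.1 + h, z.2 + h)) volume volume :=
  (measurePreserving_add_right (volume : Measure (Sp N)) h).prod
    (measurePreserving_add_right (volume : Measure (Sp N)) h)

theorem measurableEmbedding_shift (h : Sp N) :
    MeasurableEmbedding (fun z : Sp N × Sp N => (z.1 + h, z.2 + h)) :=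
  ((MeasurableEquiv.addRight h).prodCongr (MeasurableEquiv.addRight h)).measurableEmbedding

theorem energy_shift (φ : Sp N → ℝ) (s q : ℝ) (h : Sp N) :
    energy (fun x => φ (x + h)) s q univ = energy φ s q univ := by
  simp only [energy, univ_prod_univ, setLIntegral_univ]
  rw [← (measurePreserving_shift h).lintegral_comp_emb (measurableEmbedding_shift h) (fun z =>
    ENNReal.ofReal (|φ z.1 - φ z.2| ^ q / ‖z.1 - z.2‖ ^ ((N : ℝ) + s * q)))]
  simp only [add_sub_add_right_eq_sub]

theorem IsTest.shift {p s₁ sₚ r : ℝ} {φ : Sp N → ℝ} (hφ : IsTest p s₁ sₚ r φ) (h : Sp N) :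
    IsTest p s₁ sₚ (r + ‖h‖) (fun x => φ (x + h)) where
  aesm := hφ.aesm.comp_measurePreserving (measurePreserving_add_right volume h)
  zero x hx := hφ.zero _ (by
    have := norm_sub_le (x + h) h
    rw [add_sub_cancel_right] at this
    linarith)
  bdd := hφ.bdd.imp fun C hC x => hC _
  energy_one := by rw [energy_shift]; exact hφ.energy_one
  energy_p := by rw [energy_shift]; exact hφ.energy_p

theorem integrable_onePart {p s₁ sₚ r : ℝ} {φ : Sp N → ℝ} {Z : Sp N × Sp N → ℝ}
    (hφ : IsTest p s₁ sₚ r φ) (hZ : AEStronglyMeasurable Z volume)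
    (hZ1 : ∀ᵐ z, |Z z| ≤ 1) : Integrable (onePart s₁ Z φ) := by
  have hm : AEMeasurable (fun z : Sp N × Sp N => φ z.1 - φ z.2) := aemeasurable_sub_prod hφ.aesm
  refine ⟨((hZ.aemeasurable.mul hm).div (by fun_prop)).aestronglyMeasurable, ?_⟩
  have he := hφ.energy_one
  rw [energy, univ_prod_univ, setLIntegral_univ] at he
  refine lt_of_le_of_lt (lintegral_mono_ae ?_) he
  filter_upwards [hZ1] with z hz
  rw [Real.enorm_eq_ofReal_abs]
  apply ENNReal.ofReal_le_ofReal
  rw [onePart, Real.rpow_one, mul_one, abs_div, abs_mul,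
    abs_of_nonneg (Real.rpow_nonneg (norm_nonneg _) _)]
  gcongr
  exact mul_le_of_le_one_left (abs_nonneg _) hz

theorem aemeasurable_signedPow_sub {p : ℝ} {u : Sp N → ℝ} (hu : AEStronglyMeasurable u volume) :
    AEMeasurable (fun z : Sp N × Sp N => signedPow p (u z.1 - u z.2)) := by
  have h : AEMeasurable (fun z : Sp N × Sp N => u z.1 - u z.2) := aemeasurable_sub_prod hu
  exact ((continuous_abs.measurable.comp_aemeasurable h).pow_const _).mul h

/-- A crude Young inequality: replace the smaller of a and b by the larger. -/
theorem rpow_mul_le_add {p a b : ℝ} (hp : 1 < p) (ha : 0 ≤ a) (hb : 0 ≤ b) :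
    a ^ (p - 1) * b ≤ a ^ p + b ^ p := by
  have key : ∀ c : ℝ, 0 ≤ c → c ^ (p - 1) * c = c ^ p := by
    intro c hc
    rw [← Real.rpow_add_one' hc (by linarith)]; ring_nf
  rcases le_total a b with h | h
  · have : a ^ (p - 1) * b ≤ b ^ (p - 1) * b := by gcongr
    rw [key b hb] at this
    have := Real.rpow_nonneg ha p
    linarith
  · have : a ^ (p - 1) * b ≤ a ^ (p - 1) * a := by gcongr
    rw [key a ha] at this
    have := Real.rpow_nonneg hb p
    linarith

/-- The far-field kernel in `ℝ≥0∞`. -/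
noncomputable def farKernel (p sₚ : ℝ) (u : Sp N → ℝ) (x y : Sp N) : ℝ≥0∞ :=
  ENNReal.ofReal (truncKernel (sₚ * p) (x - y)) + ENNReal.ofReal (tailDensity p sₚ u y)

theorem aemeasurable_farKernel {p sₚ : ℝ} {u : Sp N → ℝ} (hu : AEStronglyMeasurable u volume) :
    AEMeasurable (fun z : Sp N × Sp N => farKernel p sₚ u z.1 z.2) := by
  have h1 : AEMeasurable (fun z : Sp N × Sp N => tailDensity p sₚ u z.2)
      ((volume : Measure (Sp N)).prod volume) :=
    (aemeasurable_tailDensity hu).comp_quasiMeasurePreserving Measure.quasiMeasurePreserving_snd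
  have h2 : Measurable (fun z : Sp N × Sp N => ENNReal.ofReal (truncKernel (sₚ * p) (z.1 - z.2))) := by
    fun_prop
  exact h2.aemeasurable.add h1.ennreal_ofReal

theorem lintegral_farKernel {p sₚ : ℝ} (u : Sp N → ℝ) (x : Sp N) :
    ∫⁻ y, farKernel p sₚ u x y =
      kernelMass N (sₚ * p) + ∫⁻ y, ENNReal.ofReal (tailDensity p sₚ u y) := by
  unfold farKernel
  rw [lintegral_add_left (by fun_prop), lintegral_truncKernel_sub]

/-- For both points in a ball V slightly larger than the support, Young's inequality splits the
integrand into the energies of u and φ. If only one point is in V, then either φ vanishes there or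
the points are ε apart, and `far_bound` replaces the kernel by one of finite mass. -/
theorem integrable_pPart (hN : 1 ≤ N) {p s₁ sₚ Λ lam r : ℝ} {u φ : Sp N → ℝ} (hp : 1 < p)
    (hp2 : p < 2) (hs : 0 < sₚ * p) (hs1 : sₚ * p < 1)
    (hu : NormalizedSolution p s₁ sₚ Λ lam u) (hφ : IsTest p s₁ sₚ r φ) (hr : r < 1) :
    Integrable (pPart p sₚ u φ) := by
  obtain ⟨C, hC⟩ := hφ.bdd
  have hC0 : 0 ≤ C := (abs_nonneg _).trans (hC 0)
  -- For r < 0 the test function vanishes identically, so r = 0 serves as well.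
  wlog hr0 : 0 ≤ r generalizing r
  · exact this ⟨hφ.aesm, fun x hx => hφ.zero x (by linarith), hφ.bdd, hφ.energy_one, hφ.energy_p⟩
      zero_lt_one le_rfl
  have hm : AEMeasurable (fun z : Sp N × Sp N => φ z.1 - φ z.2) := aemeasurable_sub_prod hφ.aesm
  have hm' : AEMeasurable (fun z : Sp N × Sp N => u z.1 - u z.2) := aemeasurable_sub_prod hu.aesm
  refine ⟨(((aemeasurable_signedPow_sub hu.aesm).mul hm).div (by fun_prop)).aestronglyMeasurable, ?_⟩
  set ε := (1 - r) / 2 with hε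
  have hε0 : 0 < ε := by rw [hε]; linarith
  have hε1 : ε ≤ 1 := by rw [hε]; linarith
  set V := ball (0 : Sp N) (r + ε) with hV
  set D := 2 * ε⁻¹ + (ε ^ ((N : ℝ) + sₚ * p))⁻¹ with hD
  have hD0 : 0 ≤ D := by positivity
  set eu : Sp N × Sp N → ℝ≥0∞ := fun z =>
    ENNReal.ofReal (|u z.1 - u z.2| ^ p / ‖z.1 - z.2‖ ^ ((N : ℝ) + sₚ * p)) with heu
  set eφ : Sp N × Sp N → ℝ≥0∞ := fun z =>
    ENNReal.ofReal (|φ z.1 - φ z.2| ^ p / ‖z.1 - z.2‖ ^ ((N : ℝ) + sₚ * p)) with heφ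
  set w : Sp N → ℝ≥0∞ := V.indicator (fun _ => ENNReal.ofReal (C * D)) with hw
  set Q := farKernel p sₚ u with hQ
  have hfar : ∀ x y, x ∈ V → y ∉ V → ENNReal.ofReal (|u x - u y| ^ (p - 1) * |φ x| /
      ‖x - y‖ ^ ((N : ℝ) + sₚ * p)) ≤ w x * Q x y := by
    intro x y hx hy
    have hT := tailDensity_nonneg p sₚ u y
    have hk0 := truncKernel_nonneg (sₚ * p) (x - y)
    by_cases hxr : r ≤ ‖x‖
    · rw [hφ.zero x hxr]; simp
    · have h1 : r + ε ≤ ‖y‖ := by simpa [hV] using hy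
      have h2 := norm_sub_norm_le y x
      rw [norm_sub_rev] at h2
      have hxy : ε ≤ ‖x - y‖ := by linarith
      have hfb := far_bound (u := u) hp hs.le hu.bdd hε0 hε1 (x := x) (y := y)
        (by linarith) hxy
      have hux : |u x| ≤ 1 := hu.bdd x (by linarith)
      have h3 : |u x - u y| ^ (p - 1) ≤ 1 + |u y| ^ (p - 1) := by
        refine (abs_sub_rpow_le (by linarith) (by linarith)).trans ?_
        have : |u x| ^ (p - 1) ≤ 1 := Real.rpow_le_one (abs_nonneg _) hux (by linarith)
        linarith
      have hwx : w x = ENNReal.ofReal (C * D) := by simp [hw, hx]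
      rw [hwx, hQ, farKernel, ← ENNReal.ofReal_add hk0 hT, ← ENNReal.ofReal_mul (by positivity)]
      apply ENNReal.ofReal_le_ofReal
      calc |u x - u y| ^ (p - 1) * |φ x| / ‖x - y‖ ^ ((N : ℝ) + sₚ * p)
          ≤ (1 + |u y| ^ (p - 1)) * C / ‖x - y‖ ^ ((N : ℝ) + sₚ * p) := by
            gcongr; exact hC x
        _ = C * ((1 + |u y| ^ (p - 1)) / ‖x - y‖ ^ ((N : ℝ) + sₚ * p)) := by ring
        _ ≤ C * (D * (truncKernel (sₚ * p) (x - y) + tailDensity p sₚ u y)) := by gcongr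
        _ = _ := by ring
  have hnorm : ∀ x y, ‖pPart p sₚ u φ (x, y)‖ₑ = ENNReal.ofReal
      (|u x - u y| ^ (p - 1) * |φ x - φ y| / ‖x - y‖ ^ ((N : ℝ) + sₚ * p)) := by
    intro x y
    rw [Real.enorm_eq_ofReal_abs, pPart, abs_div, abs_mul,
      abs_of_nonneg (Real.rpow_nonneg (norm_nonneg _) _), ← abs_signedPow hp, signedPow]
  have hpt : ∀ z : Sp N × Sp N, ‖pPart p sₚ u φ z‖ₑ ≤
      ((V ×ˢ V).indicator eu z + eφ z) + (w z.1 * Q z.1 z.2 + w z.2 * Q z.2 z.1) := by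
    rintro ⟨x, y⟩
    rw [hnorm]
    by_cases hx : x ∈ V <;> by_cases hy : y ∈ V
    · refine le_trans ?_ (le_add_right le_rfl)
      rw [indicator_of_mem (mk_mem_prod hx hy), heu, heφ, ← ENNReal.ofReal_add (by positivity)
        (by positivity), ← add_div]
      apply ENNReal.ofReal_le_ofReal
      gcongr
      exact rpow_mul_le_add hp (abs_nonneg _) (abs_nonneg _)
    · have hy0 : φ y = 0 := hφ.zero y (by
        have : r + ε ≤ ‖y‖ := by simpa [hV] using hy
        linarith)
      rw [hy0, sub_zero]
      exact (hfar x y hx hy).trans (le_add_left (le_add_right le_rfl))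
    · have hx0 : φ x = 0 := hφ.zero x (by
        have : r + ε ≤ ‖x‖ := by simpa [hV] using hx
        linarith)
      rw [hx0, zero_sub, abs_neg, abs_sub_comm, norm_sub_rev]
      exact (hfar y x hy hx).trans (le_add_left (le_add_left le_rfl))
    · have hy0 : φ y = 0 := hφ.zero y (by
        have : r + ε ≤ ‖y‖ := by simpa [hV] using hy
        linarith)
      have hx0 : φ x = 0 := hφ.zero x (by
        have : r + ε ≤ ‖x‖ := by simpa [hV] using hx
        linarith)
      simp [hx0, hy0]
  refine (lintegral_mono hpt).trans_lt ((lintegral_add_symm_weight_le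
    (c := kernelMass N (sₚ * p) + ENNReal.ofReal Λ) ?_ ?_ (aemeasurable_farKernel hu.aesm)
    ?_).trans_lt ?_)
  · exact (measurable_const.indicator measurableSet_ball).aemeasurable
  · intro x
    by_cases hx : x ∈ V <;> simp [hw, hx]
  · intro x
    rw [lintegral_farKernel]
    gcongr
    exact hu.tail_le
  · refine ENNReal.add_lt_top.2 ⟨?_, ?_⟩
    · have he : AEMeasurable eφ :=
        (((continuous_abs.measurable.comp_aemeasurable hm).pow_const _).div
          (by fun_prop)).ennreal_ofReal
      rw [lintegral_add_right' _ he]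
      refine ENNReal.add_lt_top.2 ⟨?_, ?_⟩
      · rw [lintegral_indicator (measurableSet_ball.prod measurableSet_ball)]
        exact hu.energy_p _ (by linarith)
      · have := hφ.energy_p
        rwa [energy, univ_prod_univ, setLIntegral_univ] at this
    · rw [hw, lintegral_indicator_const measurableSet_ball]
      exact ENNReal.mul_lt_top (ENNReal.mul_lt_top (by simp) (ENNReal.add_lt_top.2
        ⟨kernelMass_lt_top hN hs hs1, ENNReal.ofReal_lt_top⟩))
        (ENNReal.mul_lt_top ENNReal.ofReal_lt_top measure_ball_lt_top)

/-- The kernel of the equation satisfied by the difference `u(· + h) - u`. -/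
noncomputable def diffKernel (p s₁ sₚ lam : ℝ) (u : Sp N → ℝ) (Z : Sp N × Sp N → ℝ) (h : Sp N)
    (z : Sp N × Sp N) : ℝ :=
  (signedPow p (u (z.1 + h) - u (z.2 + h)) - signedPow p (u z.1 - u z.2)) /
      ‖z.1 - z.2‖ ^ ((N : ℝ) + sₚ * p) +
    lam * ((Z (z.1 + h, z.2 + h) - Z z) / ‖z.1 - z.2‖ ^ ((N : ℝ) + s₁))

/-- Test with φ(· - h), translate both variables by h, and subtract the equation tested with φ. The
selection Z is fixed before h and φ, so its translate is a selection for the translated increments.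
-/
theorem NormalizedSolution.exists_diff_eqn (hN : 1 ≤ N) {p s₁ sₚ Λ lam : ℝ} {u : Sp N → ℝ}
    (hp : 1 < p) (hp2 : p < 2) (hs : 0 < sₚ * p) (hs1 : sₚ * p < 1)
    (hu : NormalizedSolution p s₁ sₚ Λ lam u) :
    ∃ Z : Sp N × Sp N → ℝ, (∀ᵐ z : Sp N × Sp N, Z z ∈ sgnSet (u z.1 - u z.2)) ∧
      ∀ (h : Sp N) (r : ℝ), r + ‖h‖ < 1 → ∀ φ : Sp N → ℝ, IsTest p s₁ sₚ r φ →
        Integrable (fun z => diffKernel p s₁ sₚ lam u Z h z * (φ z.1 - φ z.2)) ∧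
        ∫ z, diffKernel p s₁ sₚ lam u Z h z * (φ z.1 - φ z.2) = 0 := by
  obtain ⟨Z, hZm, hZs, hZ⟩ := hu.eqn
  refine ⟨Z, hZs, fun h r hr φ hφ => ?_⟩
  have hr1 : r < 1 := by linarith [norm_nonneg h]
  have hφ' := hφ.shift (-h)
  rw [norm_neg] at hφ'
  set ψ : Sp N → ℝ := fun x => φ (x + -h) with hψ
  have hZ1 : ∀ᵐ z, |Z z| ≤ 1 := hZs.mono fun z hz => abs_le_one_of_mem_sgnSet hz
  have i1 := integrable_onePart hφ hZm hZ1
  have i2 := integrable_onePart hφ' hZm hZ1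
  have i3 := integrable_pPart hN hp hp2 hs hs1 hu hφ hr1
  have i4 := integrable_pPart hN hp hp2 hs hs1 hu hφ' hr
  have e1 := hZ r hr1 φ hφ
  have e2 := hZ _ hr ψ hφ'
  set τ : Sp N × Sp N → Sp N × Sp N := fun z => (z.1 + h, z.2 + h) with hτ
  have hmp : MeasurePreserving τ volume volume := measurePreserving_shift h
  have hme : MeasurableEmbedding τ := measurableEmbedding_shift h
  have i2' : Integrable (onePart s₁ Z ψ ∘ τ) := (hmp.integrable_comp_emb hme).2 i2
  have i4' : Integrable (pPart p sₚ u ψ ∘ τ) := (hmp.integrable_comp_emb hme).2 i4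
  rw [← hmp.integral_comp hme, ← hmp.integral_comp hme (pPart p sₚ u ψ)] at e2
  have hfun : (fun z => diffKernel p s₁ sₚ lam u Z h z * (φ z.1 - φ z.2)) =
      fun z => (lam * (onePart s₁ Z ψ ∘ τ) z + (pPart p sₚ u ψ ∘ τ) z) -
        (lam * onePart s₁ Z φ z + pPart p sₚ u φ z) := by
    ext z
    simp only [diffKernel, onePart, pPart, signedPow, Function.comp, hτ, hψ, add_neg_cancel_right,
      add_sub_add_right_eq_sub]
    ring
  have j1 := (i2'.const_mul lam).add i4'
  have j2 := (i1.const_mul lam).add i3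
  rw [hfun]
  refine ⟨j1.sub j2, ?_⟩
  have k1 : ∫ z, (lam * (onePart s₁ Z ψ ∘ τ) z + (pPart p sₚ u ψ ∘ τ) z) = 0 := by
    rw [integral_add (i2'.const_mul lam) i4', integral_const_mul]; exact e2
  have k2 : ∫ z, (lam * onePart s₁ Z φ z + pPart p sₚ u φ z) = 0 := by
    rw [integral_add (i1.const_mul lam) i3, integral_const_mul]; exact e1
  exact (integral_sub j1 j2).trans (by simp only [Pi.add_apply]; rw [k1, k2, sub_zero])

/-! ### The Caccioppoli inequality for the excess of a difference -/

/-- The excess `(u(x + h) - u(x) - M)_+`. -/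
noncomputable def excess (u : Sp N → ℝ) (h : Sp N) (M : ℝ) (x : Sp N) : ℝ :=
  max (u (x + h) - u x - M) 0

theorem excess_nonneg (u : Sp N → ℝ) (h : Sp N) (M : ℝ) (x : Sp N) : 0 ≤ excess u h M x :=
  le_max_right _ _

theorem excess_mono {u : Sp N → ℝ} {h : Sp N} {M : ℝ} {x y : Sp N}
    (hxy : u (y + h) - u y ≤ u (x + h) - u x) : excess u h M y ≤ excess u h M x := by
  unfold excess; gcongr

theorem abs_excess_sub_le (u : Sp N → ℝ) (h : Sp N) (M : ℝ) (x y : Sp N) :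
    |excess u h M x - excess u h M y| ≤ |u (x + h) - u (y + h)| + |u x - u y| := by
  refine (abs_max_sub_max_le_abs _ _ _).trans ?_
  rw [show u (x + h) - u x - M - (u (y + h) - u y - M) =
    (u (x + h) - u (y + h)) - (u x - u y) by ring]
  exact abs_sub _ _

theorem aestronglyMeasurable_excess {u : Sp N → ℝ} (hu : AEStronglyMeasurable u volume) (h : Sp N)
    (M : ℝ) : AEStronglyMeasurable (excess u h M) volume :=
  (((hu.comp_measurePreserving (measurePreserving_add_right volume h)).sub hu).sub
    aestronglyMeasurable_const).sup aestronglyMeasurable_const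

/-- Increments of the excess are bounded by those of u and of its translate; translating B_r by h
stays in the ball of radius r + ‖h‖. -/
theorem energy_excess_lt_top {u : Sp N → ℝ} {s q r M : ℝ} {h : Sp N} (hq : 0 < q)
    (hum : AEStronglyMeasurable u volume)
    (hu : energy u s q (ball 0 (r + ‖h‖)) < ⊤) : energy (excess u h M) s q (ball 0 r) < ⊤ := by
  set F : Sp N × Sp N → ℝ≥0∞ := fun z =>
    ENNReal.ofReal (|u z.1 - u z.2| ^ q / ‖z.1 - z.2‖ ^ ((N : ℝ) + s * q)) with hF
  have hm : AEMeasurable (fun z : Sp N × Sp N => u z.1 - u z.2) := aemeasurable_sub_prod hum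
  have hFm : AEMeasurable F :=
    (((continuous_abs.measurable.comp_aemeasurable hm).pow_const _).div
      (by fun_prop)).ennreal_ofReal
  set S := ball (0 : Sp N) (r + ‖h‖) ×ˢ ball (0 : Sp N) (r + ‖h‖) with hS
  have hSm : MeasurableSet S := measurableSet_ball.prod measurableSet_ball
  have h1 : ∀ z ∈ ball (0 : Sp N) r ×ˢ ball (0 : Sp N) r, ENNReal.ofReal
      (|excess u h M z.1 - excess u h M z.2| ^ q / ‖z.1 - z.2‖ ^ ((N : ℝ) + s * q)) ≤
      ENNReal.ofReal (2 ^ q) * (S.indicator F (z.1 + h, z.2 + h) + S.indicator F z) := by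
    rintro ⟨x, y⟩ ⟨hx, hy⟩
    simp only [mem_ball_zero_iff] at hx hy
    have hxS : (x, y) ∈ S := by
      constructor <;> simp only [mem_ball_zero_iff] <;> linarith [norm_nonneg h]
    have hxS' : (x + h, y + h) ∈ S := by
      constructor <;> simp only [mem_ball_zero_iff]
      · linarith [norm_add_le x h]
      · linarith [norm_add_le y h]
    rw [indicator_of_mem hxS, indicator_of_mem hxS', hF]
    simp only [add_sub_add_right_eq_sub]
    rw [← ENNReal.ofReal_add (by positivity) (by positivity), ← ENNReal.ofReal_mul (by positivity),
      ← add_div, ← mul_div_assoc]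
    apply ENNReal.ofReal_le_ofReal
    gcongr
    set a := |u (x + h) - u (y + h)|
    set b := |u x - u y|
    have ha : 0 ≤ a := abs_nonneg _
    have hb : 0 ≤ b := abs_nonneg _
    have h2 : |excess u h M x - excess u h M y| ≤ 2 * max a b := by
      have := abs_excess_sub_le u h M x y
      linarith [le_max_left a b, le_max_right a b]
    calc _ ≤ (2 * max a b) ^ q := Real.rpow_le_rpow (abs_nonneg _) h2 hq.le
      _ = 2 ^ q * (max a b) ^ q := Real.mul_rpow (by norm_num) (by positivity)
      _ ≤ 2 ^ q * (a ^ q + b ^ q) := by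
        gcongr
        rcases max_cases a b with h | h <;> rw [h.1]
        · linarith [Real.rpow_nonneg hb q]
        · linarith [Real.rpow_nonneg ha q]
  have h3 : ∫⁻ z, S.indicator F z < ⊤ := by
    rw [lintegral_indicator hSm]; exact hu
  rw [energy]
  refine (setLIntegral_mono' (measurableSet_ball.prod measurableSet_ball) h1).trans_lt ?_
  refine (setLIntegral_le_lintegral _ _).trans_lt ?_
  rw [lintegral_const_mul' _ _ ENNReal.ofReal_ne_top, lintegral_add_right' _ (hFm.indicator hSm),
    (measurePreserving_shift h).lintegral_comp_emb (measurableEmbedding_shift h) (S.indicator F)]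
  exact ENNReal.mul_lt_top ENNReal.ofReal_lt_top (ENNReal.add_lt_top.2 ⟨h3, h3⟩)

/-! ### Cutoffs and error kernels -/

/-- A piecewise linear radial cutoff: `1` on `B_r`, `0` outside `B_{r+ε}`. -/
noncomputable def cutoff (r ε : ℝ) (x : Sp N) : ℝ := max 0 (min 1 ((r + ε - ‖x‖) / ε))

theorem cutoff_nonneg (r ε : ℝ) (x : Sp N) : 0 ≤ cutoff r ε x := le_max_left _ _

theorem cutoff_le_one (r ε : ℝ) (x : Sp N) : cutoff r ε x ≤ 1 :=
  max_le zero_le_one (min_le_left _ _)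

theorem abs_cutoff_le_one (r ε : ℝ) (x : Sp N) : |cutoff r ε x| ≤ 1 := by
  rw [abs_of_nonneg (cutoff_nonneg _ _ _)]; exact cutoff_le_one _ _ _

theorem cutoff_eq_one {r ε : ℝ} (hε : 0 < ε) {x : Sp N} (hx : ‖x‖ ≤ r) : cutoff r ε x = 1 := by
  have : 1 ≤ (r + ε - ‖x‖) / ε := by rw [le_div_iff₀ hε]; linarith
  simp [cutoff, min_eq_left this]

theorem cutoff_eq_zero {r ε : ℝ} (hε : 0 < ε) {x : Sp N} (hx : r + ε ≤ ‖x‖) :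
    cutoff r ε x = 0 := by
  have : (r + ε - ‖x‖) / ε ≤ 0 := div_nonpos_of_nonpos_of_nonneg (by linarith) hε.le
  exact max_eq_left ((min_le_right _ _).trans this)

theorem abs_cutoff_sub_le {r ε : ℝ} (hε : 0 < ε) (x y : Sp N) :
    |cutoff r ε x - cutoff r ε y| ≤ ε⁻¹ * ‖x - y‖ := by
  have h1 : |cutoff r ε x - cutoff r ε y| ≤ |(r + ε - ‖x‖) / ε - (r + ε - ‖y‖) / ε| := by
    unfold cutoff
    rw [max_comm 0, max_comm 0, min_comm 1, min_comm 1]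
    exact (abs_max_sub_max_le_abs _ _ _).trans (abs_inf_sub_inf_le_abs _ _ _)
  refine h1.trans ?_
  rw [← sub_div, abs_div, abs_of_pos hε, inv_mul_eq_div]
  gcongr
  rw [show r + ε - ‖x‖ - (r + ε - ‖y‖) = -(‖x‖ - ‖y‖) by ring, abs_neg]
  exact abs_norm_sub_norm_le x y

theorem abs_cutoff_sub_le_min {r ε : ℝ} (hε : 0 < ε) (hε1 : ε ≤ 1) (x y : Sp N) :
    |cutoff r ε x - cutoff r ε y| ≤ ε⁻¹ * min 1 ‖x - y‖ := by
  have h1 : 1 ≤ ε⁻¹ := (one_le_inv₀ hε).2 hε1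
  rcases le_total 1 ‖x - y‖ with h | h
  · rw [min_eq_left h, mul_one]
    refine le_trans ?_ h1
    rw [abs_le]
    constructor <;> linarith [cutoff_nonneg r ε x, cutoff_nonneg r ε y, cutoff_le_one r ε x,
      cutoff_le_one r ε y]
  · rw [min_eq_right h]; exact abs_cutoff_sub_le hε x y

theorem continuous_cutoff (r ε : ℝ) : Continuous (cutoff r ε : Sp N → ℝ) := by
  unfold cutoff; fun_prop

/-- The weight multiplying the excess in the error terms of the Caccioppoli inequality. -/
noncomputable def errorKernel (p s₁ sₚ ε : ℝ) (u : Sp N → ℝ) (h x y : Sp N) : ℝ :=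
  (4 * ε⁻¹ + (ε ^ ((N : ℝ) + sₚ * p))⁻¹) *
    ((truncKernel (sₚ * p) (x - y) + tailDensity p sₚ u y) +
      (truncKernel (sₚ * p) (x - y) + tailDensity p sₚ u (y + h)) + truncKernel s₁ (x - y))

theorem errorKernel_nonneg {p s₁ sₚ ε : ℝ} (hε : 0 < ε) (u : Sp N → ℝ) (h x y : Sp N) :
    0 ≤ errorKernel p s₁ sₚ ε u h x y := by
  have := truncKernel_nonneg (sₚ * p) (x - y)
  have := truncKernel_nonneg s₁ (x - y)
  have := tailDensity_nonneg p sₚ u y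
  have := tailDensity_nonneg p sₚ u (y + h)
  unfold errorKernel
  positivity

theorem aemeasurable_errorKernel {p s₁ sₚ ε : ℝ} {u : Sp N → ℝ}
    (hu : AEStronglyMeasurable u volume) (h : Sp N) :
    AEMeasurable (fun z : Sp N × Sp N => errorKernel p s₁ sₚ ε u h z.1 z.2) := by
  have h0 := aemeasurable_tailDensity (p := p) (sₚ := sₚ) hu
  have h1 : AEMeasurable (fun z : Sp N × Sp N => tailDensity p sₚ u z.2)
      ((volume : Measure (Sp N)).prod volume) :=
    h0.comp_quasiMeasurePreserving Measure.quasiMeasurePreserving_snd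
  have h2 : AEMeasurable (fun z : Sp N × Sp N => tailDensity p sₚ u (z.2 + h))
      ((volume : Measure (Sp N)).prod volume) :=
    (h0.comp_quasiMeasurePreserving
      (measurePreserving_add_right volume h).quasiMeasurePreserving).comp_quasiMeasurePreserving
        Measure.quasiMeasurePreserving_snd
  have h3 : Measurable (fun z : Sp N × Sp N => truncKernel (sₚ * p) (z.1 - z.2)) := by fun_prop
  have h4 : Measurable (fun z : Sp N × Sp N => truncKernel s₁ (z.1 - z.2)) := by fun_prop
  exact (((h3.aemeasurable.add h1).add (h3.aemeasurable.add h2)).add h4.aemeasurable).const_mul _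

theorem lintegral_errorKernel_le {p s₁ sₚ ε Λ : ℝ} {u : Sp N → ℝ} (hε : 0 < ε)
    (hu : AEStronglyMeasurable u volume)
    (hΛ : ∫⁻ y, ENNReal.ofReal (tailDensity p sₚ u y) ≤ ENNReal.ofReal Λ) (h x : Sp N) :
    ∫⁻ y, ENNReal.ofReal (errorKernel p s₁ sₚ ε u h x y) ≤
      ENNReal.ofReal (4 * ε⁻¹ + (ε ^ ((N : ℝ) + sₚ * p))⁻¹) *
        ((kernelMass N (sₚ * p) + ENNReal.ofReal Λ) + (kernelMass N (sₚ * p) + ENNReal.ofReal Λ) +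
          kernelMass N s₁) := by
  have h0 := (aemeasurable_tailDensity (p := p) (sₚ := sₚ) hu).ennreal_ofReal
  have k1 := fun y => truncKernel_nonneg (sₚ * p) (x - y)
  have k2 := fun y => truncKernel_nonneg s₁ (x - y)
  have k3 := tailDensity_nonneg p sₚ u
  have hm1 : Measurable fun y => ENNReal.ofReal (truncKernel (sₚ * p) (x - y)) := by fun_prop
  have hm2 : Measurable fun y => ENNReal.ofReal (truncKernel s₁ (x - y)) := by fun_prop
  have hsh : ∫⁻ y, ENNReal.ofReal (tailDensity p sₚ u (y + h)) =
      ∫⁻ y, ENNReal.ofReal (tailDensity p sₚ u y) :=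
    lintegral_add_right_eq_self (fun y => ENNReal.ofReal (tailDensity p sₚ u y)) h
  have heq : ∀ y, ENNReal.ofReal (errorKernel p s₁ sₚ ε u h x y) =
      ENNReal.ofReal (4 * ε⁻¹ + (ε ^ ((N : ℝ) + sₚ * p))⁻¹) *
      ((ENNReal.ofReal (tailDensity p sₚ u y) + ENNReal.ofReal (truncKernel (sₚ * p) (x - y))) +
        (ENNReal.ofReal (tailDensity p sₚ u (y + h)) +
          ENNReal.ofReal (truncKernel (sₚ * p) (x - y))) +
        ENNReal.ofReal (truncKernel s₁ (x - y))) := by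
    intro y
    have hc : 0 ≤ 4 * ε⁻¹ + (ε ^ ((N : ℝ) + sₚ * p))⁻¹ := by positivity
    rw [errorKernel, ENNReal.ofReal_mul hc,
      ENNReal.ofReal_add (add_nonneg (add_nonneg (k1 y) (k3 y)) (add_nonneg (k1 y) (k3 _))) (k2 y),
      ENNReal.ofReal_add (add_nonneg (k1 y) (k3 y)) (add_nonneg (k1 y) (k3 _)),
      ENNReal.ofReal_add (k1 y) (k3 y),
      ENNReal.ofReal_add (k1 y) (k3 _), add_comm (ENNReal.ofReal (truncKernel (sₚ * p) (x - y))),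
      add_comm (ENNReal.ofReal (truncKernel (sₚ * p) (x - y)))]
  have hA : AEMeasurable fun y => ENNReal.ofReal (tailDensity p sₚ u y) +
      ENNReal.ofReal (truncKernel (sₚ * p) (x - y)) := h0.add hm1.aemeasurable
  simp only [heq]
  rw [lintegral_const_mul' _ _ ENNReal.ofReal_ne_top, lintegral_add_right _ hm2,
    lintegral_add_left' hA, lintegral_add_right _ hm1,
    lintegral_add_right _ hm1, hsh, lintegral_truncKernel_sub, lintegral_truncKernel_sub,
    add_comm (kernelMass N (sₚ * p))]
  gcongr

/-- The absolute value of the kernel for differences. -/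
theorem abs_diffKernel_le {p s₁ sₚ lam : ℝ} {u : Sp N → ℝ} {Z : Sp N × Sp N → ℝ} {h x y : Sp N}
    (hp : 1 < p) (hl0 : 0 ≤ lam) (hl1 : lam ≤ 1)
    (hZ : Z (x, y) ∈ sgnSet (u x - u y))
    (hZh : Z (x + h, y + h) ∈ sgnSet (u (x + h) - u (y + h))) :
    |diffKernel p s₁ sₚ lam u Z h (x, y)| ≤
      (|u (x + h) - u (y + h)| ^ (p - 1) + |u x - u y| ^ (p - 1)) / ‖x - y‖ ^ ((N : ℝ) + sₚ * p) +
        2 / ‖x - y‖ ^ ((N : ℝ) + s₁) := by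
  unfold diffKernel
  refine (abs_add_le _ _).trans (add_le_add ?_ ?_)
  · rw [abs_div, abs_of_nonneg (Real.rpow_nonneg (norm_nonneg _) _), ← abs_signedPow hp,
      ← abs_signedPow hp]
    gcongr
    exact abs_sub _ _
  · rw [abs_mul, abs_div, abs_of_nonneg (Real.rpow_nonneg (norm_nonneg _) _), abs_of_nonneg hl0]
    have h1 := abs_le_one_of_mem_sgnSet hZ
    have h2 := abs_le_one_of_mem_sgnSet hZh
    have h3 : |Z (x + h, y + h) - Z (x, y)| ≤ 2 := (abs_sub _ _).trans (by linarith)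
    calc lam * (|Z (x + h, y + h) - Z (x, y)| / ‖x - y‖ ^ ((N : ℝ) + s₁))
        ≤ 1 * (2 / ‖x - y‖ ^ ((N : ℝ) + s₁)) := by gcongr
      _ = _ := one_mul _

/-- The kernel for differences is bounded by the error kernel away from the diagonal. -/
theorem abs_diffKernel_far_le {p s₁ sₚ lam ε : ℝ} {u : Sp N → ℝ} {Z : Sp N × Sp N → ℝ}
    {h x y : Sp N} (hp : 1 < p) (hp2 : p < 2) (hs : 0 ≤ sₚ * p) (hl0 : 0 ≤ lam) (hl1 : lam ≤ 1)
    (hu : ∀ x, ‖x‖ < 1 → |u x| ≤ 1) (hε : 0 < ε) (hε1 : ε ≤ 1)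
    (hZ : Z (x, y) ∈ sgnSet (u x - u y))
    (hZh : Z (x + h, y + h) ∈ sgnSet (u (x + h) - u (y + h)))
    (hx : ‖x‖ ≤ 1 - ε) (hxh : ‖x + h‖ ≤ 1 - ε) (hxy : ε ≤ ‖x - y‖) :
    |diffKernel p s₁ sₚ lam u Z h (x, y)| ≤ errorKernel p s₁ sₚ ε u h x y := by
  refine (abs_diffKernel_le hp hl0 hl1 hZ hZh).trans ?_
  have f1 := far_bound hp hs hu hε hε1 hx hxy
  have f2 := far_bound hp hs hu hε hε1 (x := x + h) (y := y + h) hxh (by simpa using hxy)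
  rw [add_sub_add_right_eq_sub] at f2
  have f3 := inv_rpow_le_truncKernel (s := s₁) hε hε1 hxy
  have hb : ∀ x' y' : Sp N, ‖x'‖ ≤ 1 - ε → |u x' - u y'| ^ (p - 1) ≤ 1 + |u y'| ^ (p - 1) := by
    intro x' y' hx'
    refine (abs_sub_rpow_le (by linarith) (by linarith)).trans ?_
    have : |u x'| ^ (p - 1) ≤ 1 :=
      Real.rpow_le_one (abs_nonneg _) (hu x' (by linarith)) (by linarith)
    linarith
  have t1 := truncKernel_nonneg (sₚ * p) (x - y)
  have t2 := truncKernel_nonneg s₁ (x - y)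
  have t3 := tailDensity_nonneg p sₚ u y
  have t4 := tailDensity_nonneg p sₚ u (y + h)
  have hpow : 0 < ε ^ ((N : ℝ) + sₚ * p) := Real.rpow_pos_of_pos hε _
  set D := (2 * ε⁻¹ + (ε ^ ((N : ℝ) + sₚ * p))⁻¹) with hD
  have hDD : D ≤ 4 * ε⁻¹ + (ε ^ ((N : ℝ) + sₚ * p))⁻¹ := by
    have := inv_pos.2 hε
    rw [hD]; linarith
  calc _ ≤ ((1 + |u (y + h)| ^ (p - 1)) + (1 + |u y| ^ (p - 1))) / ‖x - y‖ ^ ((N : ℝ) + sₚ * p) +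
        2 / ‖x - y‖ ^ ((N : ℝ) + s₁) := by
        gcongr
        exacts [hb _ _ hxh, hb _ _ hx]
    _ = (1 + |u y| ^ (p - 1)) / ‖x - y‖ ^ ((N : ℝ) + sₚ * p) +
        (1 + |u (y + h)| ^ (p - 1)) / ‖x - y‖ ^ ((N : ℝ) + sₚ * p) +
        2 * (1 / ‖x - y‖ ^ ((N : ℝ) + s₁)) := by ring
    _ ≤ D * (truncKernel (sₚ * p) (x - y) + tailDensity p sₚ u y) +
        D * (truncKernel (sₚ * p) (x - y) + tailDensity p sₚ u (y + h)) +
        2 * (ε⁻¹ * truncKernel s₁ (x - y)) := by gcongr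
    _ ≤ (4 * ε⁻¹ + (ε ^ ((N : ℝ) + sₚ * p))⁻¹) *
          (truncKernel (sₚ * p) (x - y) + tailDensity p sₚ u y) +
        (4 * ε⁻¹ + (ε ^ ((N : ℝ) + sₚ * p))⁻¹) *
          (truncKernel (sₚ * p) (x - y) + tailDensity p sₚ u (y + h)) +
        (4 * ε⁻¹ + (ε ^ ((N : ℝ) + sₚ * p))⁻¹) * truncKernel s₁ (x - y) := by
        rw [← mul_assoc]
        gcongr
        have := inv_pos.2 hε
        have := inv_pos.2 hpow
        linarith
    _ = _ := by rw [errorKernel]; ring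

/-- Near the diagonal, the kernel times the oscillation of the cutoff is bounded by the error
kernel. -/
theorem abs_diffKernel_mul_cutoff_le {p s₁ sₚ lam r ε : ℝ} {u : Sp N → ℝ} {Z : Sp N × Sp N → ℝ}
    {h x y : Sp N} (hp : 1 < p) (hp2 : p < 2) (hl0 : 0 ≤ lam) (hl1 : lam ≤ 1)
    (hu : ∀ x, ‖x‖ < 1 → |u x| ≤ 1) (hε : 0 < ε) (hε1 : ε ≤ 1)
    (hZ : Z (x, y) ∈ sgnSet (u x - u y))
    (hZh : Z (x + h, y + h) ∈ sgnSet (u (x + h) - u (y + h)))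
    (hx : ‖x‖ < 1) (hxh : ‖x + h‖ < 1) (hy : ‖y‖ < 1) (hyh : ‖y + h‖ < 1) :
    |diffKernel p s₁ sₚ lam u Z h (x, y)| * |cutoff r ε x - cutoff r ε y| ≤
      errorKernel p s₁ sₚ ε u h y x := by
  have h2 : ∀ x' y' : Sp N, ‖x'‖ < 1 → ‖y'‖ < 1 → |u x' - u y'| ^ (p - 1) ≤ 2 := by
    intro x' y' hx' hy'
    refine (abs_sub_rpow_le (by linarith) (by linarith)).trans ?_
    have h1 : |u x'| ^ (p - 1) ≤ 1 := Real.rpow_le_one (abs_nonneg _) (hu x' hx') (by linarith)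
    have h1 : |u y'| ^ (p - 1) ≤ 1 := Real.rpow_le_one (abs_nonneg _) (hu y' hy') (by linarith)
    linarith
  have t1 := truncKernel_nonneg (sₚ * p) (x - y)
  have t2 := truncKernel_nonneg s₁ (x - y)
  have t3 := tailDensity_nonneg p sₚ u x
  have t4 := tailDensity_nonneg p sₚ u (x + h)
  have hpow : 0 < ε ^ ((N : ℝ) + sₚ * p) := Real.rpow_pos_of_pos hε _
  have hi := inv_pos.2 hε
  have hi2 := inv_pos.2 hpow
  set m := min 1 ‖x - y‖ with hm
  have hm0 : 0 ≤ m := le_min zero_le_one (norm_nonneg _)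
  calc _ ≤ ((2 + 2) / ‖x - y‖ ^ ((N : ℝ) + sₚ * p) + 2 / ‖x - y‖ ^ ((N : ℝ) + s₁)) * (ε⁻¹ * m) := by
        gcongr
        · refine (abs_diffKernel_le hp hl0 hl1 hZ hZh).trans ?_
          gcongr
          exacts [h2 _ _ hxh hyh, h2 _ _ hx hy]
        · exact abs_cutoff_sub_le_min hε hε1 x y
    _ = 4 * ε⁻¹ * truncKernel (sₚ * p) (x - y) + 2 * ε⁻¹ * truncKernel s₁ (x - y) := by
        simp only [truncKernel, ← hm]; ring
    _ ≤ (4 * ε⁻¹ + (ε ^ ((N : ℝ) + sₚ * p))⁻¹) * truncKernel (sₚ * p) (x - y) +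
        (4 * ε⁻¹ + (ε ^ ((N : ℝ) + sₚ * p))⁻¹) * truncKernel s₁ (x - y) := by
        gcongr <;> linarith
    _ ≤ _ := by
        rw [errorKernel, truncKernel_sub_comm (sₚ * p) y x, truncKernel_sub_comm s₁ y x, ← mul_add]
        gcongr
        linarith

/-- The main term in the Caccioppoli inequality. -/
noncomputable def mainTerm (p sₚ γ H r ρ M : ℝ) (u : Sp N → ℝ) (h x y : Sp N) : ℝ :=
  if ‖x‖ < r ∧ ‖x - y‖ < ρ then
    (p - 1) * (H * ρ ^ γ) ^ (p - 2) * (ρ ^ ((N : ℝ) + sₚ * p))⁻¹ *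
      (excess u h M x * max (M - (u (y + h) - u y)) 0)
  else 0

theorem mainTerm_nonneg {p sₚ γ H r ρ M : ℝ} (hp : 1 < p) (hH : 0 ≤ H) (hρ : 0 ≤ ρ) (u : Sp N → ℝ)
    (h x y : Sp N) : 0 ≤ mainTerm p sₚ γ H r ρ M u h x y := by
  unfold mainTerm
  have := excess_nonneg u h M x
  have : 0 ≤ p - 1 := by linarith
  split_ifs <;> positivity

/-- The order of w(x) and w(y), for w = u(· + h) - u, is the order of the translated and the
original increments of u. Both parts of the kernel are monotone in the increment, and the excess is
monotone in w, so the two factors share their sign. -/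
theorem diffKernel_mul_excess_sub_nonneg {p s₁ sₚ lam M : ℝ} {u : Sp N → ℝ} {Z : Sp N × Sp N → ℝ}
    {h x y : Sp N} (hp : 1 < p) (hp2 : p < 2) (hl0 : 0 ≤ lam)
    (hZ : Z (x, y) ∈ sgnSet (u x - u y))
    (hZh : Z (x + h, y + h) ∈ sgnSet (u (x + h) - u (y + h))) :
    0 ≤ diffKernel p s₁ sₚ lam u Z h (x, y) * (excess u h M x - excess u h M y) := by
  rcases lt_trichotomy (u (x + h) - u x) (u (y + h) - u y) with hw | hw | hw
  · refine mul_nonneg_of_nonpos_of_nonpos ?_ (sub_nonpos.2 (excess_mono hw.le))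
    have h1 := signedPow_mono hp hp2 (show u (x + h) - u (y + h) ≤ u x - u y by linarith)
    have h2 := sgnSet_mono hZ hZh (by linarith)
    refine add_nonpos (div_nonpos_of_nonpos_of_nonneg (by simpa using h1) (by positivity)) ?_
    exact mul_nonpos_of_nonneg_of_nonpos hl0
      (div_nonpos_of_nonpos_of_nonneg (by simpa using h2) (by positivity))
  · rw [le_antisymm (excess_mono hw.ge) (excess_mono hw.le), sub_self, mul_zero]
  · refine mul_nonneg ?_ (sub_nonneg.2 (excess_mono hw.le))
    have h1 := signedPow_mono hp hp2 (show u x - u y ≤ u (x + h) - u (y + h) by linarith)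
    have h2 := sgnSet_mono hZh hZ (by linarith)
    refine add_nonneg (div_nonneg (by simpa using h1) (by positivity)) ?_
    exact mul_nonneg hl0 (div_nonneg (by simpa using h2) (by positivity))

/-- The right side is always nonnegative, so only pairs with ‖x‖ < r, ‖x - y‖ < ρ and w(x) > M >
w(y) matter. There the cutoff is 1 and both increments of u are at most H ρ^γ; `signedPow_sub_ge`
bounds the p-part below by its slope times w(x) - w(y) ≥ M - w(y), and the nonnegative 1-part is
discarded. -/
theorem mainTerm_le {p s₁ sₚ lam γ H r ρ M ε : ℝ} {u : Sp N → ℝ} {Z : Sp N × Sp N → ℝ}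
    {h x y : Sp N} (hp : 1 < p) (hp2 : p < 2) (hs : 0 ≤ sₚ * p) (hl0 : 0 ≤ lam) (hε : 0 < ε)
    (hγ : 0 ≤ γ) (hH : 0 ≤ H)
    (hZ : Z (x, y) ∈ sgnSet (u x - u y))
    (hZh : Z (x + h, y + h) ∈ sgnSet (u (x + h) - u (y + h)))
    (hxy : |u x - u y| ≤ H * ‖x - y‖ ^ γ) (hxyh : |u (x + h) - u (y + h)| ≤ H * ‖x - y‖ ^ γ) :
    mainTerm p sₚ γ H r ρ M u h x y ≤
      diffKernel p s₁ sₚ lam u Z h (x, y) *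
        (cutoff r ε x * (excess u h M x - excess u h M y)) := by
  have hnn : 0 ≤ diffKernel p s₁ sₚ lam u Z h (x, y) *
      (cutoff r ε x * (excess u h M x - excess u h M y)) := by
    rw [mul_left_comm]
    exact mul_nonneg (cutoff_nonneg _ _ _) (diffKernel_mul_excess_sub_nonneg hp hp2 hl0 hZ hZh)
  unfold mainTerm
  split_ifs with hc
  · by_cases hx : u (x + h) - u x ≤ M
    · have : excess u h M x = 0 := max_eq_right (by linarith)
      rw [this, zero_mul, mul_zero]
      rw [this] at hnn
      exact hnn
    by_cases hy : M ≤ u (y + h) - u y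
    · rw [max_eq_right (by linarith : M - (u (y + h) - u y) ≤ 0), mul_zero, mul_zero]
      exact hnn
    push Not at hx hy
    have hy0 : excess u h M y = 0 := max_eq_right (by linarith)
    rw [hy0, sub_zero, cutoff_eq_one hε hc.1.le, one_mul,
      max_eq_left (by linarith : 0 ≤ M - (u (y + h) - u y))]
    have hne : x ≠ y := by
      rintro rfl; linarith
    have hpos : 0 < ‖x - y‖ := norm_pos_iff.2 (sub_ne_zero.2 hne)
    have hm : H * ‖x - y‖ ^ γ ≤ H * ρ ^ γ := by gcongr; exact hc.2.le
    have hJ := signedPow_sub_ge hp hp2 (hxyh.trans hm) (hxy.trans hm)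
      (show u x - u y ≤ u (x + h) - u (y + h) by linarith)
    have hZm := sgnSet_mono hZh hZ (by linarith)
    have hv := excess_nonneg u h M x
    have hρ : 0 < ρ := hpos.trans hc.2
    have hK : (ρ ^ ((N : ℝ) + sₚ * p))⁻¹ ≤ (‖x - y‖ ^ ((N : ℝ) + sₚ * p))⁻¹ := by
      gcongr; exact hc.2.le
    have hc0 : 0 ≤ (p - 1) * (H * ρ ^ γ) ^ (p - 2) := mul_nonneg (by linarith) (by positivity)
    have hW : (p - 1) * (H * ρ ^ γ) ^ (p - 2) * (M - (u (y + h) - u y)) *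
        (ρ ^ ((N : ℝ) + sₚ * p))⁻¹ ≤ diffKernel p s₁ sₚ lam u Z h (x, y) := by
      have e1 : (p - 1) * (H * ρ ^ γ) ^ (p - 2) * (M - (u (y + h) - u y)) ≤
          signedPow p (u (x + h) - u (y + h)) - signedPow p (u x - u y) := by
        exact (mul_le_mul_of_nonneg_left (by linarith) hc0).trans hJ
      have e2 : 0 ≤ lam * ((Z (x + h, y + h) - Z (x, y)) / ‖x - y‖ ^ ((N : ℝ) + s₁)) :=
        mul_nonneg hl0 (div_nonneg (by linarith) (by positivity))
      unfold diffKernel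
      refine le_add_of_le_of_nonneg ?_ e2
      rw [div_eq_mul_inv]
      exact mul_le_mul e1 hK (by positivity) (le_trans (mul_nonneg hc0 (by linarith)) e1)
    calc _ = ((p - 1) * (H * ρ ^ γ) ^ (p - 2) * (M - (u (y + h) - u y)) *
        (ρ ^ ((N : ℝ) + sₚ * p))⁻¹) * excess u h M x := by ring
      _ ≤ _ := by gcongr
  · exact hnn

/-- The pointwise form of the Caccioppoli inequality. -/
theorem mainTerm_le_add_error {p s₁ sₚ lam γ H r ρ M ε : ℝ} {u : Sp N → ℝ}
    {Z : Sp N × Sp N → ℝ} {h x y : Sp N} (hp : 1 < p) (hp2 : p < 2) (hs : 0 ≤ sₚ * p)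
    (hl0 : 0 ≤ lam) (hl1 : lam ≤ 1) (hu : ∀ x, ‖x‖ < 1 → |u x| ≤ 1) (hε : 0 < ε) (hr : 0 ≤ r)
    (hrε : r + 4 * ε ≤ 1) (hρ : ρ ≤ ε) (hh : ‖h‖ ≤ ε) (hγ : 0 ≤ γ) (hH : 0 ≤ H)
    (hHol : ∀ x y, ‖x‖ < r + 4 * ε → ‖y‖ < r + 4 * ε → |u x - u y| ≤ H * ‖x - y‖ ^ γ)
    (hZ : Z (x, y) ∈ sgnSet (u x - u y))
    (hZh : Z (x + h, y + h) ∈ sgnSet (u (x + h) - u (y + h))) :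
    mainTerm p sₚ γ H r ρ M u h x y ≤
      diffKernel p s₁ sₚ lam u Z h (x, y) *
        (cutoff r ε x * excess u h M x - cutoff r ε y * excess u h M y) +
      ((ball 0 (r + 2 * ε)).indicator (excess u h M) x * errorKernel p s₁ sₚ ε u h x y +
        (ball 0 (r + 2 * ε)).indicator (excess u h M) y * errorKernel p s₁ sₚ ε u h y x) := by
  have hε1 : ε ≤ 1 := by linarith
  have hvx := excess_nonneg u h M x
  have hvy := excess_nonneg u h M y
  have hEx := errorKernel_nonneg (p := p) (s₁ := s₁) (sₚ := sₚ) hε u h x y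
  have hEy := errorKernel_nonneg (p := p) (s₁ := s₁) (sₚ := sₚ) hε u h y x
  have hsh : ∀ z : Sp N, ‖z + h‖ ≤ ‖z‖ + ε := fun z => (norm_add_le z h).trans (by linarith)
  have hmain0 : ¬ (‖x‖ < r + 2 * ε ∧ ‖y‖ < r + 2 * ε) → mainTerm p sₚ γ H r ρ M u h x y = 0 := by
    intro hn
    apply if_neg
    rintro ⟨h1, h2⟩
    refine hn ⟨by linarith, ?_⟩
    have := norm_sub_norm_le y x
    rw [norm_sub_rev] at this
    linarith
  by_cases hx : ‖x‖ < r + 2 * ε <;> by_cases hy : ‖y‖ < r + 2 * ε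
  · rw [indicator_of_mem (by simpa using hx), indicator_of_mem (by simpa using hy)]
    have hxh : ‖x + h‖ < r + 4 * ε := (hsh x).trans_lt (by linarith)
    have hyh : ‖y + h‖ < r + 4 * ε := (hsh y).trans_lt (by linarith)
    have hx' : ‖x‖ < r + 4 * ε := by linarith
    have hy' : ‖y‖ < r + 4 * ε := by linarith
    have hxyh := hHol _ _ hxh hyh
    rw [add_sub_add_right_eq_sub] at hxyh
    have h1 := mainTerm_le (s₁ := s₁) (r := r) (ρ := ρ) (M := M) hp hp2 hs hl0 hε hγ hH hZ hZh
      (hHol _ _ hx' hy') hxyh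
    have h2 := abs_diffKernel_mul_cutoff_le (s₁ := s₁) (sₚ := sₚ) (r := r) hp hp2 hl0 hl1 hu hε
      hε1 hZ hZh (hx'.trans_le hrε) (hxh.trans_le hrε) (hy'.trans_le hrε) (hyh.trans_le hrε)
    have h3 : -(errorKernel p s₁ sₚ ε u h y x) ≤
        diffKernel p s₁ sₚ lam u Z h (x, y) * (cutoff r ε x - cutoff r ε y) := by
      rw [← abs_mul] at h2
      exact (abs_le.1 h2).1
    have h4 := mul_le_mul_of_nonneg_left h3 hvy
    have h5 := mul_nonneg hvx hEx
    -- Discrete product rule: the cutoff varies only against the value of the excess at y, hence the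
    -- order (y, x) in the error kernel.
    have h6 : diffKernel p s₁ sₚ lam u Z h (x, y) *
        (cutoff r ε x * excess u h M x - cutoff r ε y * excess u h M y) =
        diffKernel p s₁ sₚ lam u Z h (x, y) *
          (cutoff r ε x * (excess u h M x - excess u h M y)) +
        excess u h M y *
          (diffKernel p s₁ sₚ lam u Z h (x, y) * (cutoff r ε x - cutoff r ε y)) := by ring
    rw [h6]
    linarith
  · rw [hmain0 (fun hc => hy hc.2), indicator_of_mem (by simpa using hx),
      indicator_of_notMem (by simpa using hy), zero_mul, add_zero,
      cutoff_eq_zero hε (x := y) (by linarith), zero_mul, sub_zero]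
    by_cases hx2 : r + ε ≤ ‖x‖
    · rw [cutoff_eq_zero hε hx2, zero_mul, mul_zero, zero_add]
      positivity
    · have hxy : ε ≤ ‖x - y‖ := by
        have := norm_sub_norm_le y x
        rw [norm_sub_rev] at this
        linarith
      have h1 := abs_diffKernel_far_le (s₁ := s₁) hp hp2 hs hl0 hl1 hu hε hε1 hZ hZh
        (by linarith) ((hsh x).trans (by linarith)) hxy
      have h2 : |diffKernel p s₁ sₚ lam u Z h (x, y) * (cutoff r ε x * excess u h M x)| ≤
          errorKernel p s₁ sₚ ε u h x y * (1 * excess u h M x) := by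
        rw [abs_mul, abs_mul, abs_of_nonneg hvx]
        gcongr
        exact abs_cutoff_le_one _ _ _
      have := (abs_le.1 h2).1
      linarith
  · rw [hmain0 (fun hc => hx hc.1), indicator_of_mem (s := ball (0 : Sp N) (r + 2 * ε)) (a := y)
      (by simpa using hy),
      indicator_of_notMem (by simpa using hx), zero_mul, zero_add,
      cutoff_eq_zero hε (x := x) (by linarith), zero_mul, zero_sub]
    by_cases hy2 : r + ε ≤ ‖y‖
    · rw [cutoff_eq_zero hε hy2, zero_mul, neg_zero, mul_zero, zero_add]
      positivity
    · have hxy : ε ≤ ‖y - x‖ := by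
        have := norm_sub_norm_le x y
        rw [norm_sub_rev] at this
        linarith
      -- Exchanging x and y changes the sign of every increment. The function -Z(z.2, z.1) is the
      -- matching selection, so the far bound already obtained applies with the roles reversed.
      have h0 : diffKernel p s₁ sₚ lam u (fun z => -Z (z.2, z.1)) h (y, x) =
          -diffKernel p s₁ sₚ lam u Z h (x, y) := by
        simp only [diffKernel]
        rw [show u (y + h) - u (x + h) = -(u (x + h) - u (y + h)) by ring, signedPow_neg,
          show u y - u x = -(u x - u y) by ring, signedPow_neg, norm_sub_rev y x]
        ring
      have hneg : ∀ {a t : ℝ}, t ∈ sgnSet a → -t ∈ sgnSet (-a) := by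
        rintro a t ⟨ha, hb⟩
        refine ⟨fun h => ?_, fun h => ?_⟩
        · have := ha (neg_eq_zero.1 h)
          exact ⟨by linarith [this.2], by linarith [this.1]⟩
        · rw [hb (neg_ne_zero.1 h), abs_neg, neg_div]
      have h1 := abs_diffKernel_far_le (s₁ := s₁) (sₚ := sₚ) (Z := fun z => -Z (z.2, z.1)) (x := y)
        (y := x) (h := h)
        hp hp2 hs hl0 hl1 hu hε hε1 (by simpa using hneg hZ) (by simpa using hneg hZh)
        (by linarith) ((hsh y).trans (by linarith)) hxy
      rw [h0, abs_neg] at h1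
      have h2 : |diffKernel p s₁ sₚ lam u Z h (x, y) * (-(cutoff r ε y * excess u h M y))| ≤
          errorKernel p s₁ sₚ ε u h y x * (1 * excess u h M y) := by
        rw [abs_mul, abs_neg, abs_mul, abs_of_nonneg hvy]
        gcongr
        exact abs_cutoff_le_one _ _ _
      have := (abs_le.1 h2).1
      linarith
  · rw [hmain0 (fun hc => hx hc.1), cutoff_eq_zero hε (x := x) (by linarith),
      cutoff_eq_zero hε (x := y) (by linarith), indicator_of_notMem (by simpa using hx),
      indicator_of_notMem (by simpa using hy)]
    simp

/-- Passes from the pointwise inequality to an integrated one: I has no sign but integrates to zero.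
The lower integral allows m to be used before its measurability is known. -/
theorem lintegral_le_of_integral_eq_zero {α : Type*} [MeasurableSpace α] {μ : Measure α}
    {m I E : α → ℝ} (hI : Integrable I μ) (hI0 : ∫ a, I a ∂μ = 0) (hE : Integrable E μ)
    (hE0 : ∀ a, 0 ≤ E a) (hm : ∀ a, 0 ≤ m a) (h : ∀ᵐ a ∂μ, m a ≤ I a + E a) :
    ∫⁻ a, ENNReal.ofReal (m a) ∂μ ≤ ∫⁻ a, ENNReal.ofReal (E a) ∂μ := by
  have h1 : 0 ≤ᵐ[μ] fun a => I a + E a := h.mono fun a ha => (hm a).trans ha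
  calc ∫⁻ a, ENNReal.ofReal (m a) ∂μ ≤ ∫⁻ a, ENNReal.ofReal (I a + E a) ∂μ :=
        lintegral_mono_ae (h.mono fun a ha => ENNReal.ofReal_le_ofReal ha)
    _ = ENNReal.ofReal (∫ a, (I a + E a) ∂μ) :=
        (ofReal_integral_eq_lintegral_ofReal (hI.add hE) h1).symm
    _ = ENNReal.ofReal (∫ a, E a ∂μ) := by rw [integral_add hI hE, hI0, zero_add]
    _ = _ := ofReal_integral_eq_lintegral_ofReal hE (ae_of_all _ hE0)

theorem integrable_symm_weight {g : Sp N → ℝ} {q : Sp N → Sp N → ℝ} {K : ℝ≥0∞}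
    (hg0 : ∀ x, 0 ≤ g x) (hgm : AEMeasurable g) (hq0 : ∀ x y, 0 ≤ q x y)
    (hqm : AEMeasurable (fun z : Sp N × Sp N => q z.1 z.2))
    (hK : ∀ x, ∫⁻ y, ENNReal.ofReal (q x y) ≤ K) (hKtop : K < ⊤)
    (hg : ∫⁻ x, ENNReal.ofReal (g x) < ⊤) :
    Integrable (fun z : Sp N × Sp N => g z.1 * q z.1 z.2 + g z.2 * q z.2 z.1) ∧
      ∫⁻ z : Sp N × Sp N, ENNReal.ofReal (g z.1 * q z.1 z.2 + g z.2 * q z.2 z.1) ≤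
        2 * K * ∫⁻ x, ENNReal.ofReal (g x) := by
  have hle : ∫⁻ z : Sp N × Sp N, ENNReal.ofReal (g z.1 * q z.1 z.2 + g z.2 * q z.2 z.1) ≤
      2 * K * ∫⁻ x, ENNReal.ofReal (g x) := by
    have := lintegral_symm_weight_le (g := fun x => ENNReal.ofReal (g x))
      (Q := fun x y => ENNReal.ofReal (q x y)) (c := K)
      hgm.ennreal_ofReal (fun x => ENNReal.ofReal_ne_top) hqm.ennreal_ofReal hK
    refine le_trans (le_of_eq (lintegral_congr fun z => ?_)) this
    rw [ENNReal.ofReal_add (mul_nonneg (hg0 _) (hq0 _ _)) (mul_nonneg (hg0 _) (hq0 _ _)),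
      ENNReal.ofReal_mul (hg0 _), ENNReal.ofReal_mul (hg0 _)]
  have m1 : AEMeasurable (fun z : Sp N × Sp N => g z.1 * q z.1 z.2)
      ((volume : Measure (Sp N)).prod volume) :=
    (hgm.comp_quasiMeasurePreserving Measure.quasiMeasurePreserving_fst).mul hqm
  have m2 : AEMeasurable (fun z : Sp N × Sp N => g z.2 * q z.2 z.1)
      ((volume : Measure (Sp N)).prod volume) :=
    m1.comp_quasiMeasurePreserving Measure.measurePreserving_swap.quasiMeasurePreserving
  refine ⟨⟨(m1.add m2).aestronglyMeasurable, ?_⟩, hle⟩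
  rw [hasFiniteIntegral_iff_ofReal (ae_of_all _ fun z =>
    add_nonneg (mul_nonneg (hg0 _) (hq0 _ _)) (mul_nonneg (hg0 _) (hq0 _ _)))]
  exact hle.trans_lt (ENNReal.mul_lt_top (ENNReal.mul_lt_top (by simp) hKtop) hg)

/-! ### Lower bound for the main term by cancellation of means -/

/-- The volume of the unit ball. -/
noncomputable def unitVol (N : ℕ) : ℝ := volume.real (ball (0 : Sp N) 1)

theorem unitVol_pos : 0 < unitVol N :=
  ENNReal.toReal_pos (measure_ball_pos _ _ one_pos).ne' measure_ball_lt_top.ne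

theorem volume_real_ball (hN : 1 ≤ N) (x : Sp N) {r : ℝ} (hr : 0 ≤ r) :
    volume.real (ball x r) = r ^ N * unitVol N := by
  have : Nonempty (Fin N) := ⟨⟨0, hN⟩⟩
  have : Nontrivial (Sp N) := inferInstance
  rw [measureReal_def, Measure.addHaar_ball _ _ hr, ENNReal.toReal_mul,
    ENNReal.toReal_ofReal (by positivity), finrank_euclideanSpace, Fintype.card_fin, unitVol,
    measureReal_def]

theorem integrableOn_ball_of_bdd {u : Sp N → ℝ} (hum : AEStronglyMeasurable u volume) {x : Sp N}
    {r C : ℝ} (hC : ∀ y ∈ ball x r, |u y| ≤ C) : IntegrableOn u (ball x r) :=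
  Measure.integrableOn_of_bounded measure_ball_lt_top.ne hum
    ((ae_restrict_mem measurableSet_ball).mono fun y hy => hC y hy)

/-- The ball about x + h of radius ρ - ‖h‖ lies in both balls, so the difference sits in a shell;
Bernoulli's inequality bounds the volume of the shell. -/
theorem volume_real_ball_diff_le (hN : 1 ≤ N) {x h : Sp N} {ρ : ℝ} (hh : ‖h‖ ≤ ρ) :
    volume.real (ball (x + h) ρ \ ball x ρ) ≤ N * ρ ^ (N - 1) * ‖h‖ * unitVol N := by
  have hρ : 0 ≤ ρ := (norm_nonneg h).trans hh
  have hsub : ball (x + h) (ρ - ‖h‖) ⊆ ball (x + h) ρ ∩ ball x ρ := by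
    intro y hy
    rw [mem_ball] at hy
    refine ⟨mem_ball.2 (by linarith [norm_nonneg h]), mem_ball.2 ?_⟩
    have := dist_triangle y (x + h) x
    rw [dist_self_add_left] at this
    linarith
  have hfin : volume (ball (x + h) ρ) ≠ ⊤ := measure_ball_lt_top.ne
  have h1 : volume.real (ball (x + h) ρ \ ball x ρ) ≤
      volume.real (ball (x + h) ρ \ ball (x + h) (ρ - ‖h‖)) :=
    measureReal_mono (sdiff_subset_sdiff_right (hsub.trans inter_subset_right))
      (measure_ne_top_of_subset sdiff_subset hfin)
  have h2 : volume.real (ball (x + h) ρ \ ball (x + h) (ρ - ‖h‖)) =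
      ρ ^ N * unitVol N - (ρ - ‖h‖) ^ N * unitVol N := by
    rw [measureReal_sdiff (ball_subset_ball (by linarith [norm_nonneg h])) measurableSet_ball,
      volume_real_ball hN _ hρ, volume_real_ball hN _ (by linarith)]
  rw [h2] at h1
  refine h1.trans ?_
  rw [← sub_mul]
  gcongr
  · exact unitVol_pos.le
  rcases hρ.eq_or_lt with h0 | h0
  · have : ‖h‖ = 0 := le_antisymm (by linarith) (norm_nonneg _)
    rw [this]; simp
  have hb := one_add_mul_le_pow (a := -(‖h‖ / ρ)) (by
    have : ‖h‖ / ρ ≤ 1 := (div_le_one h0).2 hh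
    linarith) N
  have e1 : (ρ - ‖h‖) ^ N = ρ ^ N * (1 + -(‖h‖ / ρ)) ^ N := by
    rw [← mul_pow]; congr 1; field_simp; ring
  have e2 : ρ ^ N = ρ ^ (N - 1) * ρ := by
    rw [← pow_succ, Nat.sub_add_cancel hN]
  have e3 : ρ ^ N * (1 + N * -(‖h‖ / ρ)) = ρ ^ N - N * ρ ^ (N - 1) * ‖h‖ := by
    rw [e2]; field_simp; ring
  have := mul_le_mul_of_nonneg_left hb (pow_nonneg hρ N)
  rw [e3, ← e1] at this
  linarith

/-- On balls of radius `ρ` the mean of the difference `u(· + h) - u` is small when `|h|` is much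
smaller than `ρ`. -/
theorem ofReal_le_lintegral_ball_sub (hN : 1 ≤ N) {u : Sp N → ℝ} {x h : Sp N} {ρ H γ M : ℝ}
    (hum : AEStronglyMeasurable u volume) (hγ : 0 ≤ γ) (hH : 0 ≤ H) (hρ : 0 < ρ) (hh : ‖h‖ ≤ ρ)
    (hHol : ∀ y, ‖y - x‖ < 2 * ρ → |u y - u x| ≤ H * ‖y - x‖ ^ γ)
    (hM : 4 * H * (2 * ρ) ^ γ * N * ‖h‖ ≤ M * ρ) :
    ENNReal.ofReal (M / 2 * (ρ ^ N * unitVol N)) ≤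
      ∫⁻ y in ball x ρ, ENNReal.ofReal (max (M - (u (y + h) - u y)) 0) := by
  set A := ball (x + h) ρ with hA
  set B := ball x ρ with hB
  have hAd : ∀ y ∈ A, ‖y - x‖ < 2 * ρ := by
    intro y hy
    have h1 : ‖y - (x + h)‖ < ρ := by rwa [hA, mem_ball_iff_norm] at hy
    have : y - x = (y - (x + h)) + h := by abel
    rw [this]
    exact (norm_add_le _ _).trans_lt (by linarith)
  have hBd : ∀ y ∈ B, ‖y - x‖ < 2 * ρ := by
    intro y hy
    have h1 : ‖y - x‖ < ρ := by rwa [hB, mem_ball_iff_norm] at hy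
    linarith
  set f : Sp N → ℝ := fun y => u y - u x with hf
  have hfb : ∀ y, ‖y - x‖ < 2 * ρ → |f y| ≤ H * (2 * ρ) ^ γ := fun y hy =>
    (hHol y hy).trans (by gcongr)
  have hfm : AEStronglyMeasurable f volume := hum.sub aestronglyMeasurable_const
  have iA : IntegrableOn f A := integrableOn_ball_of_bdd hfm fun y hy => hfb y (hAd y hy)
  have iB : IntegrableOn f B := integrableOn_ball_of_bdd hfm fun y hy => hfb y (hBd y hy)
  have hshift : ∫ y in B, f (y + h) = ∫ y in A, f y := by
    have hpre : (fun y => y + h) ⁻¹' A = B := by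
      ext y; simp [hA, hB]
    rw [← hpre]
    exact (measurePreserving_add_right volume h).setIntegral_preimage_emb
      (MeasurableEquiv.addRight h).measurableEmbedding f A
  have iBh : IntegrableOn (fun y => f (y + h)) B := by
    refine integrableOn_ball_of_bdd (hfm.comp_measurePreserving
      (measurePreserving_add_right volume h)) (C := H * (2 * ρ) ^ γ) fun y hy => hfb _ (hAd _ ?_)
    rw [hA, mem_ball, dist_add_right]; exact hy
  -- The intersection cancels. Each of the two remaining shells contributes at most H (2ρ)^γ · N
  -- ρ^{N-1} ‖h‖ times the unit volume, and the factor 4 in `hM` makes their sum at most half of M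
  -- |B_ρ|.
  have hdiff : (∫ y in A, f y) - (∫ y in B, f y) ≤ M / 2 * (ρ ^ N * unitVol N) := by
    have e1 := integral_inter_add_sdiff (μ := volume) (s := A) (t := B) measurableSet_ball iA
    have e2 := integral_inter_add_sdiff (μ := volume) (s := B) (t := A) measurableSet_ball iB
    rw [inter_comm] at e2
    have b1 : ‖∫ y in A \ B, f y‖ ≤ H * (2 * ρ) ^ γ * volume.real (A \ B) :=
      norm_setIntegral_le_of_norm_le_const
        ((measure_mono sdiff_subset).trans_lt measure_ball_lt_top) fun y hy => hfb y (hAd y hy.1)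
    have b2 : ‖∫ y in B \ A, f y‖ ≤ H * (2 * ρ) ^ γ * volume.real (B \ A) :=
      norm_setIntegral_le_of_norm_le_const
        ((measure_mono sdiff_subset).trans_lt measure_ball_lt_top) fun y hy => hfb y (hBd y hy.1)
    have v1 : volume.real (A \ B) ≤ N * ρ ^ (N - 1) * ‖h‖ * unitVol N :=
      volume_real_ball_diff_le hN hh
    have v2 : volume.real (B \ A) ≤ N * ρ ^ (N - 1) * ‖h‖ * unitVol N := by
      have := volume_real_ball_diff_le hN (x := x + h) (h := -h) (ρ := ρ) (by rwa [norm_neg])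
      rwa [add_neg_cancel_right, norm_neg] at this
    rw [Real.norm_eq_abs] at b1 b2
    have c1 := (le_abs_self _).trans b1
    have c2 := (neg_le_abs _).trans b2
    have hc : 0 ≤ H * (2 * ρ) ^ γ := by positivity
    have d1 := mul_le_mul_of_nonneg_left v1 hc
    have d2 := mul_le_mul_of_nonneg_left v2 hc
    have e3 : ρ ^ N = ρ ^ (N - 1) * ρ := by
      rw [← pow_succ, Nat.sub_add_cancel hN]
    have hω : 0 ≤ ρ ^ (N - 1) * unitVol N / 2 := by
      have := unitVol_pos (N := N)
      positivity
    have d3 := mul_le_mul_of_nonneg_right hM hω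
    rw [e3]
    linarith
  have iM : Integrable (fun _ : Sp N => M) (volume.restrict B) :=
    integrableOn_const measure_ball_lt_top.ne
  have iD : Integrable (fun y => f (y + h) - f y) (volume.restrict B) := iBh.sub iB
  have hint : M / 2 * (ρ ^ N * unitVol N) ≤ ∫ y in B, (M - (f (y + h) - f y)) := by
    rw [integral_sub iM iD, integral_sub iBh iB, hshift,
      setIntegral_const, volume_real_ball hN _ hρ.le, smul_eq_mul]
    linarith
  have hi : Integrable (fun y => M - (f (y + h) - f y)) (volume.restrict B) :=
    iM.sub iD
  refine (ENNReal.ofReal_le_ofReal (hint.trans (integral_mono (g := fun y =>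
    max (M - (u (y + h) - u y)) 0) hi ?_ ?_))).trans ?_
  · refine hi.pos_part.congr (ae_of_all _ fun y => ?_)
    simp [hf]
  · intro y
    simp [hf]
  · rw [ofReal_integral_eq_lintegral_ofReal]
    · refine hi.pos_part.congr (ae_of_all _ fun y => ?_)
      simp [hf]
    · exact ae_of_all _ fun y => le_max_right _ _

/-- For fixed x the main term is a constant times v(x) (M - w(y))_+ over y ∈ B_ρ(x); integrating in
y first brings in the lower bound for the mean. -/
theorem lintegral_mainTerm_ge (hN : 1 ≤ N) {p sₚ γ H r ρ M : ℝ} {u : Sp N → ℝ} {h : Sp N}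
    (hp : 1 < p) (hum : AEStronglyMeasurable u volume) (hγ : 0 ≤ γ) (hH : 0 ≤ H) (hρ : 0 < ρ)
    (hh : ‖h‖ ≤ ρ)
    (hHol : ∀ x y, ‖x‖ < r + 2 * ρ → ‖y‖ < r + 2 * ρ → |u x - u y| ≤ H * ‖x - y‖ ^ γ)
    (hM : 4 * H * (2 * ρ) ^ γ * N * ‖h‖ ≤ M * ρ) :
    ENNReal.ofReal ((p - 1) * (H * ρ ^ γ) ^ (p - 2) * (ρ ^ ((N : ℝ) + sₚ * p))⁻¹ *
        (M / 2 * (ρ ^ N * unitVol N))) *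
      ∫⁻ x in ball (0 : Sp N) r, ENNReal.ofReal (excess u h M x) ≤
      ∫⁻ z : Sp N × Sp N, ENNReal.ofReal (mainTerm p sₚ γ H r ρ M u h z.1 z.2) := by
  set c := (p - 1) * (H * ρ ^ γ) ^ (p - 2) * (ρ ^ ((N : ℝ) + sₚ * p))⁻¹ with hc
  have hp1 : 0 ≤ p - 1 := by linarith
  have hc0 : 0 ≤ c := by positivity
  set b : Sp N → ℝ := fun y => max (M - (u (y + h) - u y)) 0 with hb
  have hvm := (aestronglyMeasurable_excess hum h M).aemeasurable
  have hbm : AEMeasurable b :=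
    ((aestronglyMeasurable_const.sub ((hum.comp_measurePreserving
      (measurePreserving_add_right volume h)).sub hum)).sup aestronglyMeasurable_const).aemeasurable
  set S : Set (Sp N × Sp N) := {z | ‖z.1‖ < r ∧ ‖z.1 - z.2‖ < ρ} with hS
  have hzS : ∀ z, z ∈ S ↔ ‖z.1‖ < r ∧ ‖z.1 - z.2‖ < ρ := fun z => Iff.rfl
  have hSm : MeasurableSet S := by
    have m1 : MeasurableSet {z : Sp N × Sp N | ‖z.1‖ < r} :=
      measurableSet_lt (by fun_prop) (by fun_prop)
    have m2 : MeasurableSet {z : Sp N × Sp N | ‖z.1 - z.2‖ < ρ} :=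
      measurableSet_lt (by fun_prop) (by fun_prop)
    exact m1.inter m2
  have hmain : (fun z : Sp N × Sp N => ENNReal.ofReal (mainTerm p sₚ γ H r ρ M u h z.1 z.2)) =
      S.indicator fun z => ENNReal.ofReal (c * (excess u h M z.1 * b z.2)) := by
    ext z
    unfold mainTerm
    by_cases hz : z ∈ S
    · rw [indicator_of_mem hz, if_pos ((hzS z).1 hz)]
    · rw [indicator_of_notMem hz, if_neg (fun h => hz ((hzS z).2 h)), ENNReal.ofReal_zero]
  have hm : AEMeasurable (fun z : Sp N × Sp N =>
      ENNReal.ofReal (mainTerm p sₚ γ H r ρ M u h z.1 z.2))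
      ((volume : Measure (Sp N)).prod volume) := by
    rw [hmain]
    have h1 : AEMeasurable (fun z : Sp N × Sp N => excess u h M z.1)
      ((volume : Measure (Sp N)).prod volume) :=
      hvm.comp_quasiMeasurePreserving Measure.quasiMeasurePreserving_fst
    have h2 : AEMeasurable (fun z : Sp N × Sp N => b z.2)
      ((volume : Measure (Sp N)).prod volume) :=
      hbm.comp_quasiMeasurePreserving Measure.quasiMeasurePreserving_snd
    exact (((h1.mul h2).const_mul c).ennreal_ofReal).indicator hSm
  rw [Measure.volume_eq_prod, lintegral_prod _ hm,
    ← lintegral_const_mul' _ _ ENNReal.ofReal_ne_top]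
  refine le_trans (setLIntegral_mono' measurableSet_ball fun x hx => ?_)
    (setLIntegral_le_lintegral (ball (0 : Sp N) r) _)
  rw [mem_ball_zero_iff] at hx
  have hv := excess_nonneg u h M x
  have hlow := ofReal_le_lintegral_ball_sub hN hum hγ hH hρ hh (x := x) (M := M)
    (fun y hy => hHol y x (by
      have := norm_add_le (y - x) x
      rw [sub_add_cancel] at this
      linarith) (by linarith)) hM
  calc _ = ENNReal.ofReal (c * excess u h M x) * ENNReal.ofReal (M / 2 * (ρ ^ N * unitVol N)) := by
        rw [ENNReal.ofReal_mul hc0, ENNReal.ofReal_mul hc0]; ring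
    _ ≤ ENNReal.ofReal (c * excess u h M x) * ∫⁻ y in ball x ρ, ENNReal.ofReal (b y) := by gcongr
    _ = ∫⁻ y in ball x ρ, ENNReal.ofReal (c * excess u h M x) * ENNReal.ofReal (b y) := by
        rw [lintegral_const_mul' _ _ ENNReal.ofReal_ne_top]
    _ = ∫⁻ y in ball x ρ, ENNReal.ofReal (mainTerm p sₚ γ H r ρ M u h x y) := by
        refine setLIntegral_congr_fun measurableSet_ball fun y hy => ?_
        rw [mem_ball, dist_comm, dist_eq_norm] at hy
        rw [mainTerm, if_pos ⟨hx, hy⟩, ← ENNReal.ofReal_mul (by positivity), mul_assoc]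
    _ ≤ _ := setLIntegral_le_lintegral _ _

/-- On B_{r+2ε} the excess is at most 2, since M ≥ 0 and |u| ≤ 1 at both x and x + h. Its energies
there are finite by translation, and the cutoff extends it by zero with finite energy. -/
theorem isTest_cutoff_mul_excess (hN : 1 ≤ N) {p s₁ sₚ Λ lam r ε M : ℝ} {u : Sp N → ℝ} {h : Sp N}
    (hp : 1 < p) (h1 : 0 < s₁) (h11 : s₁ < 1)
    (hs : 0 < sₚ * p) (hs1 : sₚ * p < 1) (hu : NormalizedSolution p s₁ sₚ Λ lam u) (hε : 0 < ε)
    (hr : 0 ≤ r) (hrε : r + 4 * ε ≤ 1) (hh : ‖h‖ ≤ ε) (hM : 0 ≤ M) :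
    IsTest p s₁ sₚ (r + ε) (fun x => cutoff r ε x * excess u h M x) := by
  have hb : ∀ x ∈ ball (0 : Sp N) (r + 2 * ε), |excess u h M x| ≤ 2 := by
    intro x hx
    rw [mem_ball_zero_iff] at hx
    have h1 := abs_le.1 (hu.bdd x (by linarith))
    have h2 := abs_le.1 (hu.bdd (x + h) (by linarith [norm_add_le x h]))
    rw [abs_of_nonneg (excess_nonneg _ _ _ _)]
    exact max_le (by linarith) (by norm_num)
  have hL : 1 ≤ ε⁻¹ := (one_le_inv₀ hε).2 (by linarith)
  have hen : ∀ s q, 1 ≤ q → 0 < s * q → s * q < 1 → energy u s q (ball 0 (r + 2 * ε + ‖h‖)) < ⊤ →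
      energy (fun x => cutoff r ε x * excess u h M x) s q univ < ⊤ := fun s q hq hsq hsq1 hue =>
    energy_cutoff_lt_top hN hq hsq hsq1 hb (energy_excess_lt_top (by linarith) hu.aesm hue) hL
      (abs_cutoff_le_one r ε) (abs_cutoff_sub_le hε) (fun x hx => cutoff_eq_zero hε hx)
      (by linarith) (by linarith)
  refine ⟨(continuous_cutoff r ε).aestronglyMeasurable.mul
    (aestronglyMeasurable_excess hu.aesm h M), fun x hx => ?_, ⟨2, fun x => ?_⟩, ?_, ?_⟩
  · rw [cutoff_eq_zero hε hx, zero_mul]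
  · by_cases hx : r + ε ≤ ‖x‖
    · rw [cutoff_eq_zero hε hx, zero_mul, abs_zero]; norm_num
    · rw [abs_mul]
      calc _ ≤ 1 * (2 : ℝ) := by
            gcongr
            · exact abs_cutoff_le_one _ _ _
            · exact hb x (by rw [mem_ball_zero_iff]; linarith [not_le.1 hx])
        _ = 2 := one_mul 2
  · exact hen s₁ 1 le_rfl (by simpa using h1) (by simpa using h11)
      (hu.energy_one _ (by linarith))
  · exact hen sₚ p hp.le hs hs1 (hu.energy_p _ (by linarith))

/-- The Caccioppoli inequality for the excess of differences. -/
theorem caccioppoli (hN : 1 ≤ N) {p s₁ sₚ : ℝ} (hp : 1 < p) (hp2 : p < 2) (h1 : 0 < s₁)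
    (h11 : s₁ < 1) (hs : 0 < sₚ * p) (hs1 : sₚ * p < 1) (Λ ε : ℝ) (hε : 0 < ε) :
    ∃ C : ℝ, 0 < C ∧ ∀ (γ H r ρ M lam : ℝ) (u : Sp N → ℝ) (h : Sp N),
      NormalizedSolution p s₁ sₚ Λ lam u → 0 ≤ γ → 0 ≤ H → 0 ≤ r → r + 4 * ε ≤ 1 → 0 < ρ →
      ρ ≤ ε → ‖h‖ ≤ ρ → 0 ≤ M →
      (∀ x y, ‖x‖ < r + 4 * ε → ‖y‖ < r + 4 * ε → |u x - u y| ≤ H * ‖x - y‖ ^ γ) →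
      4 * H * (2 * ρ) ^ γ * N * ‖h‖ ≤ M * ρ →
      ENNReal.ofReal ((p - 1) * (H * ρ ^ γ) ^ (p - 2) * (ρ ^ ((N : ℝ) + sₚ * p))⁻¹ *
          (M / 2 * (ρ ^ N * unitVol N))) *
        ∫⁻ x in ball (0 : Sp N) r, ENNReal.ofReal (excess u h M x) ≤
      ENNReal.ofReal C * ∫⁻ x in ball (0 : Sp N) (r + 4 * ε), ENNReal.ofReal (excess u h M x) := by
  set K : ℝ≥0∞ := ENNReal.ofReal (4 * ε⁻¹ + (ε ^ ((N : ℝ) + sₚ * p))⁻¹) *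
        ((kernelMass N (sₚ * p) + ENNReal.ofReal Λ) + (kernelMass N (sₚ * p) + ENNReal.ofReal Λ) +
          kernelMass N s₁) with hK
  have k1 := kernelMass_lt_top hN hs hs1
  have k2 := kernelMass_lt_top hN h1 h11
  have hKtop : K < ⊤ := ENNReal.mul_lt_top ENNReal.ofReal_lt_top
    (by simp only [ENNReal.add_lt_top]; simp [k1, k2])
  -- The constant is the mass of the error kernel, plus 1 for positivity. It does not depend on H,
  -- ρ, M, h, lam or u, which is what allows ρ and M to be tied to h later.
  refine ⟨(2 * K).toReal + 1, by positivity, ?_⟩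
  intro γ H r ρ M lam u h hu hγ hH hr hrε hρ hρε hh hM hHol hMρ
  obtain ⟨Z, hZ, heq⟩ := hu.exists_diff_eqn hN hp hp2 hs hs1
  have hhε : ‖h‖ ≤ ε := hh.trans hρε
  have htest := isTest_cutoff_mul_excess hN (M := M) hp h1 h11 hs hs1 hu hε hr hrε hhε hM
  obtain ⟨hI, hI0⟩ := heq h (r + ε) (by linarith) _ htest
  have hZh : ∀ᵐ z : Sp N × Sp N, Z (z.1 + h, z.2 + h) ∈ sgnSet (u (z.1 + h) - u (z.2 + h)) :=
    (measurePreserving_shift h).quasiMeasurePreserving.ae hZ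
  set g : Sp N → ℝ := (ball 0 (r + 2 * ε)).indicator (excess u h M) with hg
  have hg0 : ∀ x, 0 ≤ g x := indicator_nonneg fun x _ => excess_nonneg u h M x
  have hgm : AEMeasurable g :=
    (aestronglyMeasurable_excess hu.aesm h M).aemeasurable.indicator measurableSet_ball
  set E : Sp N × Sp N → ℝ := fun z => g z.1 * errorKernel p s₁ sₚ ε u h z.1 z.2 +
    g z.2 * errorKernel p s₁ sₚ ε u h z.2 z.1 with hE
  have hq0 := errorKernel_nonneg (p := p) (s₁ := s₁) (sₚ := sₚ) hε u h
  have hqm := aemeasurable_errorKernel (p := p) (s₁ := s₁) (sₚ := sₚ) (ε := ε) hu.aesm h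
  have hE0 : ∀ z, 0 ≤ E z := fun z =>
    add_nonneg (mul_nonneg (hg0 _) (hq0 _ _)) (mul_nonneg (hg0 _) (hq0 _ _))
  have hgle : ∫⁻ x, ENNReal.ofReal (g x) ≤
      ∫⁻ x in ball (0 : Sp N) (r + 4 * ε), ENNReal.ofReal (excess u h M x) := by
    have : ∀ x, ENNReal.ofReal (g x) =
        (ball 0 (r + 2 * ε)).indicator (fun x => ENNReal.ofReal (excess u h M x)) x := by
      intro x
      by_cases hx : x ∈ ball (0 : Sp N) (r + 2 * ε)
      · rw [hg, indicator_of_mem hx, indicator_of_mem hx]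
      · rw [hg, indicator_of_notMem hx, indicator_of_notMem hx, ENNReal.ofReal_zero]
    simp only [this]
    rw [lintegral_indicator measurableSet_ball]
    exact lintegral_mono_set (ball_subset_ball (by linarith))
  have hgfin : ∫⁻ x, ENNReal.ofReal (g x) < ⊤ := by
    have hb : ∀ x, ENNReal.ofReal (g x) ≤
        (ball (0 : Sp N) (r + 2 * ε)).indicator (fun _ => ENNReal.ofReal 2) x := by
      intro x
      by_cases hx : x ∈ ball (0 : Sp N) (r + 2 * ε)
      · rw [hg, indicator_of_mem hx, indicator_of_mem hx]
        rw [mem_ball_zero_iff] at hx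
        have h1 := abs_le.1 (hu.bdd x (by linarith))
        have h2 := abs_le.1 (hu.bdd (x + h) (by linarith [norm_add_le x h]))
        exact ENNReal.ofReal_le_ofReal (max_le (by linarith) (by norm_num))
      · rw [hg, indicator_of_notMem hx, indicator_of_notMem hx, ENNReal.ofReal_zero]
    refine (lintegral_mono hb).trans_lt ?_
    rw [lintegral_indicator_const measurableSet_ball]
    exact ENNReal.mul_lt_top ENNReal.ofReal_lt_top measure_ball_lt_top
  obtain ⟨hEint, hEle⟩ := integrable_symm_weight hg0 hgm hq0 hqm
    (fun x => lintegral_errorKernel_le hε hu.aesm hu.tail_le h x) hKtop hgfin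
  have hmain : ∀ᵐ z : Sp N × Sp N, mainTerm p sₚ γ H r ρ M u h z.1 z.2 ≤
      diffKernel p s₁ sₚ lam u Z h z *
        (cutoff r ε z.1 * excess u h M z.1 - cutoff r ε z.2 * excess u h M z.2) + E z := by
    filter_upwards [hZ, hZh] with z hz hzh
    exact mainTerm_le_add_error hp hp2 hs.le hu.lam_nonneg hu.lam_le hu.bdd hε hr hrε hρε hhε hγ hH
      hHol hz hzh
  have hfin := lintegral_le_of_integral_eq_zero hI hI0 hEint hE0
    (fun z => mainTerm_nonneg hp hH hρ.le u h z.1 z.2) hmain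
  refine (lintegral_mainTerm_ge hN hp hu.aesm hγ hH hρ hh
    (fun x y hx hy => hHol x y (by linarith) (by linarith)) hMρ).trans (hfin.trans (hEle.trans ?_))
  have h2K : 2 * K ≤ ENNReal.ofReal ((2 * K).toReal + 1) := by
    rw [ENNReal.ofReal_add ENNReal.toReal_nonneg zero_le_one,
      ENNReal.ofReal_toReal (ENNReal.mul_lt_top (by simp) hKtop).ne]
    exact le_self_add
  gcongr

/-! ### Decay of the excess -/

/-- A Hölder estimate of exponent `γ` inside the unit ball, uniform over normalised solutions. -/
def UnitHolder (N : ℕ) (p s₁ sₚ Λ γ : ℝ) : Prop :=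
  ∀ r < 1, ∃ H : ℝ, 0 ≤ H ∧ ∀ (lam : ℝ) (u : Sp N → ℝ), NormalizedSolution p s₁ sₚ Λ lam u →
    ∀ x y, ‖x‖ < r → ‖y‖ < r → |u x - u y| ≤ H * ‖x - y‖ ^ γ

theorem ennreal_le_of_mul_le {c d : ℝ} {X : ℝ≥0∞} (hc : 0 < c)
    (h : ENNReal.ofReal c * X ≤ ENNReal.ofReal d) : X ≤ ENNReal.ofReal (d / c) := by
  rw [ENNReal.ofReal_div_of_pos hc, ENNReal.le_div_iff_mul_le
    (Or.inl (by simpa using hc)) (Or.inl ENNReal.ofReal_ne_top), mul_comm]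
  exact h

/-- Bookkeeping of powers: with ρ = A t^θ and M = t^{γ'}, the dimension cancels and ρ^{-σ} t^{γ'} is
a constant times t^{-δ}. -/
theorem coefficient_eq {p s γ γ' θ A H t : ℝ} {σ δ : ℝ} (hA : 0 < A) (hH : 0 < H) (ht : 0 < t)
    (hσ : σ = s + (2 - p) * γ) (hδ : δ = σ * θ - γ') :
    (p - 1) * (H * (A * t ^ θ) ^ γ) ^ (p - 2) * ((A * t ^ θ) ^ ((N : ℝ) + s))⁻¹ *
      (t ^ γ' / 2 * ((A * t ^ θ) ^ N * unitVol N)) =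
    (p - 1) * H ^ (p - 2) * unitVol N / 2 * A ^ (-σ) * t ^ (-δ) := by
  set ρ := A * t ^ θ with hρ
  have hρ0 : 0 < ρ := by positivity
  have h1 : (H * ρ ^ γ) ^ (p - 2) = H ^ (p - 2) * ρ ^ (γ * (p - 2)) := by
    rw [Real.mul_rpow hH.le (by positivity), ← Real.rpow_mul hρ0.le]
  have h2 : ρ ^ (γ * (p - 2)) * (ρ ^ ((N : ℝ) + s))⁻¹ * ρ ^ N = ρ ^ (-σ) := by
    rw [← Real.rpow_natCast, ← Real.rpow_neg hρ0.le, ← Real.rpow_add hρ0, ← Real.rpow_add hρ0]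
    congr 1
    rw [hσ]; ring
  have h3 : ρ ^ (-σ) = A ^ (-σ) * t ^ (θ * -σ) := by
    rw [hρ, Real.mul_rpow hA.le (by positivity), ← Real.rpow_mul ht.le]
  have h4 : t ^ (θ * -σ) * t ^ γ' = t ^ (-δ) := by
    rw [← Real.rpow_add ht]
    congr 1
    rw [hδ]; ring
  calc _ = (p - 1) * H ^ (p - 2) * unitVol N / 2 *
        (ρ ^ (γ * (p - 2)) * (ρ ^ ((N : ℝ) + s))⁻¹ * ρ ^ N) * t ^ γ' := by rw [h1]; ring
    _ = (p - 1) * H ^ (p - 2) * unitVol N / 2 * A ^ (-σ) * (t ^ (θ * -σ) * t ^ γ') := by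
        rw [h2, h3]; ring
    _ = _ := by rw [h4]

/-- Each application of `caccioppoli` on a slightly larger ball gains a factor ‖h‖^δ. The constants
may depend on n and r, as only one fixed n is used in the end. -/
theorem excess_decay (hN : 1 ≤ N) {p s₁ sₚ Λ γ γ' : ℝ} (hp : 1 < p) (hp2 : p < 2) (h1 : 0 < s₁)
    (h11 : s₁ < 1) (hs : 0 < sₚ * p) (hs1 : sₚ * p < 1) (hγ : 0 ≤ γ) (hγγ' : γ < γ') (hγ' : γ' < 1)
    {δ : ℝ} (hδ : δ = (sₚ * p + (2 - p) * γ) * ((1 - γ') / (1 - γ)) - γ')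
    (hol : UnitHolder N p s₁ sₚ Λ γ) (n : ℕ) : ∀ r : ℝ, 0 ≤ r → r < 1 → ∃ C h₀ : ℝ, 0 < C ∧
      0 < h₀ ∧ h₀ ≤ 1 ∧ ∀ (lam : ℝ) (u : Sp N → ℝ), NormalizedSolution p s₁ sₚ Λ lam u →
      ∀ h : Sp N, 0 < ‖h‖ → ‖h‖ ≤ h₀ →
        ∫⁻ x in ball (0 : Sp N) r, ENNReal.ofReal (excess u h (‖h‖ ^ γ') x) ≤
          ENNReal.ofReal (C * ‖h‖ ^ (n * δ)) := by
  induction n with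
  | zero =>
    intro r hr hr1
    -- The bound 1 - r on ‖h‖ keeps x + h in the unit ball, where |u| ≤ 1 bounds the excess by 2.
    refine ⟨2 * unitVol N, 1 - r, by have := unitVol_pos (N := N); positivity, by linarith,
      by linarith, ?_⟩
    intro lam u hu h hh hh0
    have hb : ∀ x ∈ ball (0 : Sp N) r, ENNReal.ofReal (excess u h (‖h‖ ^ γ') x) ≤
        ENNReal.ofReal 2 := by
      intro x hx
      rw [mem_ball_zero_iff] at hx
      have h1 := abs_le.1 (hu.bdd x (by linarith))
      have h2 := abs_le.1 (hu.bdd (x + h) (by linarith [norm_add_le x h]))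
      have : 0 ≤ ‖h‖ ^ γ' := by positivity
      exact ENNReal.ofReal_le_ofReal (max_le (by linarith) (by norm_num))
    refine (setLIntegral_mono' measurableSet_ball hb).trans ?_
    rw [setLIntegral_const, CharP.cast_eq_zero, zero_mul, Real.rpow_zero, mul_one,
      ENNReal.ofReal_mul (by norm_num)]
    gcongr
    rw [unitVol, measureReal_def, ENNReal.ofReal_toReal measure_ball_lt_top.ne]
    exact measure_mono (ball_subset_ball hr1.le)
  | succ n ih =>
    intro r hr hr1
    set ε := (1 - r) / 8 with hε
    have hε0 : 0 < ε := by rw [hε]; linarith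
    have hrε : r + 4 * ε < 1 := by rw [hε]; linarith
    obtain ⟨H', hH', hHol'⟩ := hol (r + 4 * ε) hrε
    obtain ⟨Cn, hn, hCn, hhn, hhn1, hdec⟩ := ih (r + 4 * ε) (by linarith) hrε
    obtain ⟨Cc, hCc, hcac⟩ := caccioppoli hN hp hp2 h1 h11 hs hs1 Λ ε hε0
    set H := max H' 1 with hH
    have hH1 : 1 ≤ H := le_max_right _ _
    have hH0 : 0 < H := by linarith
    set σ := sₚ * p + (2 - p) * γ with hσ
    set θ := (1 - γ') / (1 - γ) with hθ
    have h1γ : 0 < 1 - γ := by linarith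
    have hθ0 : 0 < θ := div_pos (by linarith) h1γ
    have hθ1 : θ ≤ 1 := (div_le_one h1γ).2 (by linarith)
    have hNR : (1 : ℝ) ≤ N := by exact_mod_cast hN
    -- With A^{1-γ} = B, the radius ρ = A t^θ satisfies ρ^{1-γ} = B t^{1-γ'}. Since (2ρ)^γ ≤ 2 ρ^γ,
    -- the value 8HN is what the smallness condition on the mean asks for.
    set B := 8 * H * N with hB
    have hB1 : 1 ≤ B := by rw [hB]; nlinarith
    have hB0 : 0 < B := by linarith
    set A := B ^ (1 / (1 - γ)) with hA
    have hA1 : 1 ≤ A := Real.one_le_rpow hB1 (by positivity)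
    have hA0 : 0 < A := by linarith
    have hAB : A ^ (1 - γ) = B := by
      rw [hA, ← Real.rpow_mul hB0.le, one_div_mul_cancel h1γ.ne', Real.rpow_one]
    set c := (p - 1) * H ^ (p - 2) * unitVol N / 2 * A ^ (-σ) with hc
    have hc0 : 0 < c := by
      have := unitVol_pos (N := N)
      have : 0 < p - 1 := by linarith
      positivity
    -- The second entry guarantees A t^θ ≤ ε.
    set h₀ := min hn ((ε / A) ^ (1 / θ)) with hh₀
    have hh₀0 : 0 < h₀ := lt_min hhn (by positivity)
    refine ⟨Cc * Cn / c, h₀, by positivity, hh₀0, (min_le_left _ _).trans hhn1, ?_⟩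
    intro lam u hu h hh hhle
    set t := ‖h‖ with ht
    have htn : t ≤ hn := hhle.trans (min_le_left _ _)
    have ht1 : t ≤ 1 := htn.trans hhn1
    set ρ := A * t ^ θ with hρ
    have hρ0 : 0 < ρ := by positivity
    have hρε : ρ ≤ ε := by
      have : t ^ θ ≤ ε / A := by
        calc t ^ θ ≤ ((ε / A) ^ (1 / θ)) ^ θ :=
              Real.rpow_le_rpow hh.le (hhle.trans (min_le_right _ _)) hθ0.le
          _ = ε / A := by
              rw [← Real.rpow_mul (by positivity), one_div_mul_cancel hθ0.ne', Real.rpow_one]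
      rw [le_div_iff₀ hA0] at this
      rw [hρ]; linarith
    have htρ : t ≤ ρ := by
      have h2 : t ≤ t ^ θ := by
        simpa using Real.rpow_le_rpow_of_exponent_ge hh ht1 hθ1
      have : 0 ≤ t ^ θ := by positivity
      rw [hρ]; nlinarith
    have hmean : 4 * H * (2 * ρ) ^ γ * N * t ≤ t ^ γ' * ρ := by
      have e1 : (2 * ρ) ^ γ ≤ 2 * ρ ^ γ := by
        rw [Real.mul_rpow (by norm_num) hρ0.le]
        gcongr
        simpa using Real.rpow_le_rpow_of_exponent_le (one_le_two) (by linarith : γ ≤ 1)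
      have e2 : ρ ^ γ * (A ^ (1 - γ) * t ^ (1 - γ')) = ρ := by
        have : A ^ (1 - γ) * t ^ (1 - γ') = ρ ^ (1 - γ) := by
          rw [hρ, Real.mul_rpow hA0.le (by positivity), ← Real.rpow_mul hh.le, hθ,
            div_mul_cancel₀ _ h1γ.ne']
        rw [this, ← Real.rpow_add hρ0]
        simp
      have e3 : t ^ γ' * t ^ (1 - γ') = t := by
        rw [← Real.rpow_add hh]; simp
      calc 4 * H * (2 * ρ) ^ γ * N * t ≤ 4 * H * (2 * ρ ^ γ) * N * t := by gcongr
        _ = ρ ^ γ * B * t := by rw [hB]; ring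
        _ = ρ ^ γ * B * (t ^ γ' * t ^ (1 - γ')) := by rw [e3]
        _ = t ^ γ' * (ρ ^ γ * (A ^ (1 - γ) * t ^ (1 - γ'))) := by rw [hAB]; ring
        _ = t ^ γ' * ρ := by rw [e2]
    have hmain := hcac γ H r ρ (t ^ γ') lam u h hu hγ hH0.le hr hrε.le hρ0 hρε htρ (by positivity)
      (fun x y hx hy => (hHol' lam u hu x y hx hy).trans (by gcongr; exact le_max_left _ _)) hmean
    rw [hρ, coefficient_eq hA0 hH0 hh hσ (hδ.trans (by rfl)), ← hc] at hmain
    have hfin := hmain.trans (mul_le_mul' le_rfl (hdec lam u hu h hh htn))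
    rw [← ENNReal.ofReal_mul hCc.le] at hfin
    refine (ennreal_le_of_mul_le (by positivity) hfin).trans (le_of_eq ?_)
    congr 1
    rw [← ht, Real.rpow_neg hh.le, Nat.cast_succ, add_mul, one_mul, Real.rpow_add hh]
    field_simp

/-! ### From decay of the excess to Hölder continuity -/

/-- The shear (z, y) ↦ (z, y - z) preserves measure and turns the double integral into an integral
over h in the ball of radius D of the L¹ norms of the excess. The slice h = 0 vanishes because 0^γ =
0. -/
theorem lintegral_pair_excess_le {u : Sp N → ℝ} (hum : AEStronglyMeasurable u volume)
    {S T : Set (Sp N)} (hS : MeasurableSet S) (hT : MeasurableSet T) {r D γ : ℝ} {c : ℝ≥0∞}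
    (hγ : 0 < γ) (hSr : S ⊆ ball 0 r) (hST : ∀ z ∈ S, ∀ y ∈ T, ‖y - z‖ ≤ D)
    (hc : ∀ h : Sp N, 0 < ‖h‖ → ‖h‖ ≤ D →
      ∫⁻ x in ball (0 : Sp N) r, ENNReal.ofReal (excess u h (‖h‖ ^ γ) x) ≤ c) :
    ∫⁻ q in S ×ˢ T, ENNReal.ofReal (max (u q.2 - u q.1 - ‖q.2 - q.1‖ ^ γ) 0) ≤
      c * volume (closedBall (0 : Sp N) D) := by
  set G : Sp N × Sp N → ℝ≥0∞ :=
    fun q => ENNReal.ofReal (max (u q.2 - u q.1 - ‖q.2 - q.1‖ ^ γ) 0) with hG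
  have hGm : AEMeasurable G := by
    have h1 : AEMeasurable (fun q : Sp N × Sp N => u q.2 - u q.1)
        ((volume : Measure (Sp N)).prod volume) :=
      (hum.comp_snd.sub hum.comp_fst).aemeasurable
    have h2 : Measurable (fun q : Sp N × Sp N => ‖q.2 - q.1‖ ^ γ) := by fun_prop
    exact ((h1.sub h2.aemeasurable).max aemeasurable_const).ennreal_ofReal
  have hmp : MeasurePreserving (fun z : Sp N × Sp N => (z.1, z.1 + z.2)) volume volume :=
    measurePreserving_prod_add volume volume
  have hme : MeasurableEmbedding (fun z : Sp N × Sp N => (z.1, z.1 + z.2)) :=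
    (MeasurableEquiv.shearAddRight (Sp N)).measurableEmbedding
  set R := ball (0 : Sp N) r ×ˢ closedBall (0 : Sp N) D with hR
  have hRm : MeasurableSet R := measurableSet_ball.prod measurableSet_closedBall
  have hGc : AEMeasurable (fun z : Sp N × Sp N => G (z.1, z.1 + z.2)) :=
    hGm.comp_quasiMeasurePreserving hmp.quasiMeasurePreserving
  rw [← lintegral_indicator (hS.prod hT), ← hmp.lintegral_comp_emb hme]
  have hle : ∀ z : Sp N × Sp N, (S ×ˢ T).indicator G (z.1, z.1 + z.2) ≤
      R.indicator (fun z => G (z.1, z.1 + z.2)) z := by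
    intro z
    by_cases hz : (z.1, z.1 + z.2) ∈ S ×ˢ T
    · rw [indicator_of_mem hz, indicator_of_mem]
      refine ⟨hSr hz.1, ?_⟩
      have := hST _ hz.1 _ hz.2
      rwa [add_sub_cancel_left, ← mem_closedBall_zero_iff] at this
    · rw [indicator_of_notMem hz]; exact bot_le
  refine (lintegral_mono hle).trans ?_
  rw [Measure.volume_eq_prod, lintegral_prod_symm _ (hGc.indicator hRm)]
  have hin : ∀ h : Sp N, ∫⁻ x, R.indicator (fun z : Sp N × Sp N => G (z.1, z.1 + z.2)) (x, h) ≤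
      (closedBall (0 : Sp N) D).indicator (fun _ => c) h := by
    intro h
    by_cases hh : h ∈ closedBall (0 : Sp N) D
    · rw [indicator_of_mem hh]
      have heq : ∀ x, R.indicator (fun z : Sp N × Sp N => G (z.1, z.1 + z.2)) (x, h) =
          (ball (0 : Sp N) r).indicator
            (fun x => ENNReal.ofReal (excess u h (‖h‖ ^ γ) x)) x := by
        intro x
        by_cases hx : x ∈ ball (0 : Sp N) r
        · rw [indicator_of_mem hx, indicator_of_mem (mk_mem_prod hx hh)]
          simp [hG, excess]
        · rw [indicator_of_notMem hx, indicator_of_notMem (fun hc => hx hc.1)]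
      simp only [heq]
      rw [lintegral_indicator measurableSet_ball]
      rcases (norm_nonneg h).eq_or_lt with h0 | h0
      · have h00 : h = 0 := norm_eq_zero.1 h0.symm
        subst h00
        simp [excess, Real.zero_rpow hγ.ne']
      · exact hc h h0 (by simpa using hh)
    · rw [indicator_of_notMem hh]
      have heq : ∀ x, R.indicator (fun z : Sp N × Sp N => G (z.1, z.1 + z.2)) (x, h) = 0 :=
        fun x => indicator_of_notMem (fun hc => hh hc.2) _
      simp [heq]
  refine (lintegral_mono hin).trans ?_
  rw [lintegral_indicator_const measurableSet_closedBall]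

theorem volume_real_closedBall (x : Sp N) {r : ℝ} (hr : 0 ≤ r) :
    volume.real (closedBall x r) = r ^ N * unitVol N := by
  rw [Measure.addHaar_real_closedBall _ _ hr, finrank_euclideanSpace, Fintype.card_fin, unitVol]

/-- The difference of two averages is controlled by the excess. -/
theorem average_sub_average_le {u : Sp N → ℝ} (hum : AEStronglyMeasurable u volume)
    (hu : ∀ x, ‖x‖ < 1 → |u x| ≤ 1) {r D γ a b C : ℝ} {x x' : Sp N} (hγ : 0 < γ) (hγ1 : γ ≤ 1)
    (hr1 : r ≤ 1) (hD : 0 < D) (hD1 : D ≤ 1) (hx : ‖x‖ + D < r) (hx' : ‖x'‖ + D < r)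
    (ha : D / 8 ≤ a) (hb : D / 8 ≤ b) (hxx' : ‖x - x'‖ + a + b ≤ D) (hC : 0 ≤ C)
    (hdec : ∀ h : Sp N, 0 < ‖h‖ → ‖h‖ ≤ D →
      ∫⁻ x in ball (0 : Sp N) r, ENNReal.ofReal (excess u h (‖h‖ ^ γ) x) ≤
        ENNReal.ofReal (C * D ^ (N + 1))) :
    (⨍ y in closedBall x a, u y) - ⨍ y in closedBall x' b, u y ≤
      (1 + C * 64 ^ N * (unitVol N)⁻¹) * D ^ γ := by
  have hω := unitVol_pos (N := N)
  have ha0 : 0 < a := by linarith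
  have hb0 : 0 < b := by linarith
  have hxx0 := norm_nonneg (x - x')
  set A := closedBall x a with hA
  set B := closedBall x' b with hB
  -- Up to the factor |A| |B|, the difference of averages is the integral of u(y) - u(z) over (z, y)
  -- ∈ B × A, where ‖y - z‖ ≤ D.
  set μ : Measure (Sp N × Sp N) := (volume.restrict B).prod (volume.restrict A) with hμ
  have hVA : volume.real A = a ^ N * unitVol N := volume_real_closedBall x ha0.le
  have hVB : volume.real B = b ^ N * unitVol N := volume_real_closedBall x' hb0.le
  have hVA0 : 0 < volume.real A := by rw [hVA]; positivity
  have hVB0 : 0 < volume.real B := by rw [hVB]; positivity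
  have hAn : ∀ y ∈ A, ‖y‖ < r := by
    intro y hy
    rw [hA, mem_closedBall_iff_norm] at hy
    have := norm_add_le (y - x) x
    rw [sub_add_cancel] at this
    linarith
  have hBn : ∀ y ∈ B, ‖y‖ < r := by
    intro y hy
    rw [hB, mem_closedBall_iff_norm] at hy
    have := norm_add_le (y - x') x'
    rw [sub_add_cancel] at this
    linarith
  have hfA : volume A < ⊤ := measure_closedBall_lt_top
  have hfB : volume B < ⊤ := measure_closedBall_lt_top
  have : IsFiniteMeasure (volume.restrict A) := ⟨by simpa using hfA⟩
  have : IsFiniteMeasure (volume.restrict B) := ⟨by simpa using hfB⟩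
  have iA : IntegrableOn u A := Measure.integrableOn_of_bounded (M := 1) hfA.ne hum
    ((ae_restrict_mem measurableSet_closedBall).mono fun y hy => hu y ((hAn y hy).trans_le hr1))
  have iB : IntegrableOn u B := Measure.integrableOn_of_bounded (M := 1) hfB.ne hum
    ((ae_restrict_mem measurableSet_closedBall).mono fun y hy => hu y ((hBn y hy).trans_le hr1))
  have i1 : Integrable (fun q : Sp N × Sp N => u q.2) μ := iA.comp_snd _
  have i2 : Integrable (fun q : Sp N × Sp N => u q.1) μ := iB.comp_fst _
  set G : Sp N × Sp N → ℝ := fun q => max (u q.2 - u q.1 - ‖q.2 - q.1‖ ^ γ) 0 with hG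
  have hdist : ∀ z ∈ B, ∀ y ∈ A, ‖y - z‖ ≤ D := by
    intro z hz y hy
    rw [hA, mem_closedBall_iff_norm] at hy
    rw [hB, mem_closedBall_iff_norm, norm_sub_rev] at hz
    have : y - z = (y - x) + (x - x') + (x' - z) := by abel
    rw [this]
    refine (norm_add₃_le).trans ?_
    linarith
  have hμr : μ = (volume : Measure (Sp N × Sp N)).restrict (B ×ˢ A) := by
    rw [hμ, Measure.prod_restrict, Measure.volume_eq_prod]
  have hGm : AEStronglyMeasurable G μ := by
    have h2 : Measurable (fun q : Sp N × Sp N => ‖q.2 - q.1‖ ^ γ) := by fun_prop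
    exact (((i1.sub i2).aestronglyMeasurable.aemeasurable.sub h2.aemeasurable).max
      aemeasurable_const).aestronglyMeasurable
  have hGl : ∫⁻ q, ENNReal.ofReal (G q) ∂μ ≤
      ENNReal.ofReal (C * D ^ (N + 1) * (D ^ N * unitVol N)) := by
    rw [hμr]
    refine (lintegral_pair_excess_le hum measurableSet_closedBall measurableSet_closedBall hγ
      (fun z hz => by simpa using hBn z hz) hdist hdec).trans (le_of_eq ?_)
    rw [ENNReal.ofReal_mul (p := C * D ^ (N + 1)) (by positivity), ← volume_real_closedBall (0 : Sp N) hD.le,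
      measureReal_def, ENNReal.ofReal_toReal measure_closedBall_lt_top.ne]
  have hG0 : ∀ q, 0 ≤ G q := fun q => le_max_right _ _
  have iG : Integrable G μ := by
    refine ⟨hGm, ?_⟩
    rw [hasFiniteIntegral_iff_ofReal (ae_of_all _ hG0)]
    exact hGl.trans_lt ENNReal.ofReal_lt_top
  have hGint : ∫ q, G q ∂μ ≤ C * D ^ (N + 1) * (D ^ N * unitVol N) := by
    rw [integral_eq_lintegral_of_nonneg_ae (ae_of_all _ hG0) hGm]
    exact ENNReal.toReal_le_of_le_ofReal (by positivity) hGl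
  have hmono : ∫ q, (u q.2 - u q.1) ∂μ ≤ ∫ q, (D ^ γ + G q) ∂μ := by
    refine integral_mono_ae (i1.sub i2) ((integrable_const _).add iG) ?_
    rw [hμr]
    filter_upwards [ae_restrict_mem (measurableSet_closedBall.prod measurableSet_closedBall)]
      with q hq
    have h1 : ‖q.2 - q.1‖ ^ γ ≤ D ^ γ :=
      Real.rpow_le_rpow (norm_nonneg _) (hdist _ hq.1 _ hq.2) hγ.le
    have h2 : u q.2 - u q.1 - ‖q.2 - q.1‖ ^ γ ≤ G q := le_max_left _ _
    linarith
  have e1 : ∫ q, u q.2 ∂μ = volume.real B * ∫ y in A, u y := by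
    rw [hμ, integral_fun_snd]; simp
  have e2 : ∫ q, u q.1 ∂μ = volume.real A * ∫ y in B, u y := by
    rw [hμ, integral_fun_fst]; simp
  have e3 : ∫ _ : Sp N × Sp N, D ^ γ ∂μ = volume.real B * volume.real A * D ^ γ := by
    rw [integral_const, hμ, ← univ_prod_univ, measureReal_prod_prod]; simp
  rw [integral_sub i1 i2, integral_add (integrable_const _) iG, e1, e2, e3] at hmono
  rw [setAverage_eq, setAverage_eq, smul_eq_mul, smul_eq_mul]
  have hkey : (volume.real A)⁻¹ * (∫ y in A, u y) - (volume.real B)⁻¹ * ∫ y in B, u y ≤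
      D ^ γ + (volume.real A * volume.real B)⁻¹ * (C * D ^ (N + 1) * (D ^ N * unitVol N)) := by
    have h3 := mul_le_mul_of_nonneg_left (hmono.trans (add_le_add_right hGint _))
      (inv_nonneg.2 (mul_pos hVA0 hVB0).le)
    have e4 : (volume.real A * volume.real B)⁻¹ *
        (volume.real B * (∫ y in A, u y) - volume.real A * ∫ y in B, u y) =
        (volume.real A)⁻¹ * (∫ y in A, u y) - (volume.real B)⁻¹ * ∫ y in B, u y := by
      field_simp
    have e5 : (volume.real A * volume.real B)⁻¹ * (volume.real B * volume.real A * D ^ γ) =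
        D ^ γ := by field_simp
    rw [e4, mul_add, e5] at h3
    exact h3
  refine hkey.trans ?_
  -- Radii at least D / 8 give the factor 64^N. The normalisation D^{-2N}, the volume D^N of
  -- increments and the decay D^{N+1} leave a single power D ≤ D^γ; this is why the exponent N + 1
  -- is enough.
  have h4 : (volume.real A * volume.real B)⁻¹ ≤ ((D / 8) ^ N * (D / 8) ^ N * unitVol N ^ 2)⁻¹ := by
    rw [hVA, hVB]
    apply inv_anti₀ (by positivity)
    calc (D / 8) ^ N * (D / 8) ^ N * unitVol N ^ 2 ≤ a ^ N * b ^ N * unitVol N ^ 2 := by gcongr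
      _ = _ := by ring
  have h5 : (volume.real A * volume.real B)⁻¹ * (C * D ^ (N + 1) * (D ^ N * unitVol N)) ≤
      C * 64 ^ N * (unitVol N)⁻¹ * D := by
    calc _ ≤ ((D / 8) ^ N * (D / 8) ^ N * unitVol N ^ 2)⁻¹ *
          (C * D ^ (N + 1) * (D ^ N * unitVol N)) := by gcongr
      _ = _ := by
        rw [show (64 : ℝ) = 8 * 8 by norm_num, mul_pow, div_pow]
        field_simp
        ring
  have h6 : D ≤ D ^ γ := by simpa using Real.rpow_le_rpow_of_exponent_ge hD hD1 hγ1
  have h7 : C * 64 ^ N * (unitVol N)⁻¹ * D ≤ C * 64 ^ N * (unitVol N)⁻¹ * D ^ γ := by gcongr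
  linarith

/-! ### From averages to pointwise Hölder bounds -/

/-- A function of the radius with dyadic power-type oscillation is Cauchy at zero. -/
theorem abs_sub_le_of_dyadic {f : ℝ → ℝ} {C γ a₀ : ℝ} (hγ : 0 < γ) (hC : 0 ≤ C)
    (hf : ∀ a b, 0 < a → a ≤ a₀ → a / 2 ≤ b → b ≤ a → |f a - f b| ≤ C * a ^ γ) :
    ∀ a b, 0 < b → b ≤ a → a ≤ a₀ → |f a - f b| ≤ C / (1 - (1 / 2) ^ γ) * a ^ γ := by
  have hq : (1 / 2 : ℝ) ^ γ < 1 := Real.rpow_lt_one (by norm_num) (by norm_num) hγ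
  set K := C / (1 - (1 / 2) ^ γ) with hK
  have hK0 : 0 ≤ K := div_nonneg hC (by linarith)
  -- K sums the geometric series of dyadic oscillations; this fixed-point identity drives the
  -- induction on the number of halvings.
  have hKC : C + K * (1 / 2) ^ γ = K := by
    have : 1 - (1 / 2 : ℝ) ^ γ ≠ 0 := by linarith
    rw [hK]
    generalize (1 / 2 : ℝ) ^ γ = q at this
    field_simp
    ring
  have hCK : C ≤ K := by
    have : 0 ≤ K * (1 / 2 : ℝ) ^ γ := by positivity
    linarith
  have key : ∀ n : ℕ, ∀ a b, 0 < b → b ≤ a → a ≤ a₀ → a / 2 ^ n ≤ b →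
      |f a - f b| ≤ K * a ^ γ := by
    intro n
    induction n with
    | zero =>
      intro a b hb hba _ hab
      have : a = b := by
        rw [pow_zero, div_one] at hab; linarith
      rw [this, sub_self, abs_zero]
      positivity
    | succ n ih =>
      intro a b hb hba haa hab
      have ha : 0 < a := hb.trans_le hba
      have haγ : 0 < a ^ γ := Real.rpow_pos_of_pos ha _
      by_cases hb2 : a / 2 ≤ b
      · exact (hf a b ha haa hb2 hba).trans (by gcongr)
      · have h1 := hf a (a / 2) ha haa le_rfl (by linarith)
        have h2 := ih (a / 2) b hb (by linarith) (by linarith) (by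
          rw [div_div, ← pow_succ']; exact hab)
        have h3 : (a / 2) ^ γ = (1 / 2) ^ γ * a ^ γ := by
          rw [← Real.mul_rpow (by norm_num) ha.le]; ring_nf
        rw [h3] at h2
        calc |f a - f b| ≤ |f a - f (a / 2)| + |f (a / 2) - f b| := abs_sub_le _ _ _
          _ ≤ C * a ^ γ + K * ((1 / 2) ^ γ * a ^ γ) := add_le_add h1 h2
          _ = (C + K * (1 / 2) ^ γ) * a ^ γ := by ring
          _ = _ := by rw [hKC]
  intro a b hb hba haa
  obtain ⟨n, hn⟩ := exists_pow_lt_of_lt_one (show 0 < b / a by have := hb.trans_le hba; positivity)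
    (show (1 / 2 : ℝ) < 1 by norm_num)
  refine key n a b hb hba haa ?_
  have ha : 0 < a := hb.trans_le hba
  rw [lt_div_iff₀ ha, div_pow, one_pow] at hn
  calc a / 2 ^ n = 1 / 2 ^ n * a := by ring
    _ ≤ b := hn.le

theorem exists_tendsto_of_dyadic {f : ℝ → ℝ} {C γ a₀ : ℝ} (hγ : 0 < γ) (hC : 0 ≤ C) (ha₀ : 0 < a₀)
    (hf : ∀ a b, 0 < a → a ≤ a₀ → a / 2 ≤ b → b ≤ a → |f a - f b| ≤ C * a ^ γ) :
    ∃ l, Tendsto f (𝓝[>] 0) (𝓝 l) ∧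
      ∀ a, 0 < a → a ≤ a₀ → |f a - l| ≤ C / (1 - (1 / 2) ^ γ) * a ^ γ := by
  have h := abs_sub_le_of_dyadic hγ hC hf
  set K := C / (1 - (1 / 2) ^ γ) with hK
  have hcauchy : Cauchy (map f (𝓝[>] 0)) := by
    rw [Metric.cauchy_iff]
    refine ⟨inferInstance, fun ε hε => ?_⟩
    have ht : Tendsto (fun a : ℝ => K * a ^ γ) (𝓝[>] 0) (𝓝 0) := by
      have : Tendsto (fun a : ℝ => K * a ^ γ) (𝓝 0) (𝓝 (K * 0 ^ γ)) :=
        ((Real.continuousAt_rpow_const 0 γ (Or.inr hγ.le)).tendsto).const_mul K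
      rw [Real.zero_rpow hγ.ne', mul_zero] at this
      exact this.mono_left nhdsWithin_le_nhds
    have h1 : ∀ᶠ a in 𝓝[>] (0 : ℝ), K * a ^ γ < ε ∧ 0 < a ∧ a ≤ a₀ := by
      refine (ht.eventually (gt_mem_nhds hε)).and ?_
      filter_upwards [Ioc_mem_nhdsGT ha₀] with a ha using ha
    obtain ⟨a, ha, ha0, haa⟩ := h1.exists
    have hbound : ∀ b c, 0 < b → b ≤ a → 0 < c → c ≤ a → |f b - f c| < ε := by
      intro b c hb hba hc hca
      have hmono : ∀ d, 0 < d → d ≤ a → K * d ^ γ ≤ K * a ^ γ := by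
        intro d hd hda
        have : 0 ≤ K := by
          have h0 := (abs_nonneg _).trans (h a a ha0 le_rfl haa)
          exact nonneg_of_mul_nonneg_left h0 (Real.rpow_pos_of_pos ha0 _)
        gcongr
      rcases le_total b c with hbc | hbc
      · rw [abs_sub_comm]
        exact (h c b hb hbc (hca.trans haa)).trans_lt ((hmono c hc hca).trans_lt ha)
      · exact (h b c hc hbc (hba.trans haa)).trans_lt ((hmono b hb hba).trans_lt ha)
    refine ⟨f '' Ioc 0 a, image_mem_map (Ioc_mem_nhdsGT ha0), ?_⟩
    rintro _ ⟨b, hb, rfl⟩ _ ⟨c, hc, rfl⟩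
    exact hbound b c hb.1 hb.2 hc.1 hc.2
  obtain ⟨l, hl⟩ := CompleteSpace.complete hcauchy
  refine ⟨l, hl, fun a ha haa => ?_⟩
  have ht : Tendsto (fun b => |f a - f b|) (𝓝[>] 0) (𝓝 |f a - l|) :=
    (tendsto_const_nhds.sub hl).abs
  refine le_of_tendsto ht ?_
  filter_upwards [Ioc_mem_nhdsGT ha] with b hb using h a b hb.1 hb.2 haa

/-- Improvement of the Hölder exponent. -/
theorem UnitHolder.improve (hN : 1 ≤ N) {p s₁ sₚ Λ γ γ' : ℝ} (hp : 1 < p) (hp2 : p < 2)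
    (h1 : 0 < s₁) (h11 : s₁ < 1) (hs : 0 < sₚ * p) (hs1 : sₚ * p < 1) (hγ : 0 ≤ γ) (hγγ' : γ < γ')
    (hγ' : γ' < 1)
    (hδ0 : 0 < (sₚ * p + (2 - p) * γ) * ((1 - γ') / (1 - γ)) - γ')
    (hol : UnitHolder N p s₁ sₚ Λ γ) : UnitHolder N p s₁ sₚ Λ γ' := by
  intro r hr
  wlog hr0 : 0 ≤ r generalizing r
  · obtain ⟨H, hH, hH'⟩ := this 0 one_pos le_rfl
    refine ⟨H, hH, fun lam u hu x y hx hy => absurd (norm_nonneg x) (by linarith)⟩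
  set δ := (sₚ * p + (2 - p) * γ) * ((1 - γ') / (1 - γ)) - γ' with hδ
  -- Enough iterations that the decay exponent nδ exceeds N + 1.
  obtain ⟨n, hn⟩ := exists_nat_gt ((N + 1 : ℝ) / δ)
  rw [div_lt_iff₀ hδ0] at hn
  set r' := (1 + r) / 2 with hr'
  have hr'1 : r' < 1 := by rw [hr']; linarith
  have hrr' : r < r' := by rw [hr']; linarith
  obtain ⟨C, h₀, hC, hh₀, hh₀1, hdec⟩ := excess_decay hN hp hp2 h1 h11 hs hs1 hγ hγγ' hγ' hδ hol n
    r' (by linarith) hr'1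
  have hγ'0 : 0 < γ' := by linarith
  set D₀ := min h₀ ((r' - r) / 2) with hD₀
  have hD₀0 : 0 < D₀ := lt_min hh₀ (by linarith)
  have hω := unitVol_pos (N := N)
  set C₀ := 1 + C * 64 ^ N * (unitVol N)⁻¹ with hC₀
  have hC₀0 : 0 ≤ C₀ := by positivity
  set K := C₀ * 2 ^ γ' / (1 - (1 / 2) ^ γ') with hK
  have hq : (1 / 2 : ℝ) ^ γ' < 1 := Real.rpow_lt_one (by norm_num) (by norm_num) hγ'0
  have hK0 : 0 ≤ K := div_nonneg (by positivity) (by linarith)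
  -- The summands stem from passing from u to its averages at both points, from comparing averages
  -- of radius t at scale 3t, and from distant pairs 3t > D₀, where |u| ≤ 1 suffices.
  set H := 2 * K + C₀ * 3 ^ γ' + 2 * (3 / D₀) ^ γ' with hH
  refine ⟨H, by positivity, ?_⟩
  intro lam u hu x x' hx hx'
  have hdiff : ∀ x x' : Sp N, ‖x‖ < r → ‖x'‖ < r → ∀ a b D, 0 < D → D ≤ D₀ → D / 8 ≤ a →
      D / 8 ≤ b → ‖x - x'‖ + a + b ≤ D →
      (⨍ y in closedBall x a, u y) - (⨍ y in closedBall x' b, u y) ≤ C₀ * D ^ γ' := by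
    intro x x' hx hx' a b D hD hDD₀ ha hb hab
    have hDh : D ≤ h₀ := hDD₀.trans (min_le_left _ _)
    have hDr : D ≤ (r' - r) / 2 := hDD₀.trans (min_le_right _ _)
    refine average_sub_average_le hu.aesm hu.bdd hγ'0 hγ'.le hr'1.le hD (hDh.trans hh₀1)
      (by linarith) (by linarith) ha hb hab hC.le fun h hh hhD => ?_
    refine (hdec lam u hu h hh (hhD.trans hDh)).trans (ENNReal.ofReal_le_ofReal ?_)
    gcongr
    calc ‖h‖ ^ (n * δ) ≤ ‖h‖ ^ ((N : ℝ) + 1) :=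
          Real.rpow_le_rpow_of_exponent_ge hh (hhD.trans (hDh.trans hh₀1)) hn.le
      _ ≤ D ^ ((N : ℝ) + 1) := Real.rpow_le_rpow hh.le hhD (by positivity)
      _ = D ^ (N + 1) := by rw [← Real.rpow_natCast]; push_cast; rfl
  have habs : ∀ x x' : Sp N, ‖x‖ < r → ‖x'‖ < r → ∀ a b D, 0 < D → D ≤ D₀ → D / 8 ≤ a →
      D / 8 ≤ b → ‖x - x'‖ + a + b ≤ D →
      |(⨍ y in closedBall x a, u y) - (⨍ y in closedBall x' b, u y)| ≤ C₀ * D ^ γ' := by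
    intro x x' hx hx' a b D hD hDD₀ ha hb hab
    rw [abs_sub_le_iff]
    exact ⟨hdiff x x' hx hx' a b D hD hDD₀ ha hb hab, hdiff x' x hx' hx b a D hD hDD₀ hb ha
      (by rw [norm_sub_rev]; linarith)⟩
  have hlim : ∀ x : Sp N, ‖x‖ < r → ∀ a, 0 < a → a ≤ D₀ / 2 →
      |(⨍ y in closedBall x a, u y) - u x| ≤ K * a ^ γ' := by
    intro x hx
    obtain ⟨l, hl, hl'⟩ := exists_tendsto_of_dyadic
      (f := fun a => ⨍ y in closedBall x a, u y) (C := C₀ * 2 ^ γ') (a₀ := D₀ / 2) hγ'0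
      (by positivity) (by positivity) (by
        intro a b ha haa hab hba
        have := habs x x hx hx a b (2 * a) (by positivity) (by linarith) (by linarith)
          (by linarith) (by rw [sub_self, norm_zero]; linarith)
        rwa [Real.mul_rpow (by norm_num) ha.le, ← mul_assoc] at this)
    -- The averages converge at every point, so the normalisation of the representative identifies
    -- their limit with u x everywhere and not just almost everywhere.
    rw [hu.rep x l (hx.trans hr) hl]
    exact hl'
  set t := ‖x - x'‖ with ht
  have ht0 : 0 ≤ t := norm_nonneg _
  rcases ht0.eq_or_lt with h0 | h0
  · have : x = x' := sub_eq_zero.1 (norm_eq_zero.1 h0.symm)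
    rw [this, sub_self, abs_zero]
    positivity
  have htγ : 0 < t ^ γ' := Real.rpow_pos_of_pos h0 _
  by_cases hts : 3 * t ≤ D₀
  · have e1 := hlim x hx t h0 (by linarith)
    have e2 := hlim x' hx' t h0 (by linarith)
    have e3 := habs x x' hx hx' t t (3 * t) (by positivity) hts (by linarith) (by linarith)
      (by rw [← ht]; linarith)
    rw [Real.mul_rpow (by norm_num) h0.le] at e3
    have e4 : 0 ≤ 2 * (3 / D₀) ^ γ' * t ^ γ' := by positivity
    have e5 := abs_sub_le (u x) (⨍ y in closedBall x t, u y) (u x')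
    have e6 := abs_sub_le (⨍ y in closedBall x t, u y) (⨍ y in closedBall x' t, u y) (u x')
    rw [abs_sub_comm (u x) (⨍ y in closedBall x t, u y)] at e5
    rw [hH]
    linarith
  · have e1 : |u x - u x'| ≤ 2 := by
      have := hu.bdd x (hx.trans hr)
      have := hu.bdd x' (hx'.trans hr)
      linarith [abs_sub (u x) (u x')]
    have e2 : 1 ≤ (3 / D₀) ^ γ' * t ^ γ' := by
      rw [← Real.mul_rpow (by positivity) h0.le]
      apply Real.one_le_rpow _ hγ'0.le
      rw [div_mul_eq_mul_div, le_div_iff₀ hD₀0]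
      linarith
    have e3 : 0 ≤ (2 * K + C₀ * 3 ^ γ') * t ^ γ' := by positivity
    rw [hH]
    linarith

/-- Start of the bootstrap: exponent 0 only records |u| ≤ 1. -/
theorem unitHolder_zero {p s₁ sₚ Λ : ℝ} : UnitHolder N p s₁ sₚ Λ 0 := by
  intro r hr
  refine ⟨2, by norm_num, fun lam u hu x y hx hy => ?_⟩
  have := hu.bdd x (hx.trans hr)
  have := hu.bdd y (hy.trans hr)
  rw [Real.rpow_zero, mul_one]
  linarith [abs_sub (u x) (u y)]

/-- The interior Hölder estimate for normalised solutions, for every exponent below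
`sₚ p / (p - 1)`. -/
theorem unitHolder_of_lt (hN : 1 ≤ N) {p s₁ sₚ Λ γ : ℝ} (hp : 1 < p) (hp2 : p < 2)
    (h1 : 0 < s₁) (h11 : s₁ < 1) (hs : 0 < sₚ * p) (hsp : sₚ * p ≤ p - 1) (hγ : 0 < γ)
    (hγ1 : γ < sₚ * p / (p - 1)) : UnitHolder N p s₁ sₚ Λ γ := by
  have hp0 : 0 < p - 1 := by linarith
  have hγp : γ * (p - 1) < sₚ * p := (lt_div_iff₀ hp0).1 hγ1
  have hγlt : γ < 1 := by
    have : γ * (p - 1) < 1 * (p - 1) := by linarith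
    exact lt_of_mul_lt_mul_right this hp0.le
  set m := sₚ * p - γ * (p - 1) with hm
  have hm0 : 0 < m := by rw [hm]; linarith
  -- A uniform step. The gap sₚ p - (p-1) g is at least m for every g ≤ γ, and 1 - g stays at least
  -- 1 - γ.
  set t := m * (1 - γ) / 4 with ht
  have ht0 : 0 < t := by
    have : 0 < 1 - γ := by linarith
    positivity
  have key : ∀ n : ℕ, UnitHolder N p s₁ sₚ Λ (min γ (n * t)) := by
    intro n
    induction n with
    | zero => simpa [min_eq_right hγ.le] using unitHolder_zero
    | succ n ih =>
      by_cases hn : γ ≤ n * t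
      · have : γ ≤ (n + 1 : ℕ) * t := by push_cast; linarith
        rw [min_eq_left this]
        rwa [min_eq_left hn] at ih
      · push Not at hn
        rw [min_eq_right hn.le] at ih
        set g := (n : ℝ) * t with hg
        set g' := min γ ((n + 1 : ℕ) * t) with hg'
        have hg0 : 0 ≤ g := by positivity
        have hgg' : g < g' := lt_min hn (by push_cast; linarith)
        have hg't : g' ≤ g + t := (min_le_right _ _).trans (by push_cast; linarith)
        have hg'γ : g' ≤ γ := min_le_left _ _
        have h1g : 0 < 1 - g := by linarith
        refine ih.improve hN hp hp2 h1 h11 hs (by linarith) hg0 hgg' (by linarith) ?_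
        -- Positivity of the gain now reads g'(1 - g) < σ(1 - g'), that is, (g' - g)(σ + 1 - g) < (σ
        -- - g)(1 - g). The left side is at most 2t and the right side at least m(1 - γ) = 4t.
        rw [sub_pos, ← mul_div_assoc, lt_div_iff₀ h1g]
        set σ := sₚ * p + (2 - p) * g with hσ
        have hσ1 : σ ≤ 1 := by
          have : (2 - p) * g ≤ (2 - p) * 1 := by
            gcongr
            linarith
          linarith
        have hσ0 : 0 ≤ σ := by
          have : 0 ≤ (2 - p) * g := mul_nonneg (by linarith) hg0
          linarith
        have hσg : m ≤ σ - g := by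
          have : g * (p - 1) ≤ γ * (p - 1) := by gcongr
          rw [hm, hσ]; linarith
        have h2 : m * (1 - γ) ≤ (σ - g) * (1 - g) := by
          apply mul_le_mul hσg (by linarith) (by linarith) (by linarith)
        have h3 : (g' - g) * (σ + (1 - g)) ≤ t * 2 := by
          apply mul_le_mul (by linarith) (by linarith) (by linarith) ht0.le
        have h4 : t * 2 < m * (1 - γ) := by linarith
        linarith
  obtain ⟨n, hn⟩ := exists_nat_gt (γ / t)
  have := key n
  rwa [min_eq_left ((div_lt_iff₀ ht0).1 hn).le] at this

/-! ### The precise representative -/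

open Classical in
/-- The limit of averages over shrinking balls where it exists, and `0` elsewhere. -/
noncomputable def preciseRep (u : Sp N → ℝ) (x : Sp N) : ℝ :=
  if h : ∃ l, Tendsto (fun r => ⨍ y in closedBall x r, u y) (𝓝[>] 0) (𝓝 l) then h.choose else 0

theorem preciseRep_eq {u : Sp N → ℝ} {x : Sp N} {l : ℝ}
    (h : Tendsto (fun r => ⨍ y in closedBall x r, u y) (𝓝[>] 0) (𝓝 l)) : preciseRep u x = l := by
  have h' : ∃ l, Tendsto (fun r => ⨍ y in closedBall x r, u y) (𝓝[>] 0) (𝓝 l) := ⟨l, h⟩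
  rw [preciseRep, dif_pos h']
  exact tendsto_nhds_unique h'.choose_spec h

/-- Lebesgue differentiation on centred balls. -/
theorem preciseRep_ae_eq {u : Sp N → ℝ} (hu : LocallyIntegrable u volume) :
    preciseRep u =ᵐ[volume] u := by
  filter_upwards [IsUnifLocDoublingMeasure.ae_tendsto_average volume hu 1] with x hx
  refine preciseRep_eq (hx (fun _ => x) (fun r => r) tendsto_id ?_)
  filter_upwards [self_mem_nhdsWithin] with r hr
  exact mem_closedBall_self (by rw [one_mul]; exact (mem_Ioi.1 hr).le)

/-- Averages do not see null sets, so `preciseRep u` is its own precise representative; this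
supplies the field `rep` of a normalised solution. -/
theorem eq_of_tendsto_average_preciseRep {u : Sp N → ℝ} (hu : LocallyIntegrable u volume)
    {x : Sp N} {l : ℝ}
    (h : Tendsto (fun r => ⨍ y in closedBall x r, preciseRep u y) (𝓝[>] 0) (𝓝 l)) :
    preciseRep u x = l := by
  refine preciseRep_eq (h.congr fun r => ?_)
  exact average_congr (ae_restrict_of_ae (preciseRep_ae_eq hu))

/-- Upgrades an essential bound to one at every point: averages over small balls inside V inherit
it, and the default value 0 satisfies it because T ≥ 0. -/
theorem abs_preciseRep_le {u : Sp N → ℝ} {V : Set (Sp N)} (hV : IsOpen V) {T : ℝ} (hT : 0 ≤ T)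
    (hu : ∀ᵐ x ∂volume.restrict V, |u x| ≤ T) {x : Sp N} (hx : x ∈ V) : |preciseRep u x| ≤ T := by
  unfold preciseRep
  split_ifs with h
  · refine le_of_tendsto h.choose_spec.abs ?_
    obtain ⟨ε, hε, hεV⟩ := Metric.isOpen_iff.1 hV x hx
    filter_upwards [Ioo_mem_nhdsGT hε] with r hr
    have hsub : closedBall x r ⊆ V := (closedBall_subset_ball hr.2).trans hεV
    have h1 : ∀ᵐ y ∂volume.restrict (closedBall x r), ‖u y‖ ≤ T :=
      ae_restrict_of_ae_restrict_of_subset hsub hu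
    have h2 : ‖∫ y in closedBall x r, u y‖ ≤ T * volume.real (closedBall x r) :=
      norm_setIntegral_le_of_norm_le_const_ae measure_closedBall_lt_top h1
    rw [setAverage_eq, smul_eq_mul, abs_mul, abs_inv, abs_of_nonneg measureReal_nonneg,
      ← Real.norm_eq_abs]
    have hpos : 0 < volume.real (closedBall x r) := ENNReal.toReal_pos
      (measure_closedBall_pos _ _ hr.1).ne' measure_closedBall_lt_top.ne
    rw [inv_mul_le_iff₀ hpos]
    linarith
  · simpa using hT

theorem MemTailSpace.locallyIntegrable {u : Sp N → ℝ} {s p : ℝ} (hp : 1 ≤ p)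
    (hu : MemTailSpace u s p) : LocallyIntegrable u volume := by
  intro x
  refine ⟨ball x 1, ball_mem_nhds x one_pos, ?_⟩
  have h := hu.1 (ball x 1) isOpen_ball
    ⟨(isCompact_closedBall x 1).of_isClosed_subset isClosed_closure closure_ball_subset_closedBall,
      subset_univ _⟩
  have : IsFiniteMeasure (volume.restrict (ball x 1)) := ⟨by simpa using measure_ball_lt_top⟩
  exact h.integrable (by simpa using hp)

/-! ### Invariance under modification on null sets -/

theorem ae_prod_eq {u v : Sp N → ℝ} {μ : Measure (Sp N)} [SFinite μ] (h : u =ᵐ[μ] v) :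
    ∀ᵐ z ∂μ.prod μ, u z.1 = v z.1 ∧ u z.2 = v z.2 :=
  (Measure.quasiMeasurePreserving_fst.ae h).and (Measure.quasiMeasurePreserving_snd.ae h)

theorem gagliardo_congr {u v : Sp N → ℝ} {s q : ℝ} {U : Set (Sp N)}
    (h : u =ᵐ[volume.restrict U] v) : gagliardo u s q U = gagliardo v s q U := by
  unfold gagliardo
  congr 1
  refine lintegral_congr_ae (h.mono fun x hx => lintegral_congr_ae (h.mono fun y hy => ?_))
  simp only [hx, hy]

theorem MemWLoc.congr {u v : Sp N → ℝ} {s q : ℝ} {Ω : Set (Sp N)} (hu : MemWLoc u s q Ω)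
    (h : u =ᵐ[volume] v) : MemWLoc v s q Ω := by
  intro V hV hVΩ
  obtain ⟨h1, h2⟩ := hu V hV hVΩ
  exact ⟨h1.ae_eq (ae_restrict_of_ae h), by rwa [← gagliardo_congr (ae_restrict_of_ae h)]⟩

/-- All conditions on u are integral or almost-everywhere ones, so the same Z serves the precise
representative. -/
theorem IsWeakSolution.congr {u v : Sp N → ℝ} {p s₁ sₚ : ℝ} {Ω : Set (Sp N)}
    (hu : IsWeakSolution Ω p s₁ sₚ u) (h : u =ᵐ[volume] v) : IsWeakSolution Ω p s₁ sₚ v where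
  memW_one := hu.memW_one.congr h
  memW_p := hu.memW_p.congr h
  memTail := by
    refine ⟨fun V hV hVΩ => (hu.memTail.1 V hV hVΩ).ae_eq (ae_restrict_of_ae h), ?_⟩
    refine lt_of_eq_of_lt (lintegral_congr_ae ?_) hu.memTail.2
    filter_upwards [h] with x hx
    rw [hx]
  weak := by
    obtain ⟨Z, hZ, hZs, heq⟩ := hu.weak
    have h2 : ∀ᵐ z : Sp N × Sp N, u z.1 = v z.1 ∧ u z.2 = v z.2 := ae_prod_eq h
    refine ⟨Z, hZ, ?_, fun φ h1 hp => ?_⟩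
    · filter_upwards [hZs, h2] with z hz hz2
      rwa [← hz2.1, ← hz2.2]
    · rw [heq φ h1 hp]
      congr 1
      refine integral_congr_ae ?_
      filter_upwards [h2] with z hz
      simp only [hz.1, hz.2]

/-! ### Affine rescaling -/

section Affine

variable {E : Type*} [NormedAddCommGroup E] [NormedSpace ℝ E] [MeasurableSpace E] [BorelSpace E]

theorem measurableEmbedding_affine (a : E) {d : ℝ} (hd : d ≠ 0) :
    MeasurableEmbedding (fun z : E => a + d • z) :=
  (MeasurableEquiv.addLeft a).measurableEmbedding.comp (measurableEmbedding_const_smul₀ hd)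

variable [FiniteDimensional ℝ E]

theorem map_affine (μ : Measure E) [μ.IsAddHaarMeasure] (a : E) {d : ℝ} (hd : 0 < d) :
    Measure.map (fun z : E => a + d • z) μ =
      ENNReal.ofReal ((d ^ Module.finrank ℝ E)⁻¹) • μ := by
  have h1 : Measure.map (fun z : E => a + d • z) μ =
      Measure.map (fun z => a + z) (Measure.map (fun z => d • z) μ) := by
    rw [Measure.map_map (by fun_prop) (by fun_prop)]
    rfl
  rw [h1, Measure.map_addHaar_smul μ hd.ne', Measure.map_smul, map_add_left_eq_self,
    abs_of_pos (by positivity)]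

theorem lintegral_comp_affine (μ : Measure E) [μ.IsAddHaarMeasure] (a : E) {d : ℝ} (hd : 0 < d)
    (f : E → ℝ≥0∞) (s : Set E) :
    ∫⁻ z in (fun z : E => a + d • z) ⁻¹' s, f (a + d • z) ∂μ =
      ENNReal.ofReal ((d ^ Module.finrank ℝ E)⁻¹) * ∫⁻ y in s, f y ∂μ := by
  have hA := measurableEmbedding_affine a hd.ne'
  rw [← hA.lintegral_map (μ := μ.restrict ((fun z : E => a + d • z) ⁻¹' s)) f, ← hA.restrict_map,
    map_affine μ a hd, Measure.restrict_smul, lintegral_smul_measure, smul_eq_mul]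

theorem integral_comp_affine (μ : Measure E) [μ.IsAddHaarMeasure] (a : E) {d : ℝ} (hd : 0 < d)
    (f : E → ℝ) (s : Set E) :
    ∫ z in (fun z : E => a + d • z) ⁻¹' s, f (a + d • z) ∂μ =
      (d ^ Module.finrank ℝ E)⁻¹ * ∫ y in s, f y ∂μ := by
  have hA := measurableEmbedding_affine a hd.ne'
  rw [← hA.integral_map (μ := μ.restrict ((fun z : E => a + d • z) ⁻¹' s)) f, ← hA.restrict_map,
    map_affine μ a hd, Measure.restrict_smul, integral_smul_measure, smul_eq_mul,
    ENNReal.toReal_ofReal (by positivity)]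

theorem quasiMeasurePreserving_affine (μ : Measure E) [μ.IsAddHaarMeasure] (a : E) {d : ℝ}
    (hd : 0 < d) : Measure.QuasiMeasurePreserving (fun z : E => a + d • z) μ μ :=
  ⟨by fun_prop, by rw [map_affine μ a hd]; exact Measure.smul_absolutelyContinuous⟩

end Affine

/-- Allows the affine change of variables to be applied to the double integrals as well. -/
instance isAddHaarMeasure_volume_prod : (volume : Measure (Sp N × Sp N)).IsAddHaarMeasure :=
  Measure.prod.instIsAddHaarMeasure _ _

/-- The scaling factor k is left implicit because only finiteness of the energy is transported. -/
theorem energy_affine (f : Sp N → ℝ) (s q : ℝ) (x₀ : Sp N) {d S : ℝ} (hd : 0 < d) (hS : 0 < S)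
    (W : Set (Sp N)) :
    ∃ k : ℝ, 0 < k ∧ energy (fun z => S * f (x₀ + d • z)) s q ((fun z => x₀ + d • z) ⁻¹' W) =
      ENNReal.ofReal k * energy f s q W := by
  set c := (d ^ Module.finrank ℝ (Sp N × Sp N))⁻¹ with hc
  set e := S ^ q * d ^ ((N : ℝ) + s * q) with he
  have he0 : 0 < e := by positivity
  have hc0 : 0 < c := by positivity
  refine ⟨e * c, by positivity, ?_⟩
  have h := lintegral_comp_affine (volume : Measure (Sp N × Sp N)) (x₀, x₀) hd (fun z =>
    ENNReal.ofReal (|f z.1 - f z.2| ^ q / ‖z.1 - z.2‖ ^ ((N : ℝ) + s * q))) (W ×ˢ W)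
  rw [energy, energy, ENNReal.ofReal_mul he0.le, mul_assoc, ← h,
    ← lintegral_const_mul' _ _ ENNReal.ofReal_ne_top]
  have hset : ((fun z : Sp N => x₀ + d • z) ⁻¹' W) ×ˢ ((fun z : Sp N => x₀ + d • z) ⁻¹' W) =
      (fun z : Sp N × Sp N => (x₀, x₀) + d • z) ⁻¹' (W ×ˢ W) := rfl
  rw [hset]
  refine lintegral_congr fun z => ?_
  rw [← ENNReal.ofReal_mul he0.le]
  congr 1
  simp only [Prod.fst_add, Prod.snd_add, Prod.smul_fst, Prod.smul_snd, add_sub_add_left_eq_sub,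
    ← smul_sub, ← mul_sub, norm_smul, abs_mul, Real.norm_eq_abs, abs_of_pos hd, abs_of_pos hS]
  rw [Real.mul_rpow hS.le (abs_nonneg _), Real.mul_rpow hd.le (norm_nonneg _), he]
  have : d ^ ((N : ℝ) + s * q) ≠ 0 := (Real.rpow_pos_of_pos hd _).ne'
  field_simp

theorem sgnSet_mul {c a : ℝ} (hc : 0 < c) : sgnSet (c * a) = sgnSet a := by
  ext t
  have h1 : c * a = 0 ↔ a = 0 := by simp [hc.ne']
  have h2 : c * a / |c * a| = a / |a| := by
    rw [abs_mul, abs_of_pos hc, mul_div_mul_left _ _ hc.ne']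
  simp only [sgnSet, ne_eq, h1, h2]

theorem signedPow_mul {p c a : ℝ} (hc : 0 < c) :
    |c * a| ^ (p - 2) * (c * a) = c ^ (p - 1) * (|a| ^ (p - 2) * a) := by
  rw [abs_mul, abs_of_pos hc, Real.mul_rpow hc.le (abs_nonneg _),
    show p - 1 = (p - 2) + 1 by ring, Real.rpow_add_one hc.ne']
  ring

theorem preimage_affine_ball (x₀ : Sp N) {d : ℝ} (hd : 0 < d) (z : Sp N) (r : ℝ) :
    (fun y : Sp N => x₀ + d • y) ⁻¹' ball (x₀ + d • z) (d * r) = ball z r := by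
  ext y
  rw [mem_preimage, mem_ball, mem_ball, dist_add_left, dist_smul₀, Real.norm_eq_abs, abs_of_pos hd,
    mul_lt_mul_iff_right₀ hd]

theorem preimage_affine_closedBall (x₀ : Sp N) {d : ℝ} (hd : 0 < d) (z : Sp N) (r : ℝ) :
    (fun y : Sp N => x₀ + d • y) ⁻¹' closedBall (x₀ + d • z) (d * r) = closedBall z r := by
  ext y
  rw [mem_preimage, mem_closedBall, mem_closedBall, dist_add_left, dist_smul₀, Real.norm_eq_abs,
    abs_of_pos hd, mul_le_mul_iff_right₀ hd]

theorem average_affine (v : Sp N → ℝ) (x₀ : Sp N) {d S : ℝ} (hd : 0 < d) (z : Sp N) {r : ℝ}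
    (hr : 0 ≤ r) :
    ⨍ y in closedBall z r, S * v (x₀ + d • y) =
      S * ⨍ y in closedBall (x₀ + d • z) (d * r), v y := by
  have h := integral_comp_affine volume x₀ hd v (closedBall (x₀ + d • z) (d * r))
  rw [preimage_affine_closedBall x₀ hd, finrank_euclideanSpace, Fintype.card_fin] at h
  rw [setAverage_eq, setAverage_eq, integral_const_mul, h, smul_eq_mul, smul_eq_mul,
    volume_real_closedBall _ hr, volume_real_closedBall _ (by positivity), mul_pow, mul_inv_rev,
    mul_inv_rev, mul_inv_rev]
  ring

/-- The nonlocal tail integral outside a ball. -/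
noncomputable def tailIntegral (u : Sp N → ℝ) (p sₚ : ℝ) (x₀ : Sp N) (d : ℝ) : ℝ≥0∞ :=
  ∫⁻ x in (ball x₀ d)ᶜ, ENNReal.ofReal (|u x| ^ (p - 1) / ‖x - x₀‖ ^ ((N : ℝ) + sₚ * p))

theorem lintegral_tailDensity_affine (v : Sp N → ℝ) {p sₚ : ℝ} (x₀ : Sp N) {d S : ℝ} (hd : 0 < d)
    (hS : 0 < S) :
    ∫⁻ z, ENNReal.ofReal (tailDensity p sₚ (fun z => S⁻¹ * v (x₀ + d • z)) z) =
      ENNReal.ofReal (S⁻¹ ^ (p - 1) * d ^ (sₚ * p)) * tailIntegral v p sₚ x₀ d := by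
  have hpre : (fun z : Sp N => x₀ + d • z) ⁻¹' (ball x₀ d)ᶜ = (ball (0 : Sp N) 1)ᶜ := by
    have := preimage_affine_ball x₀ hd 0 1
    rw [smul_zero, add_zero, mul_one] at this
    rw [preimage_compl, this]
  have h := lintegral_comp_affine volume x₀ hd (fun x => ENNReal.ofReal
    (|v x| ^ (p - 1) / ‖x - x₀‖ ^ ((N : ℝ) + sₚ * p))) (ball x₀ d)ᶜ
  rw [hpre, finrank_euclideanSpace, Fintype.card_fin] at h
  set k := S⁻¹ ^ (p - 1) * d ^ ((N : ℝ) + sₚ * p) with hk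
  have hk0 : 0 < k := by positivity
  have hkk : S⁻¹ ^ (p - 1) * d ^ (sₚ * p) = k * (d ^ N)⁻¹ := by
    rw [hk, Real.rpow_add hd, Real.rpow_natCast]
    field_simp
  rw [hkk, ENNReal.ofReal_mul hk0.le, mul_assoc, tailIntegral, ← h,
    ← lintegral_const_mul' _ _ ENNReal.ofReal_ne_top,
    ← lintegral_indicator measurableSet_ball.compl]
  refine lintegral_congr fun z => ?_
  by_cases hz : ‖z‖ < 1
  · rw [indicator_of_notMem (by simpa using hz), tailDensity, if_pos hz, ENNReal.ofReal_zero]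
  · rw [indicator_of_mem (by simpa using hz), tailDensity, if_neg hz, ← ENNReal.ofReal_mul hk0.le]
    congr 1
    rw [add_sub_cancel_left, norm_smul, Real.norm_eq_abs, abs_of_pos hd, abs_mul,
      abs_of_pos (inv_pos.2 hS), Real.mul_rpow (inv_pos.2 hS).le (abs_nonneg _),
      Real.mul_rpow hd.le (norm_nonneg _), hk]
    have : d ^ ((N : ℝ) + sₚ * p) ≠ 0 := (Real.rpow_pos_of_pos hd _).ne'
    field_simp

theorem compactlyInside_ball {Ω : Set (Sp N)} {x₀ : Sp N} {d : ℝ} (h : closedBall x₀ d ⊆ Ω) :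
    CompactlyInside (ball x₀ d) Ω :=
  ⟨(isCompact_closedBall x₀ d).of_isClosed_subset isClosed_closure closure_ball_subset_closedBall,
    closure_ball_subset_closedBall.trans h⟩

theorem energy_lt_top_of_memWLoc {Ω : Set (Sp N)} {u : Sp N → ℝ} {s q : ℝ} (hq : 0 < q)
    (hu : MemWLoc u s q Ω) {x₀ : Sp N} {d : ℝ} (h : closedBall x₀ d ⊆ Ω) :
    energy u s q (ball x₀ d) < ⊤ := by
  obtain ⟨h1, h2⟩ := hu _ isOpen_ball (compactlyInside_ball h)
  exact (gagliardo_lt_top_iff hq h1.aestronglyMeasurable).1 h2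

/-- Pulling a test function on the unit ball back to a ball inside `Ω`. -/
theorem memWZero_affine {Ω : Set (Sp N)} {φ : Sp N → ℝ} {s q r d C : ℝ} {x₀ : Sp N} (hq : 0 < q)
    (hd : 0 < d) (hr : r ≤ 1) (hφm : AEStronglyMeasurable φ volume)
    (hφ0 : ∀ x, r ≤ ‖x‖ → φ x = 0) (hC : ∀ x, |φ x| ≤ C)
    (hφe : energy φ s q univ < ⊤) (hball : closedBall x₀ d ⊆ Ω) :
    MemWZero (fun y => φ (d⁻¹ • (y - x₀))) s q Ω := by
  set ψ : Sp N → ℝ := fun y => φ (d⁻¹ • (y - x₀)) with hψ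
  have hψm : AEStronglyMeasurable ψ volume := by
    have h1 : Measure.QuasiMeasurePreserving (fun y : Sp N => -(d⁻¹ • x₀) + d⁻¹ • y) volume volume :=
      quasiMeasurePreserving_affine volume _ (inv_pos.2 hd)
    have h2 := hφm.comp_quasiMeasurePreserving h1
    have h3 : ψ = φ ∘ (fun y : Sp N => -(d⁻¹ • x₀) + d⁻¹ • y) := by
      ext y
      simp only [hψ, Function.comp]
      rw [smul_sub, sub_eq_neg_add]
    rwa [h3]
  have hψ0 : ∀ y, y ∉ closedBall x₀ d → ψ y = 0 := by
    intro y hy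
    apply hφ0
    rw [mem_closedBall_iff_norm, not_le] at hy
    rw [norm_smul, norm_inv, Real.norm_eq_abs, abs_of_pos hd, inv_mul_eq_div]
    refine hr.trans ?_
    rw [le_div_iff₀ hd]; linarith
  refine ⟨⟨?_, ?_⟩, closedBall x₀ d, isCompact_closedBall _ _, hball, ae_of_all _ hψ0⟩
  · rw [Measure.restrict_univ]
    have hi : MemLp ((closedBall x₀ d).indicator fun _ => C) (ENNReal.ofReal q) volume :=
      memLp_indicator_const _ measurableSet_closedBall _ (Or.inr measure_closedBall_lt_top.ne)
    refine hi.mono hψm (ae_of_all _ fun y => ?_)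
    by_cases hy : y ∈ closedBall x₀ d
    · rw [indicator_of_mem hy]
      exact (hC _).trans (le_abs_self C)
    · rw [hψ0 y hy, norm_zero]; positivity
  · rw [gagliardo_lt_top_iff hq (by rwa [Measure.restrict_univ])]
    obtain ⟨k, hk, he⟩ := energy_affine ψ s q x₀ hd one_pos univ
    have h4 : (fun z => (1 : ℝ) * ψ (x₀ + d • z)) = φ := by
      ext z
      simp [hψ, smul_smul, hd.ne']
    rw [h4, preimage_univ] at he
    rw [he] at hφe
    by_contra htop
    rw [not_lt, top_le_iff] at htop
    rw [htop, ENNReal.mul_top (by simpa using hk)] at hφe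
    exact lt_irrefl _ hφe

/-- Rescaling a weak solution on a ball to a normalised solution. -/
theorem IsWeakSolution.normalize {Ω : Set (Sp N)} {p s₁ sₚ Λ : ℝ} {v : Sp N → ℝ} (hp : 1 < p)
    (hv : IsWeakSolution Ω p s₁ sₚ v) (hvm : AEStronglyMeasurable v volume)
    (hrep : ∀ x l, Tendsto (fun r => ⨍ y in closedBall x r, v y) (𝓝[>] 0) (𝓝 l) → v x = l)
    {x₀ : Sp N} {d S : ℝ} (hd : 0 < d) (hS : 0 < S) (hball : closedBall x₀ d ⊆ Ω)
    (hbdd : ∀ y ∈ ball x₀ d, |v y| ≤ S)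
    (htail : ENNReal.ofReal (S⁻¹ ^ (p - 1) * d ^ (sₚ * p)) * tailIntegral v p sₚ x₀ d ≤
      ENNReal.ofReal Λ)
    (hlam : d ^ (sₚ * p - s₁) * S⁻¹ ^ (p - 1) ≤ 1) :
    NormalizedSolution p s₁ sₚ Λ (d ^ (sₚ * p - s₁) * S⁻¹ ^ (p - 1))
      (fun z => S⁻¹ * v (x₀ + d • z)) where
  aesm := (hvm.comp_quasiMeasurePreserving (quasiMeasurePreserving_affine volume x₀ hd)).const_mul _
  bdd x hx := by
    have h1 : x₀ + d • x ∈ ball x₀ d := by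
      rw [mem_ball, dist_self_add_left, norm_smul, Real.norm_eq_abs, abs_of_pos hd]
      nlinarith
    rw [abs_mul, abs_of_pos (inv_pos.2 hS), inv_mul_le_iff₀ hS, mul_one]
    exact hbdd _ h1
  tail_le := by rw [lintegral_tailDensity_affine v x₀ hd hS]; exact htail
  lam_nonneg := by positivity
  lam_le := hlam
  energy_one r hr := by
    obtain ⟨k, _, he⟩ := energy_affine v s₁ 1 x₀ hd (inv_pos.2 hS) (ball x₀ (d * r))
    have := preimage_affine_ball x₀ hd 0 r
    rw [smul_zero, add_zero] at this
    rw [this] at he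
    rw [he]
    exact ENNReal.mul_lt_top ENNReal.ofReal_lt_top (energy_lt_top_of_memWLoc one_pos hv.memW_one
      ((closedBall_subset_closedBall (by nlinarith)).trans hball))
  energy_p r hr := by
    obtain ⟨k, _, he⟩ := energy_affine v sₚ p x₀ hd (inv_pos.2 hS) (ball x₀ (d * r))
    have := preimage_affine_ball x₀ hd 0 r
    rw [smul_zero, add_zero] at this
    rw [this] at he
    rw [he]
    exact ENNReal.mul_lt_top ENNReal.ofReal_lt_top (energy_lt_top_of_memWLoc (by linarith)
      hv.memW_p ((closedBall_subset_closedBall (by nlinarith)).trans hball))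
  eqn := by
    obtain ⟨Z, hZ, hZs, heq⟩ := hv.weak
    have hq := quasiMeasurePreserving_affine (volume : Measure (Sp N × Sp N)) (x₀, x₀) hd
    refine ⟨fun z => Z ((x₀, x₀) + d • z), hZ.aestronglyMeasurable.comp_quasiMeasurePreserving hq,
      ?_, fun r hr φ hφ => ?_⟩
    · filter_upwards [hq.ae hZs] with z hz
      rw [← mul_sub, sgnSet_mul (inv_pos.2 hS)]
      exact hz
    · obtain ⟨C, hC⟩ := hφ.bdd
      set ψ : Sp N → ℝ := fun y => φ (d⁻¹ • (y - x₀)) with hψ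
      have hψφ : ∀ z, φ z = ψ (x₀ + d • z) := by
        intro z; simp [hψ, smul_smul, hd.ne']
      have e0 := heq ψ
        (memWZero_affine one_pos hd hr.le hφ.aesm hφ.zero hC hφ.energy_one hball)
        (memWZero_affine (by linarith) hd hr.le hφ.aesm hφ.zero hC hφ.energy_p hball)
      set c := (d ^ Module.finrank ℝ (Sp N × Sp N))⁻¹ with hc
      have hcomp : ∀ f : Sp N × Sp N → ℝ, ∫ z, f ((x₀, x₀) + d • z) = c * ∫ z, f z := by
        intro f
        have := integral_comp_affine (volume : Measure (Sp N × Sp N)) (x₀, x₀) hd f univ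
        rwa [preimage_univ, Measure.restrict_univ] at this
      have f1 : ∀ z : Sp N × Sp N, onePart s₁ (fun z => Z ((x₀, x₀) + d • z)) φ z =
          d ^ ((N : ℝ) + s₁) * onePart s₁ Z ψ ((x₀, x₀) + d • z) := by
        intro z
        have : d ^ ((N : ℝ) + s₁) ≠ 0 := (Real.rpow_pos_of_pos hd _).ne'
        simp only [onePart, hψφ, Prod.fst_add, Prod.snd_add, Prod.smul_fst, Prod.smul_snd,
          add_sub_add_left_eq_sub, ← smul_sub, norm_smul, Real.norm_eq_abs, abs_of_pos hd]
        rw [Real.mul_rpow hd.le (norm_nonneg _)]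
        field_simp
      have f2 : ∀ z : Sp N × Sp N, pPart p sₚ (fun z => S⁻¹ * v (x₀ + d • z)) φ z =
          S⁻¹ ^ (p - 1) * d ^ ((N : ℝ) + sₚ * p) * pPart p sₚ v ψ ((x₀, x₀) + d • z) := by
        intro z
        have : d ^ ((N : ℝ) + sₚ * p) ≠ 0 := (Real.rpow_pos_of_pos hd _).ne'
        simp only [pPart, hψφ, Prod.fst_add, Prod.snd_add, Prod.smul_fst, Prod.smul_snd,
          add_sub_add_left_eq_sub, ← smul_sub, ← mul_sub, norm_smul, Real.norm_eq_abs,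
          abs_of_pos hd]
        rw [Real.mul_rpow hd.le (norm_nonneg _), signedPow_mul (inv_pos.2 hS)]
        field_simp
      simp only [f1, f2]
      rw [integral_const_mul, integral_const_mul, hcomp, hcomp]
      have e1 : (∫ z, onePart s₁ Z ψ z) + ∫ z, pPart p sₚ v ψ z = 0 := e0.symm
      -- The two parts scale by d^{N+s₁} and by S^{1-p} d^{N+sₚp}. The coefficient of the 1-part is
      -- chosen to restore a common factor.
      have e2 : d ^ (sₚ * p - s₁) * d ^ ((N : ℝ) + s₁) = d ^ ((N : ℝ) + sₚ * p) := by
        rw [← Real.rpow_add hd]; ring_nf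
      calc _ = S⁻¹ ^ (p - 1) * c * ((d ^ (sₚ * p - s₁) * d ^ ((N : ℝ) + s₁)) *
            (∫ z, onePart s₁ Z ψ z) + d ^ ((N : ℝ) + sₚ * p) * ∫ z, pPart p sₚ v ψ z) := by ring
        _ = S⁻¹ ^ (p - 1) * c * (d ^ ((N : ℝ) + sₚ * p) *
            ((∫ z, onePart s₁ Z ψ z) + ∫ z, pPart p sₚ v ψ z)) := by rw [e2]; ring
        _ = 0 := by rw [e1]; ring
  rep x l hx hl := by
    have h1 : Tendsto (fun r : ℝ => r / d) (𝓝[>] 0) (𝓝[>] 0) := by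
      refine tendsto_nhdsWithin_iff.2 ⟨?_, ?_⟩
      · have : Tendsto (fun r : ℝ => r / d) (𝓝 0) (𝓝 (0 / d)) := tendsto_id.div_const d
        rw [zero_div] at this
        exact this.mono_left nhdsWithin_le_nhds
      · filter_upwards [self_mem_nhdsWithin] with r hr
        exact div_pos hr hd
    have h2 : Tendsto (fun r => ⨍ y in closedBall (x₀ + d • x) r, v y) (𝓝[>] 0) (𝓝 (S * l)) := by
      refine ((hl.comp h1).const_mul S).congr' ?_
      filter_upwards [self_mem_nhdsWithin] with r hr
      have hr0 : 0 ≤ r / d := (div_pos hr hd).le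
      simp only [Function.comp]
      rw [average_affine v x₀ hd x hr0, mul_div_cancel₀ _ hd.ne', mul_inv_cancel_left₀ hS.ne']
    rw [hrep _ _ h2, inv_mul_cancel_left₀ hS.ne']

/-! ### The Hölder estimate on small balls -/

/-- Dividing by S = T d^{-(N+2)/(p-1)} rather than by T makes S^{-(p-1)} carry a spare factor
d^{N+2}. It absorbs the possibly negative power d^{sₚp - s₁} in the coefficient of the 1-part, and
it allows the tail integral to be large by a power of 1/d. -/
theorem exists_holder_half_ball (hN : 1 ≤ N) {p s₁ sₚ γ : ℝ} (Λ : ℝ) (hp : 1 < p) (hp2 : p < 2)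
    (h1 : 0 < s₁) (h11 : s₁ < 1) (hs : 0 < sₚ * p) (hsp : sₚ * p ≤ p - 1) (hγ : 0 < γ)
    (hγ1 : γ < sₚ * p / (p - 1)) :
    ∃ H : ℝ, 0 ≤ H ∧ ∀ (Ω : Set (Sp N)) (v : Sp N → ℝ), IsWeakSolution Ω p s₁ sₚ v →
      AEStronglyMeasurable v volume →
      (∀ x l, Tendsto (fun r => ⨍ y in closedBall x r, v y) (𝓝[>] 0) (𝓝 l) → v x = l) →
      ∀ (x₀ : Sp N) (d T : ℝ), 0 < d → d ≤ 1 → 1 ≤ T → closedBall x₀ d ⊆ Ω →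
      (∀ y ∈ ball x₀ d, |v y| ≤ T) →
      ENNReal.ofReal (d ^ ((N : ℝ) + 2 + sₚ * p)) * tailIntegral v p sₚ x₀ d ≤
        ENNReal.ofReal (T ^ (p - 1) * Λ) →
      ∀ y ∈ ball x₀ (d / 2), ∀ y' ∈ ball x₀ (d / 2),
        |v y - v y'| ≤ H * T * d ^ (-(((N : ℝ) + 2) / (p - 1) + γ)) * ‖y - y'‖ ^ γ := by
  obtain ⟨H, hH, hHo⟩ := unitHolder_of_lt (Λ := Λ) hN hp hp2 h1 h11 hs hsp hγ hγ1 (1 / 2)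
    (by norm_num)
  refine ⟨H, hH, fun Ω v hv hvm hrep x₀ d T hd hd1 hT hball hbdd htail y hy y' hy' => ?_⟩
  have hp0 : 0 < p - 1 := by linarith
  have hT0 : 0 < T := by linarith
  set m := ((N : ℝ) + 2) / (p - 1) with hm
  have hm0 : 0 ≤ m := by positivity
  set S := T * d ^ (-m) with hS
  have hS0 : 0 < S := by positivity
  have hdm : 1 ≤ d ^ (-m) := Real.one_le_rpow_of_pos_of_le_one_of_nonpos hd hd1 (by linarith)
  have hTS : T ≤ S := le_mul_of_one_le_right hT0.le hdm
  have hSp : S⁻¹ ^ (p - 1) = (T ^ (p - 1))⁻¹ * d ^ ((N : ℝ) + 2) := by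
    have h2 : m * (p - 1) = (N : ℝ) + 2 := by rw [hm]; field_simp
    rw [Real.inv_rpow hS0.le, hS, Real.mul_rpow hT0.le (by positivity), ← Real.rpow_mul hd.le,
      mul_inv, ← Real.rpow_neg hd.le, ← h2]
    ring_nf
  have hTp : 1 ≤ T ^ (p - 1) := Real.one_le_rpow hT hp0.le
  have hTp0 : 0 < T ^ (p - 1) := by linarith
  have hsol := hv.normalize (Λ := Λ) hp hvm hrep hd hS0 hball (fun y hy => (hbdd y hy).trans hTS)
    (by
      have e : S⁻¹ ^ (p - 1) * d ^ (sₚ * p) =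
          (T ^ (p - 1))⁻¹ * d ^ ((N : ℝ) + 2 + sₚ * p) := by
        rw [hSp, Real.rpow_add hd ((N : ℝ) + 2)]; ring
      rw [e, ENNReal.ofReal_mul (by positivity), mul_assoc]
      calc _ ≤ ENNReal.ofReal (T ^ (p - 1))⁻¹ * ENNReal.ofReal (T ^ (p - 1) * Λ) := by gcongr
        _ = ENNReal.ofReal Λ := by
          rw [← ENNReal.ofReal_mul (by positivity), inv_mul_cancel_left₀ hTp0.ne'])
    (by
      rw [hSp]
      have e : d ^ (sₚ * p - s₁) * ((T ^ (p - 1))⁻¹ * d ^ ((N : ℝ) + 2)) =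
          (T ^ (p - 1))⁻¹ * d ^ (sₚ * p - s₁ + ((N : ℝ) + 2)) := by
        rw [Real.rpow_add hd (sₚ * p - s₁)]; ring
      rw [e]
      refine mul_le_one₀ (inv_le_one_of_one_le₀ hTp) (by positivity) ?_
      have : (0 : ℝ) ≤ N := Nat.cast_nonneg N
      exact Real.rpow_le_one hd.le hd1 (by linarith))
  have hmem : ∀ w ∈ ball x₀ (d / 2), ‖d⁻¹ • (w - x₀)‖ < 1 / 2 := by
    intro w hw
    rw [mem_ball_iff_norm] at hw
    rw [norm_smul, norm_inv, Real.norm_eq_abs, abs_of_pos hd, inv_mul_lt_iff₀ hd]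
    linarith
  have h := hHo _ _ hsol _ _ (hmem y hy) (hmem y' hy')
  have hback : ∀ w : Sp N, x₀ + d • (d⁻¹ • (w - x₀)) = w := by
    intro w; simp [smul_smul, hd.ne']
  simp only [hback] at h
  rw [← mul_sub, abs_mul, abs_of_pos (inv_pos.2 hS0), inv_mul_le_iff₀ hS0, ← smul_sub,
    sub_sub_sub_cancel_right, norm_smul, norm_inv, Real.norm_eq_abs, abs_of_pos hd,
    Real.mul_rpow (by positivity) (norm_nonneg _), Real.inv_rpow hd.le, ← Real.rpow_neg hd.le] at h
  refine h.trans_eq ?_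
  rw [hS, neg_add, Real.rpow_add hd]
  ring

/-- Pairs closer than ρ obey the local bound; for the others ‖x - y‖ / ρ ≥ 1, so the sup bound is
enough. -/
theorem holder_of_local {v : Sp N → ℝ} {B : Set (Sp N)} {γ A M ρ : ℝ} (hγ : 0 ≤ γ) (hA : 0 ≤ A)
    (hρ : 0 < ρ) (hM : ∀ x ∈ B, |v x| ≤ M)
    (h : ∀ x ∈ B, ∀ y ∈ ball x ρ, |v x - v y| ≤ A * ‖x - y‖ ^ γ) {x y : Sp N} (hx : x ∈ B)
    (hy : y ∈ B) : |v x - v y| ≤ (A + 2 * M * ρ⁻¹ ^ γ) * ‖x - y‖ ^ γ := by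
  have hM0 : 0 ≤ M := (abs_nonneg _).trans (hM x hx)
  rw [add_mul]
  by_cases hxy : ‖x - y‖ < ρ
  · have := h x hx y (by rwa [mem_ball', dist_eq_norm])
    have : 0 ≤ 2 * M * ρ⁻¹ ^ γ * ‖x - y‖ ^ γ := by positivity
    linarith
  · have h1 : 1 ≤ (ρ⁻¹ * ‖x - y‖) ^ γ := by
      refine Real.one_le_rpow ?_ hγ
      rw [inv_mul_eq_div, one_le_div hρ]
      linarith
    rw [Real.mul_rpow (by positivity) (norm_nonneg _)] at h1
    have h2 : |v x - v y| ≤ 2 * M * 1 := by linarith [abs_sub (v x) (v y), hM x hx, hM y hy]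
    have h3 : 2 * M * 1 ≤ 2 * M * (ρ⁻¹ ^ γ * ‖x - y‖ ^ γ) := by gcongr
    have : 0 ≤ A * ‖x - y‖ ^ γ := by positivity
    linarith

theorem holderSeminorm_le {v : Sp N → ℝ} {γ A : ℝ} {B : Set (Sp N)}
    (h : ∀ x ∈ B, ∀ y ∈ B, |v x - v y| ≤ A * ‖x - y‖ ^ γ) :
    holderSeminorm v γ B ≤ ENNReal.ofReal A := by
  refine iSup₂_le fun x hx => iSup₂_le fun y hy => iSup_le fun hxy => ENNReal.ofReal_le_ofReal ?_
  rw [div_le_iff₀ (Real.rpow_pos_of_pos (norm_pos_iff.2 (sub_ne_zero.2 hxy)) _)]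
  exact h x hx y hy

/-! ### Moving the centre of the tail -/

/-- Points inside B_R(x₀) are handled by the sup bound and the truncated kernel, as they are at
distance at least R - r from x. Outside B_R(x₀), ‖y - x‖ ≥ ‖y - x₀‖ - r ≥ (R - r)‖y - x₀‖, where the
last inequality uses R < 1. -/
theorem tailIntegral_le_of_center {v : Sp N → ℝ} {p sₚ : ℝ} (hp : 1 < p) (hs : 0 < sₚ * p)
    {x₀ x : Sp N} {R r T : ℝ} (hrR : r < R) (hR1 : R < 1) (hx : ‖x - x₀‖ < r)
    (hT : ∀ y ∈ ball x₀ R, |v y| ≤ T) :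
    tailIntegral v p sₚ x (R - r) ≤
      ENNReal.ofReal (T ^ (p - 1) * (R - r)⁻¹) * kernelMass N (sₚ * p) +
        ENNReal.ofReal ((R - r) ^ (-((N : ℝ) + sₚ * p))) * tailIntegral v p sₚ x₀ R := by
  set d := R - r with hd
  have hd0 : 0 < d := by rw [hd]; linarith
  have hr0 : 0 < r := (norm_nonneg _).trans_lt hx
  have hT0 : 0 ≤ T := (abs_nonneg _).trans (hT x₀ (mem_ball_self (by linarith)))
  set F : Sp N → ℝ≥0∞ := fun y =>
    ENNReal.ofReal (|v y| ^ (p - 1) / ‖y - x₀‖ ^ ((N : ℝ) + sₚ * p)) with hF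
  have key : ∀ y ∈ (ball x d)ᶜ,
      ENNReal.ofReal (|v y| ^ (p - 1) / ‖y - x‖ ^ ((N : ℝ) + sₚ * p)) ≤
        ENNReal.ofReal (T ^ (p - 1) * d⁻¹) * ENNReal.ofReal (truncKernel (sₚ * p) (x - y)) +
          (ball x₀ R)ᶜ.indicator
            (fun y => ENNReal.ofReal (d ^ (-((N : ℝ) + sₚ * p))) * F y) y := by
    intro y hy
    rw [mem_compl_iff, mem_ball_iff_norm, not_lt] at hy
    by_cases hyR : y ∈ ball x₀ R
    · refine le_add_right ?_
      rw [← ENNReal.ofReal_mul (by positivity)]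
      apply ENNReal.ofReal_le_ofReal
      rw [truncKernel_sub_comm]
      have h1 := inv_rpow_le_truncKernel (s := sₚ * p) hd0 (by linarith) hy
      calc _ = |v y| ^ (p - 1) * (1 / ‖y - x‖ ^ ((N : ℝ) + sₚ * p)) := by ring
        _ ≤ T ^ (p - 1) * (d⁻¹ * truncKernel (sₚ * p) (y - x)) := by
          gcongr
          exact hT y hyR
        _ = _ := by ring
    · refine le_add_left ?_
      rw [indicator_of_mem (by exact hyR), hF, ← ENNReal.ofReal_mul (by positivity)]
      apply ENNReal.ofReal_le_ofReal
      rw [mem_ball_iff_norm, not_lt] at hyR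
      have h1 : ‖y - x₀‖ ≤ ‖y - x‖ + ‖x - x₀‖ := by
        simpa using norm_add_le (y - x) (x - x₀)
      have h2 : d * ‖y - x₀‖ ≤ ‖y - x‖ := by
        have : 0 ≤ (1 - d) * (‖y - x₀‖ - R) := mul_nonneg (by linarith) (by linarith)
        have : 0 ≤ d * (1 - R) := mul_nonneg hd0.le (by linarith)
        rw [hd] at *
        nlinarith
      have h3 : 0 < d * ‖y - x₀‖ := mul_pos hd0 (by linarith)
      have h4 : (d * ‖y - x₀‖) ^ ((N : ℝ) + sₚ * p) ≤ ‖y - x‖ ^ ((N : ℝ) + sₚ * p) :=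
        Real.rpow_le_rpow h3.le h2 (by positivity)
      calc |v y| ^ (p - 1) / ‖y - x‖ ^ ((N : ℝ) + sₚ * p)
          ≤ |v y| ^ (p - 1) / (d * ‖y - x₀‖) ^ ((N : ℝ) + sₚ * p) := by
            gcongr
        _ = _ := by
            rw [Real.mul_rpow hd0.le (norm_nonneg _), Real.rpow_neg hd0.le]
            field_simp
  calc tailIntegral v p sₚ x d
      ≤ ∫⁻ y in (ball x d)ᶜ,
          (ENNReal.ofReal (T ^ (p - 1) * d⁻¹) * ENNReal.ofReal (truncKernel (sₚ * p) (x - y)) +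
          (ball x₀ R)ᶜ.indicator
            (fun y => ENNReal.ofReal (d ^ (-((N : ℝ) + sₚ * p))) * F y) y) :=
        setLIntegral_mono' measurableSet_ball.compl key
    _ ≤ ∫⁻ y, (ENNReal.ofReal (T ^ (p - 1) * d⁻¹) * ENNReal.ofReal (truncKernel (sₚ * p) (x - y)) +
          (ball x₀ R)ᶜ.indicator
            (fun y => ENNReal.ofReal (d ^ (-((N : ℝ) + sₚ * p))) * F y) y) :=
        setLIntegral_le_lintegral _ _
    _ = _ := by
        rw [lintegral_add_left (by fun_prop), lintegral_const_mul' _ _ ENNReal.ofReal_ne_top,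
          lintegral_truncKernel_sub, lintegral_indicator measurableSet_ball.compl,
          lintegral_const_mul' _ _ ENNReal.ofReal_ne_top, tailIntegral]

/-- Off the ball, 1 + ‖y‖ is comparable to ‖y - x‖, uniformly for centres x in a bounded set. -/
theorem tailIntegral_le_of_memTailSpace {v : Sp N → ℝ} {p sₚ : ℝ} (hs : 0 < sₚ * p)
    {x : Sp N} {ε D : ℝ} (hε : 0 < ε) (hD : ‖x‖ ≤ D) :
    tailIntegral v p sₚ x ε ≤ ENNReal.ofReal (((1 + D) / ε + 1) ^ ((N : ℝ) + sₚ * p)) *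
      ∫⁻ y, ENNReal.ofReal (|v y| ^ (p - 1) / (1 + ‖y‖) ^ ((N : ℝ) + sₚ * p)) := by
  have hD0 : 0 ≤ D := (norm_nonneg _).trans hD
  rw [← lintegral_const_mul' _ _ ENNReal.ofReal_ne_top]
  refine (setLIntegral_mono' measurableSet_ball.compl fun y hy => ?_).trans
    (setLIntegral_le_lintegral _ _)
  rw [mem_compl_iff, mem_ball_iff_norm, not_lt] at hy
  rw [← ENNReal.ofReal_mul (by positivity)]
  apply ENNReal.ofReal_le_ofReal
  have h0 : 0 < ‖y - x‖ := hε.trans_le hy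
  have h1 : 1 + ‖y‖ ≤ ((1 + D) / ε + 1) * ‖y - x‖ := by
    have e1 : ‖y‖ ≤ ‖y - x‖ + ‖x‖ := by simpa using norm_add_le (y - x) x
    have e2 : 1 + D ≤ (1 + D) / ε * ‖y - x‖ := by
      rw [div_mul_eq_mul_div, le_div_iff₀ hε]
      gcongr
    linarith
  have h2 : (1 + ‖y‖) ^ ((N : ℝ) + sₚ * p) ≤
      ((1 + D) / ε + 1) ^ ((N : ℝ) + sₚ * p) * ‖y - x‖ ^ ((N : ℝ) + sₚ * p) := by
    rw [← Real.mul_rpow (by positivity) h0.le]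
    exact Real.rpow_le_rpow (by positivity) h1 (by positivity)
  rw [← mul_div_assoc, div_le_div_iff₀ (by positivity) (by positivity)]
  calc _ ≤ |v y| ^ (p - 1) * (((1 + D) / ε + 1) ^ ((N : ℝ) + sₚ * p) *
        ‖y - x‖ ^ ((N : ℝ) + sₚ * p)) := by gcongr
    _ = _ := by ring

theorem tailIntegral_congr {u v : Sp N → ℝ} {p sₚ : ℝ} {x : Sp N} {d : ℝ} (h : u =ᵐ[volume] v) :
    tailIntegral u p sₚ x d = tailIntegral v p sₚ x d := by
  refine lintegral_congr_ae (ae_restrict_of_ae ?_)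
  filter_upwards [h] with y hy
  rw [hy]

theorem tail_rpow {u : Sp N → ℝ} {p sₚ : ℝ} (hp : 1 < p) (x : Sp N) (R : ℝ) :
    tail u sₚ p x R ^ (p - 1) = ENNReal.ofReal (R ^ (sₚ * p)) * tailIntegral u p sₚ x R := by
  rw [tail, ← ENNReal.rpow_mul, one_div_mul_cancel (by linarith), ENNReal.rpow_one, tailIntegral]

theorem closedBall_subset_of_compactlyInside {Ω : Set (Sp N)} {x₀ : Sp N} {R : ℝ} (hR : R ≠ 0)
    (h : CompactlyInside (ball x₀ R) Ω) : closedBall x₀ R ⊆ Ω := by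
  rw [← closure_ball x₀ hR]
  exact h.2

theorem ae_abs_le_toReal_eLpNorm_top {u : Sp N → ℝ} {μ : Measure (Sp N)}
    (h : eLpNorm u ⊤ μ ≠ ⊤) : ∀ᵐ x ∂μ, |u x| ≤ (eLpNorm u ⊤ μ).toReal := by
  rw [eLpNorm_exponent_top] at h ⊢
  filter_upwards [ae_le_eLpNormEssSup (f := u) (μ := μ)] with x hx
  have := ENNReal.toReal_mono h hx
  simpa using this

/-- Qualitative local Hölder continuity. -/
theorem memHolderLoc_preciseRep (hN : 1 ≤ N) {p s₁ sₚ γ : ℝ} (hp : 1 < p) (hp2 : p < 2)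
    (h1 : 0 < s₁) (h11 : s₁ < 1) (hs : 0 < sₚ * p) (hsp : sₚ * p ≤ p - 1) (hγ : 0 < γ)
    (hγ1 : γ < sₚ * p / (p - 1)) {Ω : Set (Sp N)} (hΩ : IsOpen Ω) {u : Sp N → ℝ}
    (hu : IsWeakSolution Ω p s₁ sₚ u) (hbdd : MemLpLoc u ⊤ Ω) :
    MemHolderLoc (preciseRep u) γ Ω := by
  intro x₀ R hR hin
  obtain ⟨H, hH, hHo⟩ := exists_holder_half_ball hN 1 hp hp2 h1 h11 hs hsp hγ hγ1
  have hp0 : 0 < p - 1 := by linarith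
  have hloc := hu.memTail.locallyIntegrable hp.le
  have hae := preciseRep_ae_eq hloc
  have hv := hu.congr hae.symm
  set v := preciseRep u with hv_def
  have hvm : AEStronglyMeasurable v volume := hloc.aestronglyMeasurable.congr hae.symm
  have hsub := closedBall_subset_of_compactlyInside hR.ne' hin
  -- Compactness leaves room around the closed ball, so the local estimate applies at one scale ε
  -- about every point of the ball, up to its boundary.
  obtain ⟨δ, hδ, hδΩ⟩ := (isCompact_closedBall x₀ R).exists_cthickening_subset_open hΩ hsub
  set ε := min δ 1 with hε
  have hε0 : 0 < ε := lt_min hδ one_pos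
  have hε1 : ε ≤ 1 := min_le_right _ _
  rw [cthickening_closedBall hδ.le hR.le] at hδΩ
  have hbig : closedBall x₀ (ε + R) ⊆ Ω :=
    (closedBall_subset_closedBall (by linarith [min_le_left δ 1])).trans hδΩ
  have hM := hbdd _ isOpen_ball (compactlyInside_ball hbig)
  set M := (eLpNorm u ⊤ (volume.restrict (ball x₀ (ε + R)))).toReal with hM_def
  have hvM : ∀ y ∈ ball x₀ (ε + R), |v y| ≤ M := fun y hy =>
    abs_preciseRep_le isOpen_ball ENNReal.toReal_nonneg (ae_abs_le_toReal_eLpNorm_top hM.2.ne) hy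
  set I := ENNReal.ofReal (((1 + (‖x₀‖ + R)) / ε + 1) ^ ((N : ℝ) + sₚ * p)) *
      ∫⁻ y, ENNReal.ofReal (|v y| ^ (p - 1) / (1 + ‖y‖) ^ ((N : ℝ) + sₚ * p)) with hI
  have hI_top : I ≠ ⊤ := (ENNReal.mul_lt_top ENNReal.ofReal_lt_top hv.memTail.2).ne
  -- T dominates the sup bound, 1, and the (p-1)-th root of the tail bound I, so the tail condition
  -- holds with Λ = 1.
  set T := M + 1 + I.toReal ^ (1 / (p - 1)) with hT
  have hM0 : 0 ≤ M := ENNReal.toReal_nonneg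
  have hI0 : 0 ≤ I.toReal := ENNReal.toReal_nonneg
  have hIp0 : 0 ≤ I.toReal ^ (1 / (p - 1)) := by positivity
  have hTI : I ≤ ENNReal.ofReal (T ^ (p - 1) * 1) := by
    rw [← ENNReal.ofReal_toReal hI_top, mul_one]
    apply ENNReal.ofReal_le_ofReal
    calc I.toReal = (I.toReal ^ (1 / (p - 1))) ^ (p - 1) := by
          rw [← Real.rpow_mul hI0, one_div_mul_cancel hp0.ne', Real.rpow_one]
      _ ≤ T ^ (p - 1) := by
          refine Real.rpow_le_rpow hIp0 ?_ hp0.le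
          linarith
  set A := H * T * ε ^ (-(((N : ℝ) + 2) / (p - 1) + γ)) with hA
  have hA0 : 0 ≤ A := by positivity
  have hlocal : ∀ x ∈ ball x₀ R, ∀ y ∈ ball x (ε / 2), |v x - v y| ≤ A * ‖x - y‖ ^ γ := by
    intro x hx y hy
    have hball : ball x ε ⊆ ball x₀ (ε + R) := ball_subset_ball' (by linarith [mem_ball.1 hx])
    have hcball : closedBall x ε ⊆ Ω :=
      (closedBall_subset_closedBall' (by linarith [mem_ball.1 hx])).trans hbig
    refine hHo Ω v hv hvm (fun _ _ => eq_of_tendsto_average_preciseRep hloc) x ε T hε0 hε1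
      (by linarith) hcball (fun z hz => (hvM z (hball hz)).trans (by linarith)) ?_ x
      (mem_ball_self (by linarith)) y hy
    have hxn : ‖x‖ ≤ ‖x₀‖ + R := by
      have e1 : ‖x‖ ≤ ‖x₀‖ + ‖x - x₀‖ := by simpa using norm_add_le x₀ (x - x₀)
      linarith [mem_ball_iff_norm.1 hx]
    calc _ ≤ 1 * I := by
          gcongr
          · exact ENNReal.ofReal_le_one.2 (Real.rpow_le_one hε0.le hε1 (by positivity))
          · exact tailIntegral_le_of_memTailSpace hs hε0 hxn
      _ ≤ _ := by rwa [one_mul]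
  exact lt_of_le_of_lt (holderSeminorm_le fun x hx y hy => holder_of_local hγ.le hA0
    (half_pos hε0) (fun z hz => hvM z (ball_subset_ball (by linarith) hz)) hlocal hx hy)
    ENNReal.ofReal_lt_top

/-- The quantitative Hölder estimate. -/
theorem exists_holderSeminorm_le (hN : 1 ≤ N) {p s₁ sₚ γ : ℝ} (hp : 1 < p) (hp2 : p < 2)
    (h1 : 0 < s₁) (h11 : s₁ < 1) (hs : 0 < sₚ * p) (hsp : sₚ * p ≤ p - 1) (hγ : 0 < γ)
    (hγ1 : γ < sₚ * p / (p - 1)) :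
    ∃ C κ : ℝ, 0 < C ∧ 0 < κ ∧ ∀ (Ω : Set (Sp N)) (u : Sp N → ℝ), IsWeakSolution Ω p s₁ sₚ u →
      ∀ (x₀ : Sp N) (R r : ℝ), 0 < r → r < R → R < 1 → CompactlyInside (ball x₀ R) Ω →
        holderSeminorm (preciseRep u) γ (ball x₀ r) ≤
          ENNReal.ofReal C * (supPlusTail u sₚ p x₀ R + 1) / ENNReal.ofReal ((R - r) ^ κ) := by
  have hp0 : 0 < p - 1 := by linarith
  -- When the tail is recentred, the kernel mass accounts for the points inside B_R(x₀) and 1 for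
  -- the original tail.
  set Λ := (kernelMass N (sₚ * p)).toReal + 1 with hΛ
  obtain ⟨H, hH, hHo⟩ := exists_holder_half_ball hN Λ hp hp2 h1 h11 hs hsp hγ hγ1
  set κ := ((N : ℝ) + 2) / (p - 1) + γ with hκ
  have hκ0 : 0 < κ := by positivity
  have hγlt : γ ≤ 1 := by
    refine hγ1.le.trans ?_
    rwa [div_le_one hp0]
  -- H comes from close pairs, 4 from pairs at distance at least d / 2, where 2T (d/2)^{-γ} ≤ 4T
  -- d^{-κ}.
  refine ⟨H + 4, κ, by positivity, hκ0, fun Ω u hu x₀ R r hr hrR hR1 hin => ?_⟩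
  set d := R - r with hd
  have hd0 : 0 < d := by rw [hd]; linarith
  have hd1 : d ≤ 1 := by linarith
  have hR0 : 0 < R := hr.trans hrR
  by_cases htop : supPlusTail u sₚ p x₀ R = ⊤
  · rw [htop, top_add, ENNReal.mul_top (by simp; linarith),
      ENNReal.top_div_of_ne_top ENNReal.ofReal_ne_top]
    exact le_top
  have hloc := hu.memTail.locallyIntegrable hp.le
  have hae := preciseRep_ae_eq hloc
  have hv := hu.congr hae.symm
  set v := preciseRep u with hv_def
  have hvm : AEStronglyMeasurable v volume := hloc.aestronglyMeasurable.congr hae.symm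
  have hsub := closedBall_subset_of_compactlyInside hR0.ne' hin
  set T := (supPlusTail u sₚ p x₀ R).toReal + 1 with hT
  have hT1 : 1 ≤ T := le_add_of_nonneg_left ENNReal.toReal_nonneg
  have hT0 : 0 < T := by linarith
  have hTeq : ENNReal.ofReal T = supPlusTail u sₚ p x₀ R + 1 := by
    rw [hT, ENNReal.ofReal_add ENNReal.toReal_nonneg zero_le_one, ENNReal.ofReal_toReal htop,
      ENNReal.ofReal_one]
  have hsup_le : eLpNorm u ⊤ (volume.restrict (ball x₀ R)) ≤ supPlusTail u sₚ p x₀ R :=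
    le_self_add
  have htail_le : tail u sₚ p x₀ R ≤ ENNReal.ofReal T := by
    rw [hTeq]
    exact le_add_right le_add_self
  have hvT : ∀ y ∈ ball x₀ R, |v y| ≤ T := fun y hy => by
    refine (abs_preciseRep_le isOpen_ball ENNReal.toReal_nonneg
      (ae_abs_le_toReal_eLpNorm_top (ne_top_of_le_ne_top htop hsup_le)) hy).trans ?_
    linarith [ENNReal.toReal_mono htop hsup_le]
  have hTp0 : 0 ≤ T ^ (p - 1) := by positivity
  have htailR : ENNReal.ofReal (R ^ (sₚ * p)) * tailIntegral v p sₚ x₀ R ≤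
      ENNReal.ofReal (T ^ (p - 1)) := by
    rw [tailIntegral_congr hae, ← tail_rpow hp, ← ENNReal.ofReal_rpow_of_pos hT0]
    exact ENNReal.rpow_le_rpow htail_le hp0.le
  set A := H * T * d ^ (-κ) with hA
  have hA0 : 0 ≤ A := by positivity
  have hlocal : ∀ x ∈ ball x₀ r, ∀ y ∈ ball x (d / 2), |v x - v y| ≤ A * ‖x - y‖ ^ γ := by
    intro x hx y hy
    have hball : ball x d ⊆ ball x₀ R := ball_subset_ball' (by linarith [mem_ball.1 hx])
    have hcball : closedBall x d ⊆ Ω :=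
      (closedBall_subset_closedBall' (by linarith [mem_ball.1 hx])).trans hsub
    refine hHo Ω v hv hvm (fun _ _ => eq_of_tendsto_average_preciseRep hloc) x d T hd0 hd1 hT1
      hcball (fun z hz => hvT z (hball hz)) ?_ x (mem_ball_self (by linarith)) y hy
    have hc := tailIntegral_le_of_center hp hs hrR hR1 (mem_ball_iff_norm.1 hx) hvT
    have hN0 : (0 : ℝ) ≤ N := Nat.cast_nonneg N
    -- The factor d^{N+2+sₚp} outweighs the losses d^{-1} and d^{-(N+sₚp)} of recentring. Against
    -- the latter it leaves d² ≤ d^{sₚp} ≤ R^{sₚp}, the weight built into the tail.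
    calc _ ≤ ENNReal.ofReal (d ^ ((N : ℝ) + 2 + sₚ * p)) *
          (ENNReal.ofReal (T ^ (p - 1) * d⁻¹) * kernelMass N (sₚ * p) +
        ENNReal.ofReal (d ^ (-((N : ℝ) + sₚ * p))) * tailIntegral v p sₚ x₀ R) := by gcongr
      _ = ENNReal.ofReal (d ^ ((N : ℝ) + 2 + sₚ * p) * (T ^ (p - 1) * d⁻¹)) *
            kernelMass N (sₚ * p) +
          ENNReal.ofReal (d ^ ((N : ℝ) + 2 + sₚ * p) * d ^ (-((N : ℝ) + sₚ * p))) *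
            tailIntegral v p sₚ x₀ R := by
        rw [mul_add, ← mul_assoc, ← mul_assoc, ← ENNReal.ofReal_mul (by positivity),
          ← ENNReal.ofReal_mul (by positivity)]
      _ ≤ ENNReal.ofReal (T ^ (p - 1)) * kernelMass N (sₚ * p) +
          ENNReal.ofReal (R ^ (sₚ * p)) * tailIntegral v p sₚ x₀ R := by
        gcongr
        · have e : d ^ ((N : ℝ) + 2 + sₚ * p) * (T ^ (p - 1) * d⁻¹) =
              T ^ (p - 1) * d ^ ((N : ℝ) + 1 + sₚ * p) := by
            rw [show (N : ℝ) + 2 + sₚ * p = ((N : ℝ) + 1 + sₚ * p) + 1 by ring,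
              Real.rpow_add_one hd0.ne']
            field_simp
          rw [e]
          exact mul_le_of_le_one_right hTp0 (Real.rpow_le_one hd0.le hd1 (by positivity))
        · rw [← Real.rpow_add hd0]
          calc _ ≤ d ^ (sₚ * p) :=
                Real.rpow_le_rpow_of_exponent_ge hd0 hd1 (by linarith)
            _ ≤ R ^ (sₚ * p) := Real.rpow_le_rpow hd0.le (by linarith) hs.le
      _ ≤ ENNReal.ofReal (T ^ (p - 1)) * kernelMass N (sₚ * p) +
          ENNReal.ofReal (T ^ (p - 1)) := by gcongr
      _ = ENNReal.ofReal (T ^ (p - 1) * Λ) := by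
        rw [hΛ, ENNReal.ofReal_mul hTp0, ENNReal.ofReal_add ENNReal.toReal_nonneg zero_le_one,
          ENNReal.ofReal_toReal (kernelMass_lt_top hN hs (by linarith)).ne, ENNReal.ofReal_one]
        ring
  have hdκ : 0 < d ^ κ := Real.rpow_pos_of_pos hd0 _
  have hhalf : 2 * T * (d / 2)⁻¹ ^ γ ≤ 4 * T * d ^ (-κ) := by
    have e1 : (d / 2)⁻¹ ^ γ = 2 ^ γ * d ^ (-γ) := by
      rw [inv_div, Real.div_rpow zero_le_two hd0.le, Real.rpow_neg hd0.le]
      rfl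
    have e2 : (2 : ℝ) ^ γ ≤ 2 := by
      simpa using Real.rpow_le_rpow_of_exponent_le one_le_two hγlt
    have e3 : d ^ (-γ) ≤ d ^ (-κ) := by
      apply Real.rpow_le_rpow_of_exponent_ge hd0 hd1
      rw [neg_le_neg_iff, hκ]
      have : 0 ≤ ((N : ℝ) + 2) / (p - 1) := by positivity
      linarith
    rw [e1]
    calc 2 * T * (2 ^ γ * d ^ (-γ)) ≤ 2 * T * (2 * d ^ (-κ)) := by gcongr
      _ = _ := by ring
  calc holderSeminorm v γ (ball x₀ r) ≤ ENNReal.ofReal ((H + 4) * T / d ^ κ) := by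
        refine holderSeminorm_le fun x hx y hy => ?_
        refine (holder_of_local hγ.le hA0 (by linarith)
          (fun z hz => hvT z (ball_subset_ball hrR.le hz)) hlocal hx hy).trans ?_
        gcongr
        calc A + 2 * T * (d / 2)⁻¹ ^ γ ≤ A + 4 * T * d ^ (-κ) := by gcongr
          _ = _ := by rw [hA, Real.rpow_neg hd0.le]; ring
    _ = _ := by
        rw [ENNReal.ofReal_div_of_pos hdκ, ENNReal.ofReal_mul (by positivity), hTeq]

end FracOneP

theorem corollary1p3 (N : ℕ) (hN : 2 ≤ N) (p s₁ sₚ : ℝ) (hp : p ∈ Set.Ioo (1 : ℝ) 2)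
    (hs₁ : s₁ ∈ Set.Ioo (0 : ℝ) 1) (hsₚ : sₚ ∈ Set.Ioc (0 : ℝ) ((p - 1) / p))
    (γ : ℝ) (hγ : γ ∈ Set.Ioo (0 : ℝ) (sₚ * p / (p - 1))) :
    ∃ C κ : ℝ, 0 < C ∧ 0 < κ ∧
      ∀ (Ω : Set (FracOneP.Sp N)) (u : FracOneP.Sp N → ℝ),
        IsOpen Ω → IsConnected Ω → Bornology.IsBounded Ω →
        FracOneP.IsWeakSolution Ω p s₁ sₚ u → FracOneP.MemLpLoc u ⊤ Ω →
        ∃ v : FracOneP.Sp N → ℝ, v =ᵐ[volume.restrict Ω] u ∧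
          FracOneP.MemHolderLoc v γ Ω ∧
          ∀ (x₀ : FracOneP.Sp N) (R r : ℝ), 0 < r → r < R → R < 1 →
            FracOneP.CompactlyInside (Metric.ball x₀ R) Ω →
            FracOneP.holderSeminorm v γ (Metric.ball x₀ r) ≤
              ENNReal.ofReal C *
                (FracOneP.supPlusTail u sₚ p x₀ R +
                  FracOneP.gagliardo u sₚ p (Metric.ball x₀ R) + 1) /
                ENNReal.ofReal ((R - r) ^ κ) := by
  have hN1 : 1 ≤ N := by omega
  have hp0 : 0 < p := by linarith [hp.1]
  have hs : 0 < sₚ * p := mul_pos hsₚ.1 hp0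
  -- Hence sₚ p < 1 and γ < 1.
  have hsp : sₚ * p ≤ p - 1 := (le_div_iff₀ hp0).1 hsₚ.2
  obtain ⟨C, κ, hC, hκ, h⟩ := FracOneP.exists_holderSeminorm_le hN1 hp.1 hp.2 hs₁.1 hs₁.2 hs hsp
    hγ.1 hγ.2
  refine ⟨C, κ, hC, hκ, fun Ω u hΩ _ _ hu hbdd => ⟨FracOneP.preciseRep u,
    ae_restrict_of_ae (FracOneP.preciseRep_ae_eq (hu.memTail.locallyIntegrable hp.1.le)),
    FracOneP.memHolderLoc_preciseRep hN1 hp.1 hp.2 hs₁.1 hs₁.2 hs hsp hγ.1 hγ.2 hΩ hu hbdd,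
    fun x₀ R r hr hrR hR1 hin => (h Ω u hu x₀ R r hr hrR hR1 hin).trans ?_⟩⟩
  -- The estimate already holds without the Gagliardo seminorm; adding it only enlarges the right
  -- side.
  gcongr
  exact le_self_add
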